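/- **Setting.** Let $d\ge 1$, let $\Omega\subset\mathbb R^d$ be open and bounded with Lipschitz boundary, and let $\eta:[0,\infty)\to[0,\infty)$ be non-increasing, continuous at $0$, with $\eta(0)>0$, $\eta(t)=0$ for $t>1$ and $\int_{B(0,1)}\eta(|z|)\,dz=1$. Let $0<\rho_{\min}\le\rho_{\max}<\infty$. Let $\rho\in C^{1,\alpha}(\Omega)$, for some $0<\alpha\le1$, be a probability density on $\Omega$ with $\rho_{\min}\le\rho\le\rho_{\max}$, and let $x_1,\dots,x_n$ be i.i.d. random points with density $\rho$, $\mathcal X_n=\{x_1,\dots,x_n\}$, where $n\ge2$, $0<\varepsilon\le1$ and $n\varepsilon^d\ge1$. Set $\eta_\varepsilon(t)=\varepsilon^{-d}\eta(t/\varepsilon)$, $\eta^x_\varepsilon(y)=\eta_\varepsilon(|x-y|)$, $\deg(x)=\sum_{j=1}^n\eta_\varepsilon(|x-x_j|)$ and $\varepsilon_k=\varepsilon\sqrt k$. For $x\in\Omega$ the graph heat kernel $H^x_k$, $k\ge1$, is defined on $\mathcal X_n$ by $$H^x_1(x_i)=\frac{n\,\eta_\varepsilon(|x_i-x|)}{\deg(x)},\qquad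 H^x_{k+1}(x_i)=\sum_{j=1}^n\frac{\eta_\varepsilon(|x_i-x_j|)}{\deg(x_j)}H^x_k(x_j)\quad(k\ge1);$$ for a node $x\in\mathcal X_n$ this is the solution of $H^x_{k+1}=H^x_k-\mathcal L_{rw}^TH^x_k$ with $H^x_0=\delta_x$, where $\delta_x$ equals $n$ at $x$ and $0$ at the other nodes and $\mathcal L_{rw}^Tu(x_i)=u(x_i)-\sum_j\frac{\eta_\varepsilon(|x_i-x_j|)}{\deg(x_j)}u(x_j)$. Let $$\hat\rho_\varepsilon(x)=\int_\Omega\eta_\varepsilon(|x-y|)\rho(y)\,dy,\qquad \mathcal M_\varepsilon\varphi(x)=\int_\Omega\eta_\varepsilon(|x-y|)\hat\rho_\varepsilon(y)^{-1}\rho(y)\varphi(y)\,dy,$$ $$R_k=5\varepsilon+\varepsilon_k\sqrt{8d\log(k\varepsilon^{-(d+2)})},\qquad \phi_k(z)=\min\Big\{\Theta_{d,k},\,k\exp\Big(-\frac{(|z|-\varepsilon)_+^2}{8d\varepsilon_k^2}\Big)\Big\},$$ where $\Theta_{1,k}=\sqrt k$, $\Theta_{2,k}=\log(k+1)$ and $\Theta_{d,k}=\frac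 d{d-2}$ for $d\ge3$. **Theorem 4.14 (interior heat kernel asymptotics).** There exist constants $0<c<1$ and $C,K>0$, depending only on $d,\Omega,\eta,\rho_{\min},\rho_{\max}$, such that the following holds in the setting above. Let $x_0\in\Omega$, $m\ge2$, $R\ge R_m$, $0<\lambda\le1$ and $m\varepsilon^{1+\alpha}\le c$. Then, with probability at least $1-12mn^2\exp(-Cn\varepsilon^d\lambda^2)$, the estimate $$\Big|H^x_k(x_i)-\hat\rho_\varepsilon(x)^{-1}\mathcal M_\varepsilon^{k-1}\eta^x_\varepsilon(x_i)\Big|\le K\Big(\lambda\varepsilon^{-d}\phi_k(x-x_i)+\lambda\varepsilon_k^2\exp\Big(-\frac{R^2}{4d\varepsilon_k^2}\Big)\Big)$$ holds simultaneously for all $i=1,\dots,n$, all $x\in\mathcal X_n\cup\{x_0\}$ with $B(x,R)\subset\Omega$, and all $k=2,\dots,m$. -/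

import Mathlib

open MeasureTheory ProbabilityTheory
open scoped NNReal ENNReal RealInnerProductSpace

noncomputable section

namespace PoissonLearning

/-- `ℝ^d` with the Euclidean norm. -/
abbrev Pt (d : ℕ) : Type := EuclideanSpace ℝ (Fin d)

/-! ### Assumptions on the domain, the kernel profile and the density -/

/-- `Ω` has a Lipschitz boundary: around each boundary point, after a rotation of the coordinates
whose last axis is the unit vector `e`, the set `Ω` is the part of a ball lying strictly above the
graph of a Lipschitz function `γ` defined on the hyperplane orthogonal to `e`. -/
def HasLipschitzBoundary {d : ℕ} (Ω : Set (Pt d)) : Prop :=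
  ∀ z ∈ frontier Ω, ∃ e : Pt d, ‖e‖ = 1 ∧ ∃ r : ℝ, 0 < r ∧
    ∃ (L : ℝ≥0) (γ : (Submodule.span ℝ {e})ᗮ → ℝ), LipschitzWith L γ ∧
      ∀ y ∈ Metric.ball z r,
        (y ∈ Ω ↔ γ ((Submodule.span ℝ {e})ᗮ.orthogonalProjectionOnto y) < ⟪e, y⟫)

/-- An open bounded subset of `ℝ^d` with Lipschitz boundary. -/
structure IsLipschitzDomain {d : ℕ} (Ω : Set (Pt d)) : Prop where
  isOpen : IsOpen Ω
  isBounded : Bornology.IsBounded Ω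
  lipschitz_boundary : HasLipschitzBoundary Ω

/-- The assumptions on the profile `η : [0,∞) → [0,∞)`; only the values of `η` on `[0,∞)` matter. -/
structure IsKernelProfile (d : ℕ) (η : ℝ → ℝ) : Prop where
  nonneg : ∀ t, 0 ≤ t → 0 ≤ η t
  continuousAt_zero : ContinuousWithinAt η (Set.Ici 0) 0
  pos_zero : 0 < η 0
  antitone : AntitoneOn η (Set.Ici 0)
  support : ∀ t, 1 < t → η t = 0
  unit_mass : ∫ z in Metric.ball (0 : Pt d) 1, η ‖z‖ = 1

/-- `ρ` is a probability density on `Ω` with `ρmin ≤ ρ ≤ ρmax` on `Ω`. -/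
structure IsDensityBetween {d : ℕ} (Ω : Set (Pt d)) (ρmin ρmax : ℝ) (ρ : Pt d → ℝ) : Prop where
  lower : ∀ x ∈ Ω, ρmin ≤ ρ x
  upper : ∀ x ∈ Ω, ρ x ≤ ρmax
  unit_mass : ∫ x in Ω, ρ x = 1

/-- `ρ ∈ C^{1,α}(Ω)`: `ρ` is differentiable on the (open) set `Ω` and its derivative is
`α`-Hölder continuous on `Ω`. -/
def IsC1Holder {d : ℕ} (Ω : Set (Pt d)) (α : ℝ≥0) (ρ : Pt d → ℝ) : Prop :=
  (∀ x ∈ Ω, DifferentiableAt ℝ ρ x) ∧ ∃ L : ℝ≥0, HolderOnWith L α (fderiv ℝ ρ) Ω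

/-- The probability distribution on `ℝ^d` with density `ρ` on `Ω` (and no mass outside `Ω`). -/
def densityLaw {d : ℕ} (Ω : Set (Pt d)) (ρ : Pt d → ℝ) : Measure (Pt d) :=
  (volume.restrict Ω).withDensity fun x => ENNReal.ofReal (ρ x)

/-! ### The random geometric graph and its heat kernel -/

/-- `η_ε(t) = ε^{-d} η(t / ε)`. -/
def etaScaled (d : ℕ) (η : ℝ → ℝ) (ε t : ℝ) : ℝ := (ε ^ d)⁻¹ * η (t / ε)

/-- `η_ε^x(y) = η_ε(|x - y|)`. -/
def etaAt {d : ℕ} (η : ℝ → ℝ) (ε : ℝ) (x y : Pt d) : ℝ := etaScaled d η ε ‖x - y‖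

variable {d n : ℕ}

/-- `deg_{n,ε}(x) = ∑_j η_ε(|x - x_j|)`, for any point `x ∈ ℝ^d`, where `xs` is the family of
nodes `x_1, …, x_n`. -/
def degree (η : ℝ → ℝ) (ε : ℝ) (xs : Fin n → Pt d) (x : Pt d) : ℝ :=
  ∑ j, etaAt η ε x (xs j)

/-- The adjoint random walk Laplacian
`L_rw^T u (x_i) = u(x_i) - ∑_j (w_{ij} / deg(x_j)) u(x_j)` with `w_{ij} = η_ε(|x_i - x_j|)`;
functions on the nodes are written as functions of the index. -/
def adjRWLaplacian (η : ℝ → ℝ) (ε : ℝ) (xs : Fin n → Pt d) (u : Fin n → ℝ) : Fin n → ℝ :=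
  fun i => u i - ∑ j, etaAt η ε (xs i) (xs j) / degree η ε xs (xs j) * u j

open Classical in
/-- The graph delta function: `δ_x(y) = n` if `y = x`, and `δ_x(y) = 0` for all other nodes `y`. -/
def graphDelta (xs : Fin n → Pt d) (x : Pt d) : Fin n → ℝ :=
  fun i => if xs i = x then (n : ℝ) else 0

/-- The heat kernel `i ↦ H_k^x(x_i)` centred at an arbitrary point `x ∈ ℝ^d`, node or not.
It starts from `H_0^x = δ_x`, and `H_{k+1}^x = H_k^x - L_rw^T H_k^x` for `k ≥ 1`. The first step is
given by the formula `H_1^x(x_i) = n η_ε(|x_i - x|) / deg(x)`, which makes sense for every `x`.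
When `x` is one of finitely many distinct nodes this is `H_0^x - L_rw^T H_0^x`
(see `heatKernel_succ_of_node`), so that the heat equation then holds from `k = 0` on. -/
def heatKernel (η : ℝ → ℝ) (ε : ℝ) (xs : Fin n → Pt d) (x : Pt d) : ℕ → Fin n → ℝ
  | 0 => graphDelta xs x
  | 1 => fun i => (n : ℝ) * (etaAt η ε (xs i) x / degree η ε xs x)
  | (k + 2) => heatKernel η ε xs x (k + 1) - adjRWLaplacian η ε xs (heatKernel η ε xs x (k + 1))

/-- For a node of a graph with distinct nodes, `heatKernel` is the solution of the graph heat
equation started from `δ_x`. -/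
theorem heatKernel_succ_of_node (η : ℝ → ℝ) (ε : ℝ) (xs : Fin n → Pt d)
    (hxs : Function.Injective xs) (l : Fin n) (k : ℕ) :
    heatKernel η ε xs (xs l) (k + 1) =
      heatKernel η ε xs (xs l) k - adjRWLaplacian η ε xs (heatKernel η ε xs (xs l) k) := by
  cases k with
  | succ k => rfl
  | zero =>
    funext i
    simp only [heatKernel, graphDelta, adjRWLaplacian, Pi.sub_apply, hxs.eq_iff, mul_ite, mul_zero,
      Finset.sum_ite_eq', Finset.mem_univ, if_true]
    ring

/-! ### Nonlocal averaging -/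

/-- `ρ̂_ε(x) = ∫_Ω η_ε(|x - y|) ρ(y) dy`. -/
def rhoHat (Ω : Set (Pt d)) (η : ℝ → ℝ) (ρ : Pt d → ℝ) (ε : ℝ) (x : Pt d) : ℝ :=
  ∫ y in Ω, etaAt η ε x y * ρ y

/-- The nonlocal averaging operator
`M_ε φ (x) = ∫_Ω η_ε(|x - y|) ρ̂_ε(y)⁻¹ ρ(y) φ(y) dy`. -/
def averaging (Ω : Set (Pt d)) (η : ℝ → ℝ) (ρ : Pt d → ℝ) (ε : ℝ) (φ : Pt d → ℝ) : Pt d → ℝ :=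
  fun x => ∫ y in Ω, etaAt η ε x y * (rhoHat Ω η ρ ε y)⁻¹ * ρ y * φ y

/-! ### The quantities in the error term -/

/-- `ε_k = ε √k`. -/
def epsK (ε : ℝ) (k : ℕ) : ℝ := ε * √(k : ℝ)

/-- `R_k = 5 ε + ε_k √(8 d log (k ε^{-(d+2)}))`. -/
def radiusK (d : ℕ) (ε : ℝ) (k : ℕ) : ℝ :=
  5 * ε + epsK ε k * √(8 * d * Real.log (k * (ε ^ (d + 2))⁻¹))

/-- `Θ_{d,k}`, for `d ≥ 1`. -/
def Theta (d k : ℕ) : ℝ :=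
  if d = 1 then √(k : ℝ) else if d = 2 then Real.log (k + 1) else (d : ℝ) / ((d : ℝ) - 2)

/-- `φ(z) = min {Θ_{d,k}, k exp(-(|z| - ε)_+² / (8 d ε_k²))}`. -/
def phiError (ε : ℝ) (k : ℕ) (z : Pt d) : ℝ :=
  min (Theta d k) (k * Real.exp (-(max (‖z‖ - ε) 0) ^ 2 / (8 * d * epsK ε k ^ 2)))

end PoissonLearning

end

open PoissonLearning

universe u

noncomputable section

/-! Both sides of the estimate are one construction over two measures. With `w x y = η_ε(|x - y|)`,
let `A_μ` be the adjoint walk operator (`adjWalk`) of a measure `μ`. For the sampling law `μ` it is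
the averaging operator, and for the empirical measure `ν` it drives the graph heat equation
(`averaging_eq_adjWalk`, `heatKernel_eq_adjWalk`). So `deg_ν(x)⁻¹ A_ν^(k-1) w_x` is to be compared
with `deg_μ(x)⁻¹ A_μ^(k-1) w_x`.

The difference of the iterates is expanded by Duhamel's formula. Its sources `(A_ν - A_μ) A_μ^j w_x`
involve only integrals of `w` and of deterministic heat kernels against `ν - μ`. Bernstein's
inequality and a union bound control these by `lam` times the size of the heat kernel
(`exists_event_isPerturbation`, `abs_adjWalk_sub_le`).

This needs sharp upper bounds for the deterministic heat kernel. Off the diagonal, Carne-Varopoulos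
gives a Gaussian: `T ^ k` is a binomial mixture of Chebyshev polynomials of `T`, each a contraction,
and those of low degree do not see distant points because the walk has range `ε`
(`carne_varopoulos`, `heat_le_gaussian`). On the diagonal, decay like `k^(-d/2)` comes from a
nonlocal Nash inequality in a ball inside `Ω` (`nonlocal_nash`, `exists_decay_of_nash`,
`exists_heat_le`). The condition `R ≥ R_m` makes the Gaussian tail at distance about `R / 2` small
enough for the cut-off to be harmless.

The sources are transported by the `ν`-walk in two ways (`abs_iterate_sub_le`). The degree is
invariant under `A_ν`, which gives a supremum bound by the sum of `(j + 1)^(-d/2)`, that is,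
`Theta`. Carne-Varopoulos for the `ν`-walk gives a Gaussian with a polynomial loss. The Gaussian
rate obtained is `3 / 8`, against `1 / (8 d)` in `phiError`, and this room together with the
supremum bound absorbs the loss (`errorScale_le_phiError`). -/

namespace PoissonLearning

/-! ### Chebyshev polynomials and the Carne-Varopoulos bound. -/

section Varopoulos

open Polynomial

theorem two_pow_mul_X_pow_eq_sum_chebyshev (k : ℕ) :
    (2 : ℝ[X]) ^ k * X ^ k =
      ∑ i ∈ Finset.range (k + 1), (k.choose i : ℝ[X]) * Chebyshev.T ℝ (2 * (i : ℤ) - k) := by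
  induction k with
  | zero => simp
  | succ k ih =>
    have hT : ∀ n : ℤ, 2 * X * Chebyshev.T ℝ n = Chebyshev.T ℝ (n + 1) + Chebyshev.T ℝ (n - 1) := by
      intro n
      rw [Chebyshev.T_add_one]; ring
    have h1 : (2 : ℝ[X]) ^ (k + 1) * X ^ (k + 1) =
        ∑ i ∈ Finset.range (k + 1), (k.choose i : ℝ[X]) *
          (Chebyshev.T ℝ (2 * (i : ℤ) - k + 1) + Chebyshev.T ℝ (2 * (i : ℤ) - k - 1)) := by
      rw [pow_succ, pow_succ, show (2 : ℝ[X]) ^ k * 2 * (X ^ k * X) = 2 * X * (2 ^ k * X ^ k) by ring,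
        ih, Finset.mul_sum]
      refine Finset.sum_congr rfl fun i _ => ?_
      rw [← hT]; ring
    rw [h1, Finset.sum_range_succ' _ (k + 1)]
    simp only [mul_add, Finset.sum_add_distrib, Nat.choose_succ_succ, Nat.cast_add, add_mul]
    rw [Finset.sum_range_succ (fun i => ((k.choose (i + 1) : ℕ) : ℝ[X]) * _) k,
      Finset.sum_range_succ' (fun i => ((k.choose i : ℕ) : ℝ[X]) *
        Chebyshev.T ℝ (2 * (i : ℤ) - k - 1)) k]
    push_cast
    have e2 : ∀ i : ℕ, 2 * ((i : ℤ) + 1) - (k : ℤ) - 1 = 2 * (i : ℤ) - k + 1 := by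
      intro i; ring
    simp only [e2, Nat.choose_succ_self, Nat.cast_zero, zero_mul, add_zero]
    ring_nf
    rw [add_assoc, add_comm]
    congr 1
    · simp
    · refine Finset.sum_congr rfl fun i _ => ?_
      congr 2
      ring

/-- The moment generating function of the simple random walk on the integers, whose law weights the
Chebyshev polynomials in `x ^ k`. -/
theorem sum_choose_mul_exp_eq (k : ℕ) (s : ℝ) :
    ∑ i ∈ Finset.range (k + 1), (k.choose i : ℝ) * Real.exp (s * (2 * (i : ℝ) - k))
      = 2 ^ k * Real.cosh s ^ k := by
  rw [← mul_pow, Real.cosh_eq, mul_div_cancel₀ _ two_ne_zero, add_pow]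
  refine Finset.sum_congr rfl fun i hi => ?_
  have hi' : i ≤ k := by simpa [Nat.lt_succ_iff] using hi
  rw [← Real.exp_nat_mul, ← Real.exp_nat_mul, ← Real.exp_add, mul_comm]
  congr 2
  push_cast [hi']; ring

variable {V : Type*} [AddCommGroup V] [Module ℝ V]

theorem form_aeval_symm {B : LinearMap.BilinForm ℝ V} {T : Module.End ℝ V}
    (hT : ∀ f g, B (T f) g = B f (T g)) (p : ℝ[X]) (f g : V) :
    B (aeval T p f) g = B f (aeval T p g) := by
  induction p using Polynomial.induction_on' generalizing f g with
  | add p q hp hq => simp [hp, hq]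
  | monomial n a =>
    have : ∀ n : ℕ, ∀ f g, B ((T ^ n) f) g = B f ((T ^ n) g) := by
      intro n
      induction n with
      | zero => simp
      | succ n ih =>
        intro f g
        rw [pow_succ, Module.End.mul_apply, ih, hT, ← Module.End.mul_apply, ← pow_succ', pow_succ]
    simp [aeval_monomial, this]

/-- A Chebyshev polynomial of a symmetric contraction is a contraction. -/
theorem form_chebyshev_le {B : LinearMap.BilinForm ℝ V}
    {T : Module.End ℝ V} (hT : ∀ f g, B (T f) g = B f (T g)) (hc : ∀ f, B (T f) (T f) ≤ B f f)
    (n : ℤ) (f : V) :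
    B (aeval T (Chebyshev.T ℝ n) f) (aeval T (Chebyshev.T ℝ n) f) ≤ B f f := by
  -- The Pell identity `T² + (1 - X²) U² = 1`. Applied to an operator it splits `B f f` into the
  -- form of `T_n f` and a remainder that is nonnegative by contractivity.
  have key : (1 : ℝ[X]) = Chebyshev.T ℝ n * Chebyshev.T ℝ n
      + Chebyshev.U ℝ (n - 1) * ((1 - X ^ 2) * Chebyshev.U ℝ (n - 1)) := by
    have := Chebyshev.S_sq_add_S_sq ℝ (n - 1)
    have h2 := congrArg (fun p : ℝ[X] => p.comp (2 * X)) this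
    simp only [add_comp, sub_comp, mul_comp, pow_comp, X_comp, Chebyshev.S_comp_two_mul_X,
      one_comp, sub_add_cancel] at h2
    rw [Chebyshev.T_eq_U_sub_X_mul_U]
    linear_combination -h2
  set t := aeval T (Chebyshev.T ℝ n)
  set u := aeval T (Chebyshev.U ℝ (n - 1))
  have h1 : f = t (t f) + u ((u f) - T (T (u f))) := by
    have := congrArg (fun p : ℝ[X] => aeval T p f) key
    simpa [t, u, pow_two] using this
  have h2 : B f f = B (t f) (t f) + (B (u f) (u f) - B (T (u f)) (T (u f))) := by
    refine (congrArg (B f) h1).trans ?_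
    have e1 : B f (t (t f)) = B (t f) (t f) := (form_aeval_symm hT _ _ _).symm
    have e2 : B f (u (u f - T (T (u f)))) = B (u f) (u f - T (T (u f))) :=
      (form_aeval_symm hT _ _ _).symm
    rw [map_add, e1, e2, map_sub, hT (u f)]
  linarith [hc (u f)]

/-- The **Carne–Varopoulos bound** for a symmetric contraction `T` of a positive semidefinite form:
if `f` is orthogonal to `T ^ i g` for `i < N`, then `B f (T ^ k g)` is Gaussian small in `N`. -/
theorem carne_varopoulos {B : LinearMap.BilinForm ℝ V} (hpos : ∀ f, 0 ≤ B f f)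
    (hsymm : ∀ f g, B f g = B g f)
    {T : Module.End ℝ V} (hT : ∀ f g, B (T f) g = B f (T g)) (hc : ∀ f, B (T f) (T f) ≤ B f f)
    {f g : V} {N k K : ℕ} (hK : 0 < K) (hkK : k ≤ K) (hN : ∀ i < N, B f ((T ^ i) g) = 0) :
    |B f ((T ^ k) g)| ≤ 2 * Real.exp (-(N : ℝ) ^ 2 / (2 * K)) * √(B f f) * √(B g g) := by
  have hKr : (0 : ℝ) < K := by exact_mod_cast hK
  set A := √(B f f) * √(B g g)
  have hA : 0 ≤ A := by positivity
  have hCS : ∀ h, B h h ≤ B g g → |B f h| ≤ A := by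
    intro h hh
    have h0 : B f h * B h f ≤ B f f * B h h := LinearMap.BilinForm.apply_mul_apply_le_of_forall_zero_le B hpos f h
    simp only [A]
    rw [← Real.sqrt_mul (hpos f)]
    apply Real.abs_le_sqrt
    rw [hsymm h f] at h0
    nlinarith [mul_le_mul_of_nonneg_left hh (hpos f)]
  have hlow : ∀ p : ℝ[X], p.natDegree < N → B f (aeval T p g) = 0 := by
    intro p hp
    rw [aeval_eq_sum_range, LinearMap.sum_apply, map_sum]
    refine Finset.sum_eq_zero fun i hi => ?_
    rw [LinearMap.smul_apply, map_smul, hN i (by rw [Finset.mem_range] at hi; omega), smul_zero]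
  -- The minimiser of `s² K / 2 - s N`, the exponent reached at the end.
  set s : ℝ := N / K
  have hs : 0 ≤ s := by positivity
  -- A Chernoff argument: terms with `|j| < N` vanish by degree, and for the others the exponential
  -- factor is at least `1`.
  have hterm : ∀ j : ℤ, |B f (aeval T (Chebyshev.T ℝ j) g)|
      ≤ (Real.exp (s * j) + Real.exp (-s * j)) * Real.exp (-s * N) * A := by
    intro j
    by_cases hj : j.natAbs < N
    · rw [hlow _ (by rw [Chebyshev.natDegree_T]; exact hj)]
      simp only [abs_zero]; positivity
    · refine (hCS _ (form_chebyshev_le hT hc j g)).trans ?_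
      rw [add_mul, ← Real.exp_add, ← Real.exp_add]
      have hj' : (N : ℝ) ≤ |(j : ℝ)| := by
        have : (N : ℤ) ≤ |j| := by rw [Int.abs_eq_natAbs]; omega
        exact_mod_cast this
      have : 1 ≤ Real.exp (s * j + -s * N) + Real.exp (-s * j + -s * N) := by
        rcases le_total 0 (j : ℝ) with h | h
        · rw [abs_of_nonneg h] at hj'
          have : 1 ≤ Real.exp (s * j + -s * N) := Real.one_le_exp (by nlinarith)
          linarith [Real.exp_pos (-s * j + -s * N)]
        · rw [abs_of_nonpos h] at hj'
          have : 1 ≤ Real.exp (-s * j + -s * N) := Real.one_le_exp (by nlinarith)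
          linarith [Real.exp_pos (s * j + -s * N)]
      nlinarith
  have hexp : (2 : ℝ) ^ k * B f ((T ^ k) g) = ∑ i ∈ Finset.range (k + 1),
      (k.choose i : ℝ) * B f (aeval T (Chebyshev.T ℝ (2 * (i : ℤ) - k)) g) := by
    have := congrArg (fun p : ℝ[X] => B f (aeval T p g)) (two_pow_mul_X_pow_eq_sum_chebyshev k)
    have h2 : aeval T ((2 : ℝ[X]) ^ k * X ^ k) g = (2 : ℝ) ^ k • (T ^ k) g := by
      have : (2 : ℝ[X]) ^ k = C ((2 : ℝ) ^ k) := by rw [map_pow, map_ofNat]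
      rw [this, ← smul_eq_C_mul, map_smul, map_pow, aeval_X, LinearMap.smul_apply]
    simp only [h2, map_smul, smul_eq_mul] at this
    rw [this, map_sum, LinearMap.sum_apply, map_sum]
    refine Finset.sum_congr rfl fun i _ => ?_
    have : ((k.choose i : ℕ) : ℝ[X]) = C (k.choose i : ℝ) := by simp
    rw [this, ← smul_eq_C_mul, map_smul, LinearMap.smul_apply, map_smul, smul_eq_mul]
  have hsum : (2 : ℝ) ^ k * |B f ((T ^ k) g)|
      ≤ 2 * (2 ^ k * Real.cosh s ^ k) * Real.exp (-s * N) * A := by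
    calc (2 : ℝ) ^ k * |B f ((T ^ k) g)| = |(2 : ℝ) ^ k * B f ((T ^ k) g)| := by
          rw [abs_mul, abs_of_pos (by positivity : (0 : ℝ) < 2 ^ k)]
      _ ≤ ∑ i ∈ Finset.range (k + 1), (k.choose i : ℝ) *
          ((Real.exp (s * (2 * (i : ℝ) - k)) + Real.exp (-s * (2 * (i : ℝ) - k))) * Real.exp (-s * N) * A) := by
          rw [hexp]
          refine (Finset.abs_sum_le_sum_abs _ _).trans (Finset.sum_le_sum fun i _ => ?_)
          rw [abs_mul, abs_of_nonneg (by positivity : (0 : ℝ) ≤ k.choose i)]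
          have := hterm (2 * (i : ℤ) - k)
          push_cast at this
          gcongr
      _ = (∑ i ∈ Finset.range (k + 1), (k.choose i : ℝ) * Real.exp (s * (2 * (i : ℝ) - k))
          + ∑ i ∈ Finset.range (k + 1), (k.choose i : ℝ) * Real.exp (-s * (2 * (i : ℝ) - k)))
            * Real.exp (-s * N) * A := by
          rw [← Finset.sum_add_distrib, Finset.sum_mul, Finset.sum_mul]
          exact Finset.sum_congr rfl fun i _ => by ring
      _ = _ := by
          rw [sum_choose_mul_exp_eq, sum_choose_mul_exp_eq, Real.cosh_neg]; ring
  have hcosh : Real.cosh s ^ k * Real.exp (-s * N) ≤ Real.exp (-(N : ℝ) ^ 2 / (2 * K)) := by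
    calc Real.cosh s ^ k * Real.exp (-s * N) ≤ Real.cosh s ^ K * Real.exp (-s * N) := by
          gcongr
          exact Real.one_le_cosh s
      _ ≤ Real.exp (s ^ 2 / 2) ^ K * Real.exp (-s * N) := by
          gcongr
          exact Real.cosh_le_exp_half_sq s
      _ = _ := by
          rw [← Real.exp_nat_mul, ← Real.exp_add]
          congr 1
          simp only [s]; field_simp; ring
  have h2k : (0 : ℝ) < 2 ^ k := by positivity
  have : |B f ((T ^ k) g)| ≤ 2 * (Real.cosh s ^ k * Real.exp (-s * N)) * A := by
    have : (2 : ℝ) ^ k * |B f ((T ^ k) g)|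
        ≤ 2 ^ k * (2 * (Real.cosh s ^ k * Real.exp (-s * N)) * A) := by
      linarith [hsum]
    exact le_of_mul_le_mul_left this h2k
  calc _ ≤ _ := this
    _ ≤ 2 * Real.exp (-(N : ℝ) ^ 2 / (2 * K)) * A := by gcongr
    _ = _ := by simp only [A]; ring

end Varopoulos

/-! ### Random walks with symmetric weights, as operators on genuine bounded functions rather than
on classes. -/

section Kernel

variable {E : Type*} [MeasurableSpace E]

/-- The space of bounded measurable functions. -/
def boundedMeasurable (E : Type*) [MeasurableSpace E] : Submodule ℝ (E → ℝ) where
  carrier := {f | Measurable f ∧ ∃ C, ∀ x, |f x| ≤ C}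
  zero_mem' := ⟨measurable_zero, 0, fun _ => by simp⟩
  add_mem' := by
    rintro f g ⟨hf, C, hC⟩ ⟨hg, D, hD⟩
    exact ⟨hf.add hg, C + D, fun x => (abs_add_le _ _).trans (add_le_add (hC x) (hD x))⟩
  smul_mem' := by
    rintro c f ⟨hf, C, hC⟩
    refine ⟨hf.const_smul c, |c| * C, fun x => ?_⟩
    simp only [Pi.smul_apply, smul_eq_mul, abs_mul]
    exact mul_le_mul_of_nonneg_left (hC x) (abs_nonneg c)

theorem measurable_coe (f : boundedMeasurable E) : Measurable (f : E → ℝ) := f.2.1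

theorem exists_abs_le_coe (f : boundedMeasurable E) :
    ∃ C, 0 ≤ C ∧ ∀ x, |(f : E → ℝ) x| ≤ C := by
  obtain ⟨C, hC⟩ := f.2.2
  exact ⟨|C|, abs_nonneg C, fun x => (hC x).trans (le_abs_self C)⟩

theorem integrable_of_abs_le {ν : Measure E} [IsFiniteMeasure ν] {f : E → ℝ} (hf : Measurable f)
    {C : ℝ} (hC : ∀ x, |f x| ≤ C) : Integrable f ν :=
  Integrable.of_bound hf.aestronglyMeasurable C (ae_of_all _ hC)

/-- A bounded measurable symmetric nonnegative kernel. -/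
structure IsSymmKernel (w : E → E → ℝ) : Prop where
  meas : Measurable (Function.uncurry w)
  symm : ∀ x y, w x y = w y x
  nonneg : ∀ x y, 0 ≤ w x y
  bdd : ∃ C, ∀ x y, w x y ≤ C

/-- The degree of a point. -/
def kernelDeg (ν : Measure E) (w : E → E → ℝ) (x : E) : ℝ := ∫ y, w x y ∂ν

/-- The transition operator of the random walk with weights `w`. -/
def walk (ν : Measure E) (w : E → E → ℝ) (f : E → ℝ) (x : E) : ℝ :=
  (kernelDeg ν w x)⁻¹ * ∫ y, w x y * f y ∂ν

/-- The adjoint of the transition operator. -/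
def adjWalk (ν : Measure E) (w : E → E → ℝ) (φ : E → ℝ) (z : E) : ℝ :=
  ∫ y, w z y * (kernelDeg ν w y)⁻¹ * φ y ∂ν

variable {ν : Measure E} [IsFiniteMeasure ν] {w : E → E → ℝ}

namespace IsSymmKernel

theorem exists_bound (hw : IsSymmKernel w) : ∃ C, 0 ≤ C ∧ ∀ x y, |w x y| ≤ C := by
  obtain ⟨C, hC⟩ := hw.bdd
  exact ⟨|C|, abs_nonneg C, fun x y => by
    rw [abs_of_nonneg (hw.nonneg x y)]; exact (hC x y).trans (le_abs_self C)⟩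

theorem meas_left (hw : IsSymmKernel w) (x : E) : Measurable (w x) :=
  hw.meas.comp measurable_prodMk_left

theorem integrable_left (hw : IsSymmKernel w) (x : E) : Integrable (w x) ν := by
  obtain ⟨C, _, hC⟩ := hw.exists_bound
  exact integrable_of_abs_le (hw.meas_left x) (hC x)

theorem integrable_mul (hw : IsSymmKernel w) (x : E) (f : boundedMeasurable E) :
    Integrable (fun y => w x y * (f : E → ℝ) y) ν := by
  obtain ⟨C, hC0, hC⟩ := hw.exists_bound
  obtain ⟨D, hD0, hD⟩ := exists_abs_le_coe f
  refine integrable_of_abs_le ((hw.meas_left x).mul (measurable_coe f)) (C := C * D) fun y => ?_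
  rw [abs_mul]
  exact mul_le_mul (hC x y) (hD y) (abs_nonneg _) hC0

omit [IsFiniteMeasure ν] in
theorem deg_nonneg (hw : IsSymmKernel w) (x : E) : 0 ≤ kernelDeg ν w x :=
  integral_nonneg (hw.nonneg x)

theorem measurable_integral_mul (hw : IsSymmKernel w) {f : E → ℝ} (hf : Measurable f) :
    Measurable fun x => ∫ y, w x y * f y ∂ν :=
  (StronglyMeasurable.integral_prod_right
    (f := fun x y => w x y * f y)
    (hw.meas.mul (hf.comp measurable_snd)).stronglyMeasurable).measurable

theorem measurable_deg (hw : IsSymmKernel w) : Measurable (kernelDeg ν w) := by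
  unfold kernelDeg
  simpa using hw.measurable_integral_mul (ν := ν) (f := fun _ => 1) measurable_const

theorem deg_le (hw : IsSymmKernel w) :
    ∃ C, 0 ≤ C ∧ ∀ x, |kernelDeg ν w x| ≤ C := by
  obtain ⟨C, hC0, hC⟩ := hw.exists_bound
  refine ⟨C * ν.real Set.univ, by positivity, fun x => ?_⟩
  have := norm_integral_le_of_norm_le_const (μ := ν) (f := w x) (C := C) (ae_of_all _ (hC x))
  simpa [kernelDeg] using this

/-- The degree as a bounded measurable function. -/
def degB (hw : IsSymmKernel w) (ν : Measure E) [IsFiniteMeasure ν] : boundedMeasurable E :=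
  ⟨kernelDeg ν w, hw.measurable_deg, (hw.deg_le (ν := ν)).imp fun _ h => h.2⟩

theorem abs_integral_mul_le (hw : IsSymmKernel w) (x : E) {f : E → ℝ} {C : ℝ}
    (hC : ∀ x, |f x| ≤ C) : |∫ y, w x y * f y ∂ν| ≤ C * kernelDeg ν w x := by
  rw [kernelDeg, ← integral_const_mul]
  refine abs_integral_le_integral_abs.trans (integral_mono_of_nonneg ?_ ?_ ?_)
  · exact ae_of_all _ fun y => abs_nonneg _
  · exact (hw.integrable_left x).const_mul C
  · refine ae_of_all _ fun y => ?_
    simp only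
    rw [abs_mul, abs_of_nonneg (hw.nonneg x y), mul_comm]
    exact mul_le_mul_of_nonneg_right (hC y) (hw.nonneg x y)

/-- No lower bound on the degree is needed: where it vanishes, the integral of `w x` against a
bounded function vanishes too. -/
theorem deg_mul_walk (hw : IsSymmKernel w) (f : boundedMeasurable E) (x : E) :
    kernelDeg ν w x * walk ν w f x = ∫ y, w x y * (f : E → ℝ) y ∂ν := by
  rw [walk]
  by_cases h : kernelDeg ν w x = 0
  · obtain ⟨C, _, hC⟩ := exists_abs_le_coe f
    have := hw.abs_integral_mul_le (ν := ν) x hC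
    rw [h, mul_zero] at this
    rw [h, zero_mul, abs_nonpos_iff.1 this]
  · rw [mul_inv_cancel_left₀ h]

theorem abs_walk_le (hw : IsSymmKernel w) {f : E → ℝ} {C : ℝ} (hC : ∀ x, |f x| ≤ C) (x : E) :
    |walk ν w f x| ≤ C := by
  have hC0 : 0 ≤ C := (abs_nonneg _).trans (hC x)
  rw [walk, abs_mul, abs_of_nonneg (inv_nonneg.2 (hw.deg_nonneg x))]
  rcases (hw.deg_nonneg (ν := ν) x).eq_or_lt with h | h
  · rw [← h]; simpa using hC0
  · rw [inv_mul_le_iff₀ h, mul_comm]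
    exact hw.abs_integral_mul_le x hC

/-- The transition operator on bounded measurable functions. -/
def walkB (hw : IsSymmKernel w) (ν : Measure E) [IsFiniteMeasure ν] :
    Module.End ℝ (boundedMeasurable E) where
  toFun f := ⟨walk ν w f, hw.measurable_deg.inv.mul (hw.measurable_integral_mul (measurable_coe f)),
    (exists_abs_le_coe f).imp fun _ h => hw.abs_walk_le h.2⟩
  map_add' f g := by
    ext x
    simp only [walk, Submodule.coe_add, Pi.add_apply, mul_add]
    rw [integral_add (hw.integrable_mul x f) (hw.integrable_mul x g), mul_add]
  map_smul' c f := by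
    ext x
    change walk ν w (c • (f : E → ℝ)) x = c * walk ν w f x
    rw [walk, walk, mul_left_comm, ← integral_const_mul c]
    simp only [Pi.smul_apply, smul_eq_mul, mul_left_comm c]

@[simp] theorem walkB_apply (hw : IsSymmKernel w) (f : boundedMeasurable E) (x : E) :
    (hw.walkB ν f : E → ℝ) x = walk ν w f x := rfl

theorem integrable_mul_mul_deg (hw : IsSymmKernel w) (f g : boundedMeasurable E) :
    Integrable (fun x => (f : E → ℝ) x * (g : E → ℝ) x * kernelDeg ν w x) ν := by
  obtain ⟨C, hC0, hC⟩ := exists_abs_le_coe f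
  obtain ⟨D, hD0, hD⟩ := exists_abs_le_coe g
  obtain ⟨K, hK0, hK⟩ := hw.deg_le (ν := ν)
  refine integrable_of_abs_le (((measurable_coe f).mul (measurable_coe g)).mul hw.measurable_deg)
    (C := C * D * K) fun x => ?_
  simp only [abs_mul]
  have := hC x; have := hD x; have := hK x
  gcongr

/-- The inner product with respect to the stationary measure of the walk. -/
def form (hw : IsSymmKernel w) (ν : Measure E) [IsFiniteMeasure ν] :
    LinearMap.BilinForm ℝ (boundedMeasurable E) :=
  LinearMap.mk₂ ℝ (fun f g => ∫ x, (f : E → ℝ) x * (g : E → ℝ) x * kernelDeg ν w x ∂ν)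
    (fun f₁ f₂ g => by
      rw [← integral_add (hw.integrable_mul_mul_deg f₁ g) (hw.integrable_mul_mul_deg f₂ g)]
      simp only [Submodule.coe_add, Pi.add_apply, add_mul])
    (fun c f g => by
      rw [smul_eq_mul, ← integral_const_mul]
      simp only [Submodule.coe_smul, Pi.smul_apply, smul_eq_mul, mul_assoc])
    (fun f g₁ g₂ => by
      rw [← integral_add (hw.integrable_mul_mul_deg f g₁) (hw.integrable_mul_mul_deg f g₂)]
      simp only [Submodule.coe_add, Pi.add_apply, add_mul, mul_add])
    (fun c f g => by
      rw [smul_eq_mul, ← integral_const_mul]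
      congr 1; ext x
      simp only [Submodule.coe_smul, Pi.smul_apply, smul_eq_mul]; ring)

theorem form_apply (hw : IsSymmKernel w) (f g : boundedMeasurable E) :
    hw.form ν f g = ∫ x, (f : E → ℝ) x * (g : E → ℝ) x * kernelDeg ν w x ∂ν := rfl

theorem form_self_nonneg (hw : IsSymmKernel w) (f : boundedMeasurable E) : 0 ≤ hw.form ν f f :=
  integral_nonneg fun x => mul_nonneg (mul_self_nonneg _) (hw.deg_nonneg x)

theorem form_comm (hw : IsSymmKernel w) (f g : boundedMeasurable E) :
    hw.form ν f g = hw.form ν g f := by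
  simp only [form_apply, mul_comm ((f : E → ℝ) _)]

theorem integrable_prod (hw : IsSymmKernel w) (f g : boundedMeasurable E) :
    Integrable (Function.uncurry fun x y => w x y * (f : E → ℝ) y * (g : E → ℝ) x) (ν.prod ν) := by
  obtain ⟨C, hC0, hC⟩ := exists_abs_le_coe f
  obtain ⟨D, hD0, hD⟩ := exists_abs_le_coe g
  obtain ⟨K, hK0, hK⟩ := hw.exists_bound
  refine integrable_of_abs_le ((hw.meas.mul ((measurable_coe f).comp measurable_snd)).mul
    ((measurable_coe g).comp measurable_fst)) (C := K * C * D) ?_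
  rintro ⟨x, y⟩
  have := hC y; have := hD x; have := hK x y
  change |w x y * (f : E → ℝ) y * (g : E → ℝ) x| ≤ _
  rw [abs_mul, abs_mul]
  gcongr

theorem form_walkB_left (hw : IsSymmKernel w) (f g : boundedMeasurable E) :
    hw.form ν (hw.walkB ν f) g = ∫ x, ∫ y, w x y * (f : E → ℝ) y * (g : E → ℝ) x ∂ν ∂ν := by
  rw [form_apply]
  congr 1; ext x
  rw [integral_mul_const, ← hw.deg_mul_walk, walkB_apply]; ring

theorem form_walkB (hw : IsSymmKernel w) (f g : boundedMeasurable E) :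
    hw.form ν (hw.walkB ν f) g = hw.form ν f (hw.walkB ν g) := by
  rw [form_comm _ f, form_walkB_left, form_walkB_left, integral_integral_swap (hw.integrable_prod f g)]
  congr 1; ext x; congr 1; ext y
  rw [hw.symm]; ring

/-- `∫ f² deg - ∫ (Q f)² deg` is the mean variance of one step of the walk. -/
theorem form_sub_form_walkB (hw : IsSymmKernel w) (f : boundedMeasurable E) :
    hw.form ν f f - hw.form ν (hw.walkB ν f) (hw.walkB ν f) =
      ∫ u, ∫ x, w u x * ((f : E → ℝ) x - walk ν w f u) ^ 2 ∂ν ∂ν := by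
  obtain ⟨C, hC0, hC⟩ := exists_abs_le_coe f
  -- The square and the constant `1` are packaged as bounded functions so that `integrable_prod`
  -- justifies exchanging the integrals.
  let f2 : boundedMeasurable E := ⟨fun x => (f : E → ℝ) x ^ 2, (measurable_coe f).pow_const 2, C ^ 2, fun x => by
    rw [abs_pow]; gcongr; exact hC x⟩
  let one : boundedMeasurable E := ⟨fun _ => 1, measurable_const, 1, fun x => by simp⟩
  have hin : ∀ u, ∫ x, w u x * ((f : E → ℝ) x - walk ν w f u) ^ 2 ∂ν =
      ∫ x, w u x * (f2 : E → ℝ) x * (one : E → ℝ) u ∂ν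
        - walk ν w f u * walk ν w f u * kernelDeg ν w u := by
    intro u
    have h1 : ∀ x, w u x * ((f : E → ℝ) x - walk ν w f u) ^ 2 =
        w u x * (f2 : E → ℝ) x * (one : E → ℝ) u - 2 * walk ν w f u * (w u x * (f : E → ℝ) x)
          + walk ν w f u ^ 2 * w u x := by
      intro x; simp only [f2, one]; ring
    simp only [h1]
    have i1 : Integrable (fun x => w u x * (f2 : E → ℝ) x * (one : E → ℝ) u) ν :=
      (hw.integrable_mul u f2).mul_const _
    have i2 := (hw.integrable_mul (ν := ν) u f).const_mul (2 * walk ν w f u)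
    have i3 := (hw.integrable_left (ν := ν) u).const_mul (walk ν w f u ^ 2)
    have i12 : Integrable (fun x => w u x * (f2 : E → ℝ) x * (one : E → ℝ) u
      - 2 * walk ν w f u * (w u x * (f : E → ℝ) x)) ν := i1.sub i2
    rw [integral_add i12 i3, integral_sub i1 i2, integral_const_mul, integral_const_mul,
      ← hw.deg_mul_walk f u]
    simp only [kernelDeg]; ring
  simp only [hin]
  rw [integral_sub, integral_integral_swap (hw.integrable_prod f2 one), form_apply, form_apply]
  · congr 1
    congr 1; ext x
    have : ∀ y, w y x * (f2 : E → ℝ) x * (one : E → ℝ) y = (f : E → ℝ) x * (f : E → ℝ) x * w x y := by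
      intro y; simp only [f2, one]; rw [hw.symm]; ring
    simp only [this]
    rw [integral_const_mul, kernelDeg]
  · exact (hw.integrable_prod f2 one).integral_prod_left
  · exact hw.integrable_mul_mul_deg (hw.walkB ν f) (hw.walkB ν f)

theorem form_walkB_self_le (hw : IsSymmKernel w) (f : boundedMeasurable E) :
    hw.form ν (hw.walkB ν f) (hw.walkB ν f) ≤ hw.form ν f f := by
  rw [← sub_nonneg, form_sub_form_walkB]
  exact integral_nonneg fun u => integral_nonneg fun x =>
    mul_nonneg (hw.nonneg u x) (sq_nonneg _)

/-- The one-step density of the walk started at `x`, with respect to the stationary measure and up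
to the normalisation by the degree of `x`; it is cut off where the degree is below `c`. -/
def seed (hw : IsSymmKernel w) (ν : Measure E) [IsFiniteMeasure ν] {c : ℝ} (hc : 0 < c) (x : E) :
    boundedMeasurable E :=
  ⟨fun y => {y | c ≤ kernelDeg ν w y}.indicator (fun y => w x y / kernelDeg ν w y) y,
    ((hw.meas_left x).div hw.measurable_deg).indicator
      (measurableSet_le measurable_const hw.measurable_deg),
    by
      obtain ⟨C, hC0, hC⟩ := hw.exists_bound
      refine ⟨C / c, fun y => ?_⟩
      beta_reduce
      by_cases hy : c ≤ kernelDeg ν w y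
      · rw [Set.indicator_of_mem (by exact hy), abs_div, abs_of_pos (hc.trans_le hy)]
        exact div_le_div₀ hC0 (hC x y) hc hy
      · rw [Set.indicator_of_notMem (by exact hy), abs_zero]; positivity⟩

theorem seed_apply (hw : IsSymmKernel w) {c : ℝ} (hc : 0 < c) (x : E) {y : E}
    (hy : c ≤ kernelDeg ν w y) : (hw.seed ν hc x : E → ℝ) y = w x y / kernelDeg ν w y :=
  Set.indicator_of_mem (s := {y | c ≤ kernelDeg ν w y}) hy fun y => w x y / kernelDeg ν w y

theorem seed_nonneg (hw : IsSymmKernel w) {c : ℝ} (hc : 0 < c) (x y : E) :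
    0 ≤ (hw.seed ν hc x : E → ℝ) y :=
  Set.indicator_nonneg (fun y _ => div_nonneg (hw.nonneg x y) (hw.deg_nonneg y)) y

/-- The transition density of the walk after `k + 1` steps, normalised as `seed`. -/
def heat (hw : IsSymmKernel w) (ν : Measure E) [IsFiniteMeasure ν] {c : ℝ} (hc : 0 < c) (k : ℕ)
    (x : E) : boundedMeasurable E := (hw.walkB ν ^ k) (hw.seed ν hc x)

theorem heat_zero (hw : IsSymmKernel w) {c : ℝ} (hc : 0 < c) (x : E) :
    hw.heat ν hc 0 x = hw.seed ν hc x := rfl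

theorem heat_succ (hw : IsSymmKernel w) {c : ℝ} (hc : 0 < c) (k : ℕ) (x : E) :
    hw.heat ν hc (k + 1) x = hw.walkB ν (hw.heat ν hc k x) := by
  rw [heat, pow_succ', Module.End.mul_apply, ← heat]

theorem heat_nonneg (hw : IsSymmKernel w) {c : ℝ} (hc : 0 < c) (k : ℕ) (x y : E) :
    0 ≤ (hw.heat ν hc k x : E → ℝ) y := by
  induction k generalizing y with
  | zero => exact hw.seed_nonneg hc x y
  | succ k ih =>
    rw [heat_succ, walkB_apply, walk]
    exact mul_nonneg (inv_nonneg.2 (hw.deg_nonneg y))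
      (integral_nonneg fun z => mul_nonneg (hw.nonneg y z) (ih z))

theorem measurable_heat (hw : IsSymmKernel w) {c : ℝ} (hc : 0 < c) (k : ℕ) :
    Measurable (Function.uncurry fun x y => (hw.heat ν hc k x : E → ℝ) y) := by
  induction k with
  | zero =>
    have hm : MeasurableSet {q : E × E | c ≤ kernelDeg ν w q.2} :=
      measurableSet_le measurable_const (hw.measurable_deg.comp measurable_snd)
    exact (hw.meas.div (hw.measurable_deg.comp measurable_snd)).indicator hm
  | succ k ih =>
    have : (Function.uncurry fun x y => (hw.heat ν hc (k + 1) x : E → ℝ) y) = fun q : E × E =>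
        (kernelDeg ν w q.2)⁻¹ * ∫ u, w q.2 u * (hw.heat ν hc k q.1 : E → ℝ) u ∂ν := by
      ext ⟨x, y⟩
      simp only [Function.uncurry, heat_succ, walkB_apply, walk]
    rw [this]
    refine (hw.measurable_deg.comp measurable_snd).inv.mul ?_
    refine (StronglyMeasurable.integral_prod_right
      (f := fun (q : E × E) u => w q.2 u * (hw.heat ν hc k q.1 : E → ℝ) u) ?_).measurable
    refine Measurable.stronglyMeasurable ?_
    exact (hw.meas.comp ((measurable_snd.comp measurable_fst).prodMk measurable_snd)).mul
      (ih.comp ((measurable_fst.comp measurable_fst).prodMk measurable_snd))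

theorem form_seed (hw : IsSymmKernel w) {c : ℝ} (hc : 0 < c)
    (hae : ∀ᵐ y ∂ν, c ≤ kernelDeg ν w y) (z : E) (f : boundedMeasurable E) :
    hw.form ν (hw.seed ν hc z) f = ∫ y, w z y * (f : E → ℝ) y ∂ν := by
  rw [form_apply]
  refine integral_congr_ae (hae.mono fun y hy => ?_)
  simp only
  have : kernelDeg ν w y ≠ 0 := (hc.trans_le hy).ne'
  rw [hw.seed_apply hc z hy]; field_simp

theorem deg_mul_heat_succ (hw : IsSymmKernel w) {c : ℝ} (hc : 0 < c)
    (hae : ∀ᵐ y ∂ν, c ≤ kernelDeg ν w y) (k : ℕ) (x y : E) :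
    kernelDeg ν w y * (hw.heat ν hc (k + 1) x : E → ℝ) y
      = hw.form ν (hw.seed ν hc y) (hw.heat ν hc k x) := by
  rw [hw.form_seed hc hae, heat_succ, walkB_apply, hw.deg_mul_walk]

omit [IsFiniteMeasure ν] in
theorem adjWalk_congr {φ ψ : E → ℝ} (h : φ =ᵐ[ν] ψ) : adjWalk ν w φ = adjWalk ν w ψ := by
  ext z
  exact integral_congr_ae (h.mono fun y hy => by simp only [hy])

/-- Detailed balance: multiplication by the degree intertwines the walk and its adjoint, so bounds
for the self-adjoint `walkB` carry over to `adjWalk`. -/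
theorem adjWalk_deg_mul (hw : IsSymmKernel w) {c : ℝ} (hc : 0 < c)
    (hae : ∀ᵐ y ∂ν, c ≤ kernelDeg ν w y) (f : boundedMeasurable E) :
    adjWalk ν w (fun y => kernelDeg ν w y * (f : E → ℝ) y)
      = fun z => kernelDeg ν w z * (hw.walkB ν f : E → ℝ) z := by
  ext z
  rw [walkB_apply, hw.deg_mul_walk, adjWalk]
  refine integral_congr_ae (hae.mono fun y hy => ?_)
  simp only
  have : kernelDeg ν w y ≠ 0 := (hc.trans_le hy).ne'
  field_simp

theorem adjWalk_iterate_deg_mul (hw : IsSymmKernel w) {c : ℝ} (hc : 0 < c)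
    (hae : ∀ᵐ y ∂ν, c ≤ kernelDeg ν w y) (f : boundedMeasurable E) (k : ℕ) :
    (adjWalk ν w)^[k] (fun y => kernelDeg ν w y * (f : E → ℝ) y)
      = fun z => kernelDeg ν w z * ((hw.walkB ν ^ k) f : E → ℝ) z := by
  induction k with
  | zero => rfl
  | succ k ih =>
    rw [Function.iterate_succ_apply', ih, hw.adjWalk_deg_mul hc hae, pow_succ',
      Module.End.mul_apply]

theorem deg_mul_seed_ae (hw : IsSymmKernel w) {c : ℝ} (hc : 0 < c)
    (hae : ∀ᵐ y ∂ν, c ≤ kernelDeg ν w y) (x : E) :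
    w x =ᵐ[ν] fun y => kernelDeg ν w y * (hw.seed ν hc x : E → ℝ) y := by
  filter_upwards [hae] with y hy
  have : kernelDeg ν w y ≠ 0 := (hc.trans_le hy).ne'
  rw [hw.seed_apply hc x hy]; field_simp

theorem adjWalk_iterate_kernel (hw : IsSymmKernel w) {c : ℝ} (hc : 0 < c)
    (hae : ∀ᵐ y ∂ν, c ≤ kernelDeg ν w y) (x : E) (k : ℕ) {z : E} (hz : c ≤ kernelDeg ν w z) :
    (adjWalk ν w)^[k] (w x) z = kernelDeg ν w z * (hw.heat ν hc k x : E → ℝ) z := by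
  cases k with
  | zero =>
    have : kernelDeg ν w z ≠ 0 := (hc.trans_le hz).ne'
    rw [heat_zero, hw.seed_apply hc x hz, Function.iterate_zero, id]; field_simp
  | succ k =>
    -- `w x` and degree times `seed` agree only almost everywhere, but one application of `adjWalk`
    -- makes them agree at every point.
    rw [heat, ← congrFun (hw.adjWalk_iterate_deg_mul hc hae _ (k + 1)) z, Function.iterate_succ_apply,
      Function.iterate_succ_apply, adjWalk_congr (hw.deg_mul_seed_ae hc hae x)]

theorem form_pow_walkB (hw : IsSymmKernel w) (k : ℕ) (f g : boundedMeasurable E) :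
    hw.form ν ((hw.walkB ν ^ k) f) g = hw.form ν f ((hw.walkB ν ^ k) g) := by
  have := form_aeval_symm (B := hw.form ν) (T := hw.walkB ν) hw.form_walkB (Polynomial.X ^ k) f g
  simpa using this

/-- The kernel representation of the iterates of the adjoint walk. -/
theorem adjWalk_iterate_succ_eq (hw : IsSymmKernel w) {c : ℝ} (hc : 0 < c)
    (hae : ∀ᵐ y ∂ν, c ≤ kernelDeg ν w y) (φ : boundedMeasurable E) (k : ℕ) (z : E) :
    (adjWalk ν w)^[k + 1] φ z = ∫ y, (hw.heat ν hc k z : E → ℝ) y * (φ : E → ℝ) y ∂ν := by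
  obtain ⟨C, hC0, hC⟩ := exists_abs_le_coe φ
  let ψ : boundedMeasurable E :=
    ⟨fun y => {y | c ≤ kernelDeg ν w y}.indicator (fun y => (φ : E → ℝ) y / kernelDeg ν w y) y,
      ((measurable_coe φ).div hw.measurable_deg).indicator
        (measurableSet_le measurable_const hw.measurable_deg), C / c, fun y => by
      beta_reduce
      by_cases hy : c ≤ kernelDeg ν w y
      · rw [Set.indicator_of_mem (by exact hy), abs_div, abs_of_pos (hc.trans_le hy)]
        exact div_le_div₀ hC0 (hC y) hc hy
      · rw [Set.indicator_of_notMem (by exact hy), abs_zero]; positivity⟩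
  have hψ : (φ : E → ℝ) =ᵐ[ν] fun y => kernelDeg ν w y * (ψ : E → ℝ) y := by
    filter_upwards [hae] with y hy
    have : kernelDeg ν w y ≠ 0 := (hc.trans_le hy).ne'
    simp only [ψ]
    rw [Set.indicator_of_mem (by exact hy)]; field_simp
  rw [Function.iterate_succ_apply, adjWalk_congr hψ, ← Function.iterate_succ_apply (adjWalk ν w),
    hw.adjWalk_iterate_deg_mul hc hae ψ]
  simp only
  -- One of the `k + 1` steps turns into `seed z`; self-adjointness then moves the other `k` onto
  -- it, which produces `heat k z`.
  rw [pow_succ', Module.End.mul_apply, walkB_apply, hw.deg_mul_walk, ← hw.form_seed hc hae,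
    ← form_pow_walkB, form_apply]
  refine integral_congr_ae (hψ.mono fun y hy => ?_)
  simp only at hy ⊢
  rw [hy, heat]; ring

/-- The Chapman-Kolmogorov relation. With `deg_mul_heat_succ`, it expresses a heat kernel at time `i
+ j + 2` as an inner product of two earlier ones. -/
theorem form_heat_heat (hw : IsSymmKernel w) {c : ℝ} (hc : 0 < c) (i j : ℕ) (x y : E) :
    hw.form ν (hw.heat ν hc i x) (hw.heat ν hc j y)
      = hw.form ν (hw.seed ν hc x) (hw.heat ν hc (i + j) y) := by
  rw [heat, form_pow_walkB, heat, heat, pow_add, Module.End.mul_apply]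

theorem form_sq_le (hw : IsSymmKernel w) (f g : boundedMeasurable E) :
    |hw.form ν f g| ≤ √(hw.form ν f f) * √(hw.form ν g g) := by
  have h0 := LinearMap.BilinForm.apply_mul_apply_le_of_forall_zero_le (hw.form ν)
    hw.form_self_nonneg f g
  rw [← Real.sqrt_mul (hw.form_self_nonneg f)]
  apply Real.abs_le_sqrt
  rw [hw.form_comm g f] at h0
  linarith

theorem form_seed_self_le (hw : IsSymmKernel w) {c b : ℝ} (hc : 0 < c)
    (hae : ∀ᵐ y ∂ν, c ≤ kernelDeg ν w y) (hb : ∀ x y, w x y ≤ b) (x : E) :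
    hw.form ν (hw.seed ν hc x) (hw.seed ν hc x) ≤ b / c * kernelDeg ν w x := by
  rw [hw.form_seed hc hae, kernelDeg, ← integral_const_mul]
  refine integral_mono_ae (hw.integrable_mul x _) ((hw.integrable_left x).const_mul _)
    (hae.mono fun y hy => ?_)
  simp only
  rw [hw.seed_apply hc x hy, mul_comm]
  exact mul_le_mul_of_nonneg_right
    (div_le_div₀ ((hw.nonneg x y).trans (hb x y)) (hb x y) hc hy) (hw.nonneg x y)

end IsSymmKernel
end Kernel

/-! ### Gaussian bounds for walks of range `ε`. -/

section FiniteRange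

variable {E : Type*} [MeasurableSpace E] [PseudoMetricSpace E] {ν : Measure E} [IsFiniteMeasure ν]
  {w : E → E → ℝ} {ε : ℝ}

namespace IsSymmKernel

theorem heat_eq_zero (hw : IsSymmKernel w) {c : ℝ} (hc : 0 < c)
    (hr : ∀ x y, ε < dist x y → w x y = 0) (k : ℕ) {x y : E} (hxy : (k + 1) * ε < dist x y) :
    (hw.heat ν hc k x : E → ℝ) y = 0 := by
  induction k generalizing y with
  | zero =>
    have h0 : w x y = 0 := hr x y (by simpa using hxy)
    change {y | c ≤ kernelDeg ν w y}.indicator (fun y => w x y / kernelDeg ν w y) y = 0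
    rw [Set.indicator_apply, h0]; simp
  | succ k ih =>
    rw [heat_succ, walkB_apply, walk]
    have : ∀ z, w y z * (hw.heat ν hc k x : E → ℝ) z = 0 := by
      intro z
      by_cases hz : ε < dist y z
      · rw [hr y z hz, zero_mul]
      · rw [ih, mul_zero]
        push_cast at hxy
        have := dist_triangle_right x y z
        nlinarith
    simp [this]

/-- The supports are disjoint: `seed y` reaches one step from `y` and `heat k x` reaches `k + 1`
steps from `x`. -/
theorem form_seed_heat_eq_zero (hw : IsSymmKernel w) {c : ℝ} (hc : 0 < c)
    (hr : ∀ x y, ε < dist x y → w x y = 0) (k : ℕ) {x y : E} (hxy : (k + 2) * ε < dist x y) :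
    hw.form ν (hw.seed ν hc y) (hw.heat ν hc k x) = 0 := by
  rw [form_apply]
  have : ∀ z, (hw.seed ν hc y : E → ℝ) z * (hw.heat ν hc k x : E → ℝ) z * kernelDeg ν w z = 0 := by
    intro z
    by_cases hz : ε < dist y z
    · rw [← heat_zero, hw.heat_eq_zero hc hr 0 (by simpa using hz)]; ring
    · rw [hw.heat_eq_zero hc hr k (x := x)]
      · ring
      · have := dist_triangle_right x y z
        nlinarith
  simp [this]

/-- Carne-Varopoulos applied to the two seeds. Each seed already uses one step, hence the loss of `2
ε` in the distance. -/
theorem form_seed_heat_le (hw : IsSymmKernel w) {c b : ℝ} (hc : 0 < c) (hε : 0 < ε)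
    (hr : ∀ x y, ε < dist x y → w x y = 0) (hb : ∀ x y, w x y ≤ b)
    (hae : ∀ᵐ y ∂ν, c ≤ kernelDeg ν w y) {k K : ℕ} (hK : 0 < K) (hkK : k ≤ K) {x y : E} {C : ℝ}
    (hx : kernelDeg ν w x ≤ C) (hy : kernelDeg ν w y ≤ C) :
    hw.form ν (hw.seed ν hc y) (hw.heat ν hc k x)
      ≤ 2 * Real.exp (-(max (dist x y - 2 * ε) 0) ^ 2 / (2 * K * ε ^ 2)) * (b / c * C) := by
  have hb0 : 0 ≤ b := (hw.nonneg x y).trans (hb x y)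
  set N : ℕ := ⌈max (dist x y - 2 * ε) 0 / ε⌉₊
  have hN : ∀ i < N, hw.form ν (hw.seed ν hc y) ((hw.walkB ν ^ i) (hw.seed ν hc x)) = 0 := by
    intro i hi
    refine hw.form_seed_heat_eq_zero hc hr i ?_
    rw [Nat.lt_ceil, lt_div_iff₀ hε, lt_max_iff] at hi
    rcases hi with hi | hi
    · linarith
    · exfalso; have : (0 : ℝ) ≤ i * ε := by positivity
      linarith
  have h1 := carne_varopoulos hw.form_self_nonneg hw.form_comm hw.form_walkB hw.form_walkB_self_le
    hK hkK hN
  refine (le_abs_self _).trans (h1.trans ?_)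
  have hKr : (0 : ℝ) < K := by exact_mod_cast hK
  have hNle : max (dist x y - 2 * ε) 0 / ε ≤ N := Nat.le_ceil _
  have hsx := (hw.form_seed_self_le hc hae hb x).trans
    (mul_le_mul_of_nonneg_left hx (by positivity : 0 ≤ b / c))
  have hsy := (hw.form_seed_self_le hc hae hb y).trans
    (mul_le_mul_of_nonneg_left hy (by positivity : 0 ≤ b / c))
  have hC : 0 ≤ b / c * C := (hw.form_self_nonneg _).trans hsx
  have hexp : Real.exp (-(N : ℝ) ^ 2 / (2 * K))
      ≤ Real.exp (-(max (dist x y - 2 * ε) 0) ^ 2 / (2 * K * ε ^ 2)) := by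
    apply Real.exp_le_exp.2
    rw [neg_div, neg_div, neg_le_neg_iff]
    have : (max (dist x y - 2 * ε) 0) ^ 2 / (2 * K * ε ^ 2)
        = (max (dist x y - 2 * ε) 0 / ε) ^ 2 / (2 * K) := by field_simp
    rw [this]
    gcongr
  rw [mul_assoc _ (√ _)]
  refine mul_le_mul (mul_le_mul_of_nonneg_left hexp zero_le_two) ?_ (by positivity) (by positivity)
  calc _ ≤ √(b / c * C) * √(b / c * C) :=
        mul_le_mul (Real.sqrt_le_sqrt hsy) (Real.sqrt_le_sqrt hsx) (by positivity) (by positivity)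
    _ = _ := Real.mul_self_sqrt hC

/-- Gaussian upper bound for the heat kernel of a walk with bounded steps. -/
theorem heat_le_gaussian (hw : IsSymmKernel w) {c b : ℝ} (hc : 0 < c) (hε : 0 < ε)
    (hr : ∀ x y, ε < dist x y → w x y = 0) (hb : ∀ x y, w x y ≤ b)
    (hae : ∀ᵐ y ∂ν, c ≤ kernelDeg ν w y) (k : ℕ) {x y : E} {C : ℝ}
    (hx : kernelDeg ν w x ≤ C) (hy : kernelDeg ν w y ≤ C) (hcy : c ≤ kernelDeg ν w y) :
    (hw.heat ν hc k x : E → ℝ) y ≤ 2 * b * C / c ^ 2 *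
      Real.exp (-(max (dist x y - 2 * ε) 0) ^ 2 / (2 * (k + 1) * ε ^ 2)) := by
  have hb0 : 0 ≤ b := (hw.nonneg x y).trans (hb x y)
  have hd : 0 < kernelDeg ν w y := hc.trans_le hcy
  have hC : 0 < C := hd.trans_le hy
  cases k with
  | zero =>
    by_cases h : ε < dist x y
    · rw [hw.heat_eq_zero hc hr 0 (by simpa using h)]
      positivity
    · have : max (dist x y - 2 * ε) 0 = 0 := max_eq_right (by linarith)
      rw [this, heat_zero, hw.seed_apply hc x hcy]
      simp only [ne_eq, OfNat.ofNat_ne_zero, not_false_eq_true, zero_pow, neg_zero, zero_div,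
        Real.exp_zero, mul_one]
      calc w x y / kernelDeg ν w y ≤ b / c := div_le_div₀ hb0 (hb x y) hc hcy
        _ = b * c / c ^ 2 := by field_simp
        _ ≤ 2 * b * C / c ^ 2 := by
          apply div_le_div_of_nonneg_right _ (by positivity)
          nlinarith [hcy.trans hy]
  | succ k =>
    -- The value after `k + 2` steps is the form of two seeds with only `k` steps between them; the
    -- larger `K` gives the stated exponent.
    have h1 := hw.form_seed_heat_le hc hε hr hb hae (k := k) (K := k + 1 + 1) (by omega) (by omega)
      hx hy
    rw [← hw.deg_mul_heat_succ hc hae] at h1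
    have h0 := hw.heat_nonneg (ν := ν) hc (k + 1) x y
    have h2 : c * (hw.heat ν hc (k + 1) x : E → ℝ) y ≤ _ :=
      (mul_le_mul_of_nonneg_right hcy h0).trans h1
    rw [mul_comm, ← le_div_iff₀ hc] at h2
    refine h2.trans (le_of_eq ?_)
    push_cast
    field_simp

end IsSymmKernel
end FiniteRange

/-! ### A nonlocal Nash inequality in Euclidean space. -/

section Nash

variable {d : ℕ}

theorem two_mul_ofReal (a : ℝ) : 2 * ENNReal.ofReal a = ENNReal.ofReal (2 * a) := by
  rw [ENNReal.ofReal_mul zero_le_two, ENNReal.ofReal_ofNat]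

/-- The nonlocal Dirichlet energy of a pair of functions at scale `δ`. -/
def pairEnergy (δ : ℝ) (F G : Pt d → ℝ) : ℝ≥0∞ :=
  ∫⁻ x, ∫⁻ u in Metric.closedBall x δ, ENNReal.ofReal ((F x - G u) ^ 2)

theorem measurable_lintegral_closedBall {F G : Pt d → ℝ} (hF : Measurable F) (hG : Measurable G)
    (δ : ℝ) :
    Measurable fun x => ∫⁻ u in Metric.closedBall x δ, ENNReal.ofReal ((F x - G u) ^ 2) := by
  have : ∀ x, ∫⁻ u in Metric.closedBall x δ, ENNReal.ofReal ((F x - G u) ^ 2) =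
      ∫⁻ u, {p : Pt d × Pt d | dist p.2 p.1 ≤ δ}.indicator
        (fun p => ENNReal.ofReal ((F p.1 - G p.2) ^ 2)) (x, u) := by
    intro x
    rw [← lintegral_indicator Metric.isClosed_closedBall.measurableSet]
    rfl
  simp only [this]
  refine Measurable.lintegral_prod_right' (f := {p : Pt d × Pt d | dist p.2 p.1 ≤ δ}.indicator
        (fun p => ENNReal.ofReal ((F p.1 - G p.2) ^ 2))) ?_
  refine Measurable.indicator ?_ (measurableSet_le (by fun_prop) measurable_const)
  exact (((hF.comp measurable_fst).sub (hG.comp measurable_snd)).pow_const 2).ennreal_ofReal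

/-- The ball of radius `δ / 2` about the midpoint `x + h / 2` lies in the `δ`-balls about both `x`
and `x + h`. Writing `F (x + h) - F x` through `G u` and averaging over `u` in that ball bounds it
by two copies of the energy. -/
theorem volume_mul_lintegral_translate_le {F G : Pt d → ℝ} (hF : Measurable F) (hG : Measurable G)
    {δ : ℝ} {h : Pt d} (hh : ‖h‖ ≤ δ) :
    volume (Metric.ball (0 : Pt d) (δ / 2)) * ∫⁻ x, ENNReal.ofReal ((F (x + h) - F x) ^ 2)
      ≤ 4 * pairEnergy δ F G := by
  have hm := measurable_lintegral_closedBall hF hG δ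
  rw [← lintegral_const_mul _ (by fun_prop)]
  have key : ∀ x, volume (Metric.ball (0 : Pt d) (δ / 2)) * ENNReal.ofReal ((F (x + h) - F x) ^ 2)
      ≤ 2 * (∫⁻ u in Metric.closedBall x δ, ENNReal.ofReal ((F x - G u) ^ 2))
        + 2 * ∫⁻ u in Metric.closedBall (x + h) δ, ENNReal.ofReal ((F (x + h) - G u) ^ 2) := by
    intro x
    set B := Metric.ball (x + (1 / 2 : ℝ) • h) (δ / 2)
    have hvol : volume (Metric.ball (0 : Pt d) (δ / 2)) = volume B :=
      (Measure.addHaar_ball_center _ _ _).symm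
    have hnorm : ‖(1 / 2 : ℝ) • h‖ ≤ δ / 2 := by
      rw [norm_smul]; norm_num; linarith
    have hB1 : B ⊆ Metric.closedBall x δ := by
      intro u hu
      simp only [B, Metric.mem_ball, Metric.mem_closedBall] at hu ⊢
      have := dist_triangle u (x + (1 / 2 : ℝ) • h) x
      have h3 : dist (x + (1 / 2 : ℝ) • h) x = ‖(1 / 2 : ℝ) • h‖ := by simp [dist_eq_norm]
      linarith
    have hB2 : B ⊆ Metric.closedBall (x + h) δ := by
      intro u hu
      simp only [B, Metric.mem_ball, Metric.mem_closedBall] at hu ⊢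
      have := dist_triangle u (x + (1 / 2 : ℝ) • h) (x + h)
      have h3 : dist (x + (1 / 2 : ℝ) • h) (x + h) = ‖(1 / 2 : ℝ) • h‖ := by
        rw [dist_eq_norm, ← norm_neg]
        congr 1
        module
      linarith
    rw [hvol, mul_comm, ← setLIntegral_const]
    have hmeas : ∀ y, Measurable fun u => ENNReal.ofReal ((F y - G u) ^ 2) := fun y => by fun_prop
    calc ∫⁻ _ in B, ENNReal.ofReal ((F (x + h) - F x) ^ 2)
        ≤ ∫⁻ u in B, (2 * ENNReal.ofReal ((F x - G u) ^ 2)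
          + 2 * ENNReal.ofReal ((F (x + h) - G u) ^ 2)) := by
          refine lintegral_mono fun u => ?_
          simp only
          rw [two_mul_ofReal, two_mul_ofReal, ← ENNReal.ofReal_add (by positivity) (by positivity)]
          apply ENNReal.ofReal_le_ofReal
          nlinarith [sq_nonneg (F x - G u + (F (x + h) - G u))]
      _ = 2 * (∫⁻ u in B, ENNReal.ofReal ((F x - G u) ^ 2))
        + 2 * ∫⁻ u in B, ENNReal.ofReal ((F (x + h) - G u) ^ 2) := by
          rw [lintegral_add_left ((hmeas _).const_mul 2), lintegral_const_mul _ (hmeas _),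
            lintegral_const_mul _ (hmeas _)]
      _ ≤ _ := by
          gcongr
  refine (lintegral_mono key).trans ?_
  rw [lintegral_add_left (hm.const_mul 2), lintegral_const_mul _ hm,
    lintegral_const_mul _ (f := fun x => ∫⁻ u in Metric.closedBall (x + h) δ,
      ENNReal.ofReal ((F (x + h) - G u) ^ 2)) (hm.comp (measurable_add_const h)),
    lintegral_add_right_eq_self (μ := volume)
      (fun x => ∫⁻ u in Metric.closedBall x δ, ENNReal.ofReal ((F x - G u) ^ 2)) h, ← two_mul,
    ← mul_assoc, pairEnergy]
  norm_num

/-- A long translation is `N` short ones; telescoping and Cauchy-Schwarz cost the factor `N ^ 2`. -/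
theorem volume_mul_lintegral_long_translate_le {F G : Pt d → ℝ} (hF : Measurable F)
    (hG : Measurable G) {δ : ℝ} {N : ℕ} (hN : 0 < N) {h : Pt d} (hh : ‖h‖ ≤ N * δ) :
    volume (Metric.ball (0 : Pt d) (δ / 2)) * ∫⁻ x, ENNReal.ofReal ((F (x + h) - F x) ^ 2)
      ≤ N ^ 2 * (4 * pairEnergy δ F G) := by
  have hNr : (0 : ℝ) < N := by exact_mod_cast hN
  set k : Pt d := (N : ℝ)⁻¹ • h
  have hk : ‖k‖ ≤ δ := by
    rw [norm_smul, norm_inv, Real.norm_natCast, inv_mul_le_iff₀ hNr]; exact hh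
  have hpt : ∀ x, ENNReal.ofReal ((F (x + h) - F x) ^ 2) ≤
      N * ∑ i ∈ Finset.range N, ENNReal.ofReal ((F (x + (i : ℝ) • k + k) - F (x + (i : ℝ) • k)) ^ 2) := by
    intro x
    have htel : F (x + h) - F x
        = ∑ i ∈ Finset.range N, (F (x + (i : ℝ) • k + k) - F (x + (i : ℝ) • k)) := by
      have := Finset.sum_range_sub (fun i : ℕ => F (x + (i : ℝ) • k)) N
      have hk2 : (N : ℝ) • k = h := by rw [smul_smul, mul_inv_cancel₀ hNr.ne', one_smul]
      simp only [hk2, Nat.cast_zero, zero_smul, add_zero] at this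
      rw [← this]
      refine Finset.sum_congr rfl fun i _ => ?_
      congr 2
      push_cast
      module
    rw [htel, ← ENNReal.ofReal_sum_of_nonneg (fun i _ => sq_nonneg _), ← ENNReal.ofReal_natCast,
      ← ENNReal.ofReal_mul (by positivity)]
    apply ENNReal.ofReal_le_ofReal
    have := sq_sum_le_card_mul_sum_sq (s := Finset.range N)
      (f := fun i : ℕ => F (x + (i : ℝ) • k + k) - F (x + (i : ℝ) • k))
    simpa using this
  have hmeas : Measurable fun x => ENNReal.ofReal ((F (x + k) - F x) ^ 2) := by fun_prop
  calc volume (Metric.ball (0 : Pt d) (δ / 2)) * ∫⁻ x, ENNReal.ofReal ((F (x + h) - F x) ^ 2)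
      ≤ volume (Metric.ball (0 : Pt d) (δ / 2)) * ∫⁻ x, N * ∑ i ∈ Finset.range N,
        ENNReal.ofReal ((F (x + (i : ℝ) • k + k) - F (x + (i : ℝ) • k)) ^ 2) := by
        gcongr with x; exact hpt x
    _ = volume (Metric.ball (0 : Pt d) (δ / 2)) * (N * ∑ i ∈ Finset.range N,
          ∫⁻ x, ENNReal.ofReal ((F (x + k) - F x) ^ 2)) := by
        rw [lintegral_const_mul _ (by fun_prop), lintegral_finsetSum _ (by fun_prop)]
        congr 2
        refine Finset.sum_congr rfl fun i _ => ?_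
        exact lintegral_add_right_eq_self (μ := volume)
          (fun x => ENNReal.ofReal ((F (x + k) - F x) ^ 2)) ((i : ℝ) • k)
    _ = N ^ 2 * (volume (Metric.ball (0 : Pt d) (δ / 2))
          * ∫⁻ x, ENNReal.ofReal ((F (x + k) - F x) ^ 2)) := by
        rw [Finset.sum_const, Finset.card_range, nsmul_eq_mul]; ring
    _ ≤ _ := by
        refine mul_le_mul_right ?_ _
        exact volume_mul_lintegral_translate_le hF hG hk

/-- A nonlocal **Nash inequality**: `L²` norms are controlled by `L¹` norms and the energy at
scale `δ`. -/
theorem nonlocal_nash {F G : Pt d → ℝ} (hF : Measurable F) (hG : Measurable G) (hF0 : ∀ x, 0 ≤ F x)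
    {δ : ℝ} {N : ℕ} (hN : 0 < N) :
    volume (Metric.ball (0 : Pt d) (δ / 2)) * (volume (Metric.ball (0 : Pt d) (N * δ))
        * ∫⁻ x, ENNReal.ofReal (F x ^ 2))
      ≤ 2 * (volume (Metric.ball (0 : Pt d) (δ / 2)) * (∫⁻ x, ENNReal.ofReal (F x)) ^ 2)
        + volume (Metric.ball (0 : Pt d) (N * δ)) * (N ^ 2 * (4 * pairEnergy δ F G)) := by
  set v := volume (Metric.ball (0 : Pt d) (δ / 2))
  set B := Metric.ball (0 : Pt d) (N * δ)
  -- This will be averaged over translations `h` of length below `N δ`: the product term integrates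
  -- to at most the squared `L¹` norm, the other is the energy of a long translation.
  have hpt : ∀ h x, ENNReal.ofReal (F x ^ 2) ≤
      2 * (ENNReal.ofReal (F x) * ENNReal.ofReal (F (x + h)))
        + ENNReal.ofReal ((F (x + h) - F x) ^ 2) := by
    intro h x
    rw [← ENNReal.ofReal_mul (hF0 x), two_mul_ofReal,
      ← ENNReal.ofReal_add (by have := hF0 x; have := hF0 (x + h); positivity) (by positivity)]
    apply ENNReal.ofReal_le_ofReal
    nlinarith [sq_nonneg (F (x + h))]
  have hmF : Measurable fun x => ENNReal.ofReal (F x) := hF.ennreal_ofReal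
  have hstep : ∀ h ∈ B, v * ∫⁻ x, ENNReal.ofReal (F x ^ 2) ≤
      v * (2 * ∫⁻ x, ENNReal.ofReal (F x) * ENNReal.ofReal (F (x + h)))
        + N ^ 2 * (4 * pairEnergy δ F G) := by
    intro h hh
    have hh' : ‖h‖ ≤ N * δ := by simpa [B] using (Metric.mem_ball.1 hh).le
    calc v * ∫⁻ x, ENNReal.ofReal (F x ^ 2)
        ≤ v * ∫⁻ x, (2 * (ENNReal.ofReal (F x) * ENNReal.ofReal (F (x + h)))
        + ENNReal.ofReal ((F (x + h) - F x) ^ 2)) := by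
          gcongr with x; exact hpt h x
      _ = v * (2 * ∫⁻ x, ENNReal.ofReal (F x) * ENNReal.ofReal (F (x + h)))
        + v * ∫⁻ x, ENNReal.ofReal ((F (x + h) - F x) ^ 2) := by
          rw [lintegral_add_left (by fun_prop), lintegral_const_mul _ (by fun_prop), mul_add]
      _ ≤ _ := by
          refine add_le_add_right ?_ _
          exact volume_mul_lintegral_long_translate_le hF hG hN hh'
  have hmul : ∫⁻ h, ∫⁻ x, ENNReal.ofReal (F x) * ENNReal.ofReal (F (x + h))
      = (∫⁻ x, ENNReal.ofReal (F x)) ^ 2 := by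
    rw [lintegral_lintegral_swap (by fun_prop), sq, ← lintegral_mul_const _ hmF]
    refine lintegral_congr fun x => ?_
    rw [lintegral_const_mul _ (by fun_prop), lintegral_add_left_eq_self (μ := volume)
      (fun x => ENNReal.ofReal (F x)) x]
  calc v * (volume B * ∫⁻ x, ENNReal.ofReal (F x ^ 2))
      = ∫⁻ _ in B, v * ∫⁻ x, ENNReal.ofReal (F x ^ 2) := by
        rw [setLIntegral_const]; ring
    _ ≤ ∫⁻ h in B, (v * (2 * ∫⁻ x, ENNReal.ofReal (F x) * ENNReal.ofReal (F (x + h)))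
        + N ^ 2 * (4 * pairEnergy δ F G)) :=
        setLIntegral_mono' measurableSet_ball hstep
    _ = (∫⁻ h in B, v * (2 * ∫⁻ x, ENNReal.ofReal (F x) * ENNReal.ofReal (F (x + h))))
        + volume B * (N ^ 2 * (4 * pairEnergy δ F G)) := by
        rw [lintegral_add_right _ measurable_const, setLIntegral_const]; ring
    _ ≤ (∫⁻ h, v * (2 * ∫⁻ x, ENNReal.ofReal (F x) * ENNReal.ofReal (F (x + h))))
        + volume B * (N ^ 2 * (4 * pairEnergy δ F G)) := by
        refine add_le_add_left ?_ _
        exact setLIntegral_le_lintegral _ _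
    _ = _ := by
        have hm : Measurable fun h => ∫⁻ x, ENNReal.ofReal (F x) * ENNReal.ofReal (F (x + h)) := by
          refine Measurable.lintegral_prod_right'
            (f := fun p : Pt d × Pt d => ENNReal.ofReal (F p.2) * ENNReal.ofReal (F (p.2 + p.1))) ?_
          fun_prop
        rw [lintegral_const_mul _ (hm.const_mul 2), lintegral_const_mul _ hm, hmul]; ring

end Nash

/-! ### Dissipation of the quadratic form and conservation of mass. -/

section Energy

variable {E : Type*} [MeasurableSpace E] {ν : Measure E} [IsFiniteMeasure ν] {w : E → E → ℝ}

namespace IsSymmKernel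

/-- The dissipation identity `form_sub_form_walkB` in extended reals. It compares `f` at one point
with its average at another, which is why `pairEnergy` takes two functions. -/
theorem lintegral_energy (hw : IsSymmKernel w) (f : boundedMeasurable E) :
    ∫⁻ u, ∫⁻ x, ENNReal.ofReal (w u x * ((f : E → ℝ) x - walk ν w f u) ^ 2) ∂ν ∂ν
      = ENNReal.ofReal (hw.form ν f f - hw.form ν (hw.walkB ν f) (hw.walkB ν f)) := by
  obtain ⟨C, hC0, hC⟩ := exists_abs_le_coe f
  obtain ⟨K, hK0, hK⟩ := hw.exists_bound
  have hQ : Measurable (walk ν w f) := measurable_coe (hw.walkB ν f)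
  have hm : Measurable (Function.uncurry fun u x => w u x * ((f : E → ℝ) x - walk ν w f u) ^ 2) :=
    hw.meas.mul ((((measurable_coe f).comp measurable_snd).sub
      (hQ.comp measurable_fst)).pow_const 2)
  have hb : ∀ u x, |w u x * ((f : E → ℝ) x - walk ν w f u) ^ 2| ≤ K * (2 * C) ^ 2 := by
    intro u x
    have h1 : |(f : E → ℝ) x - walk ν w f u| ≤ 2 * C := by
      have := abs_sub ((f : E → ℝ) x) (walk ν w f u)
      linarith [hC x, hw.abs_walk_le (ν := ν) hC u]
    rw [abs_mul, abs_pow]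
    have := hK u x
    gcongr
  have hnn : ∀ u x, 0 ≤ w u x * ((f : E → ℝ) x - walk ν w f u) ^ 2 := fun u x =>
    mul_nonneg (hw.nonneg u x) (sq_nonneg _)
  have hint : Integrable (Function.uncurry fun u x =>
      w u x * ((f : E → ℝ) x - walk ν w f u) ^ 2) (ν.prod ν) :=
    integrable_of_abs_le hm fun p => hb p.1 p.2
  have hint' : Integrable (fun u => ∫ x, w u x * ((f : E → ℝ) x - walk ν w f u) ^ 2 ∂ν) ν :=
    hint.integral_prod_left
  rw [form_sub_form_walkB, ofReal_integral_eq_lintegral_ofReal hint'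
    (ae_of_all _ fun u => integral_nonneg (hnn u))]
  refine lintegral_congr fun u => ?_
  rw [ofReal_integral_eq_lintegral_ofReal _ (ae_of_all _ (hnn u))]
  exact integrable_of_abs_le (hm.comp measurable_prodMk_left) (hb u)

theorem form_heat_self_antitone (hw : IsSymmKernel w) {c : ℝ} (hc : 0 < c) (x : E) :
    Antitone fun k => hw.form ν (hw.heat ν hc k x) (hw.heat ν hc k x) :=
  antitone_nat_of_succ_le fun k => by
    rw [heat_succ]; exact hw.form_walkB_self_le _

/-- The constant function one. -/
def oneB (E : Type*) [MeasurableSpace E] : boundedMeasurable E :=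
  ⟨fun _ => 1, measurable_const, 1, fun x => by simp⟩

theorem abs_pow_walkB_le (hw : IsSymmKernel w) {f : boundedMeasurable E} {C : ℝ}
    (hC : ∀ x, |(f : E → ℝ) x| ≤ C) (k : ℕ) (x : E) :
    |((hw.walkB ν ^ k) f : E → ℝ) x| ≤ C := by
  induction k generalizing x with
  | zero => exact hC x
  | succ k ih =>
    rw [pow_succ', Module.End.mul_apply]
    exact hw.abs_walk_le ih x

/-- The `L¹` bound for Nash: self-adjointness moves the walk onto the constant `1`, where it is a
contraction in supremum norm. -/
theorem form_heat_one_le (hw : IsSymmKernel w) {c : ℝ} (hc : 0 < c)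
    (hae : ∀ᵐ y ∂ν, c ≤ kernelDeg ν w y) (k : ℕ) (x : E) :
    hw.form ν (hw.heat ν hc k x) (oneB E) ≤ kernelDeg ν w x := by
  rw [heat, form_pow_walkB, form_seed hw hc hae]
  refine (le_abs_self _).trans ((hw.abs_integral_mul_le x (C := 1) ?_).trans_eq (one_mul _))
  exact hw.abs_pow_walkB_le (fun x => by simp [oneB]) k

end IsSymmKernel

end Energy

/-! ### Kernels at scale `ε` over measures comparable with Lebesgue measure. -/

section Comparable

variable {d : ℕ}

/-- The measure `μ` lives on `Ω` and has a density between `a` and `A` there. -/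
structure IsComparable (μ : Measure (Pt d)) (Ω : Set (Pt d)) (a A : ℝ) : Prop where
  measurableSet : MeasurableSet Ω
  pos : 0 < a
  lower : ENNReal.ofReal a • volume.restrict Ω ≤ μ
  upper : μ ≤ ENNReal.ofReal A • volume.restrict Ω

/-- A kernel at scale `ε`: its range is at most `ε`, its size at most `Λ ε ^ (-d)`, and it is at
least `κ ε ^ (-d)` for points at distance at most `δ ε`. -/
structure IsScaledKernel (w : Pt d → Pt d → ℝ) (ε Λ κ δ : ℝ) : Prop extends IsSymmKernel w where
  eps_pos : 0 < ε
  kappa_pos : 0 < κ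
  delta_pos : 0 < δ
  delta_le : δ ≤ 1
  range : ∀ x y, ε < dist x y → w x y = 0
  le : ∀ x y, w x y ≤ Λ * (ε ^ d)⁻¹
  ge : ∀ x y, dist x y ≤ δ * ε → κ * (ε ^ d)⁻¹ ≤ w x y

variable {μ : Measure (Pt d)} {Ω : Set (Pt d)} {a A : ℝ}

namespace IsComparable

theorem ae_mem (h : IsComparable μ Ω a A) : ∀ᵐ x ∂μ, x ∈ Ω := by
  have h1 : ∀ᵐ x ∂(ENNReal.ofReal A • volume.restrict Ω), x ∈ Ω :=
    Measure.ae_smul_measure (ae_restrict_mem h.measurableSet) _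
  exact (Measure.absolutelyContinuous_of_le h.upper).ae_le h1

theorem setLIntegral_le (h : IsComparable μ Ω a A) (g : Pt d → ℝ≥0∞) :
    ∫⁻ x in Ω, g x ≤ ENNReal.ofReal a⁻¹ * ∫⁻ x, g x ∂μ := by
  have h1 : ENNReal.ofReal a * ∫⁻ x in Ω, g x ≤ ∫⁻ x, g x ∂μ := by
    have := lintegral_mono' (μ := ENNReal.ofReal a • volume.restrict Ω) (ν := μ) h.lower (le_refl g)
    rwa [lintegral_smul_measure] at this
  calc ∫⁻ x in Ω, g x = ENNReal.ofReal a⁻¹ * (ENNReal.ofReal a * ∫⁻ x in Ω, g x) := by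
        rw [← mul_assoc, ← ENNReal.ofReal_mul (inv_nonneg.2 h.pos.le), inv_mul_cancel₀ h.pos.ne',
          ENNReal.ofReal_one, one_mul]
    _ ≤ _ := by gcongr

theorem lintegral_le (h : IsComparable μ Ω a A) (g : Pt d → ℝ≥0∞) :
    ∫⁻ x, g x ∂μ ≤ ENNReal.ofReal A * ∫⁻ x in Ω, g x := by
  have := lintegral_mono' (μ := μ) (ν := ENNReal.ofReal A • volume.restrict Ω) h.upper (le_refl g)
  rwa [lintegral_smul_measure] at this

theorem volume_le (h : IsComparable μ Ω a A) [IsProbabilityMeasure μ] :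
    volume Ω ≤ ENNReal.ofReal a⁻¹ := by
  have := h.setLIntegral_le (fun _ => 1)
  simpa using this

end IsComparable

theorem volume_closedBall_eq (x : Pt d) (r : ℝ) :
    volume (Metric.closedBall x r) = volume (Metric.closedBall (0 : Pt d) r) :=
  Measure.addHaar_closedBall_center _ _ _

/-- The pair energy of a function and its average, cut off to a ball inside `Ω`, is controlled by
the Dirichlet form up to the size `t` of the functions near and beyond the boundary of the ball. -/
theorem pairEnergy_indicator_le (h : IsComparable μ Ω a A) [IsProbabilityMeasure μ]
    {w : Pt d → Pt d → ℝ} {ε Λ κ δ : ℝ} (hw : IsScaledKernel w ε Λ κ δ)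
    (f : boundedMeasurable (Pt d)) {y : Pt d} {r t : ℝ} (hball : Metric.ball y r ⊆ Ω)
    (ht : ∀ x ∈ Ω, r - ε ≤ dist x y → |(f : Pt d → ℝ) x| ≤ t ∧ |walk μ w f x| ≤ t) :
    pairEnergy (δ * ε) ((Metric.ball y r).indicator f) ((Metric.ball y r).indicator (walk μ w f))
      ≤ ENNReal.ofReal (ε ^ d * κ⁻¹ * a⁻¹ ^ 2 * (hw.form μ f f
          - hw.form μ (hw.walkB μ f) (hw.walkB μ f)))
        + 2 * (ENNReal.ofReal (a⁻¹ * t ^ 2) * volume (Metric.closedBall (0 : Pt d) (δ * ε))) := by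
  have hε := hw.eps_pos
  have hδ := hw.delta_pos
  have hκ := hw.kappa_pos
  have hδ1 : δ * ε ≤ ε := by nlinarith [hw.delta_le]
  have hQ : Measurable (walk μ w f) := measurable_coe (hw.walkB μ f)
  have hf := measurable_coe f
  set B := Metric.ball y r
  set T := ENNReal.ofReal (t ^ 2)
  set g : Pt d → Pt d → ℝ≥0∞ := fun u x =>
    ENNReal.ofReal (w u x * ((f : Pt d → ℝ) x - walk μ w f u) ^ 2)
  set D : Set (Pt d × Pt d) := {p | dist p.1 p.2 ≤ δ * ε}
  have hD : MeasurableSet D := measurableSet_le (by fun_prop) measurable_const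
  have hg : Measurable (Function.uncurry g) :=
    (hw.meas.mul (((hf.comp measurable_snd).sub (hQ.comp measurable_fst)).pow_const 2)).ennreal_ofReal
  set k0 := ENNReal.ofReal (ε ^ d * κ⁻¹)
  -- If both points lie in the ball, `κ ε ^ (-d) ≤ w` brings in the Dirichlet form. If only one
  -- does, it is within `δ ε ≤ ε` of the boundary sphere, where the functions are at most `t`.
  have hpt : ∀ x u, (Metric.closedBall x (δ * ε)).indicator
      (fun u => ENNReal.ofReal ((B.indicator f x - B.indicator (walk μ w f) u) ^ 2)) u
      ≤ Ω.indicator (fun x => Ω.indicator (fun u => k0 * g u x) u) x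
        + (Ω.indicator (fun x => D.indicator (fun _ => T) (x, u)) x
          + Ω.indicator (fun u => D.indicator (fun _ => T) (x, u)) u) := by
    intro x u
    by_cases hxu : dist u x ≤ δ * ε
    swap
    · rw [Set.indicator_of_notMem (by simpa [Metric.mem_closedBall] using hxu)]; exact zero_le
    rw [Set.indicator_of_mem (by simpa [Metric.mem_closedBall] using hxu)]
    have hmD : (x, u) ∈ D := by simpa [D, dist_comm] using hxu
    by_cases hx : x ∈ B <;> by_cases hu : u ∈ B
    · rw [Set.indicator_of_mem hx, Set.indicator_of_mem hu, Set.indicator_of_mem (hball hx),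
        Set.indicator_of_mem (hball hu)]
      refine le_add_of_le_of_nonneg ?_ zero_le
      simp only [k0, g]
      rw [← ENNReal.ofReal_mul (by positivity)]
      apply ENNReal.ofReal_le_ofReal
      have h1 := hw.ge u x hxu
      have h2 : 1 ≤ ε ^ d * κ⁻¹ * w u x := by
        calc (1 : ℝ) = ε ^ d * κ⁻¹ * (κ * (ε ^ d)⁻¹) := by field_simp
          _ ≤ _ := by gcongr
      nlinarith [sq_nonneg ((f : Pt d → ℝ) x - walk μ w f u)]
    · rw [Set.indicator_of_mem hx, Set.indicator_of_notMem hu]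
      refine le_add_of_nonneg_of_le zero_le (le_add_of_le_of_nonneg ?_ zero_le)
      rw [Set.indicator_of_mem (hball hx), Set.indicator_of_mem hmD]
      apply ENNReal.ofReal_le_ofReal
      have hd : r - ε ≤ dist x y := by
        have h3 : r ≤ dist u y := by simpa [B] using hu
        have := dist_triangle u x y
        linarith
      have := (ht x (hball hx) hd).1
      rw [sub_zero, ← sq_abs]; gcongr
    · rw [Set.indicator_of_notMem hx, Set.indicator_of_mem hu]
      refine le_add_of_nonneg_of_le zero_le (le_add_of_nonneg_of_le zero_le ?_)
      rw [Set.indicator_of_mem (hball hu), Set.indicator_of_mem hmD]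
      apply ENNReal.ofReal_le_ofReal
      have hd : r - ε ≤ dist u y := by
        have h3 : r ≤ dist x y := by simpa [B] using hx
        have := dist_triangle_left x y u
        linarith
      have := (ht u (hball hu) hd).2
      rw [zero_sub, neg_sq, ← sq_abs]; gcongr
    · rw [Set.indicator_of_notMem hx, Set.indicator_of_notMem hu]; simp
  have hmA : Measurable fun p : Pt d × Pt d =>
      Ω.indicator (fun x => Ω.indicator (fun u => k0 * g u x) p.2) p.1 := by
    have : (fun p : Pt d × Pt d => Ω.indicator (fun x => Ω.indicator (fun u => k0 * g u x) p.2) p.1)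
        = (Ω ×ˢ Ω).indicator fun p => k0 * g p.2 p.1 := by
      ext p
      by_cases h1 : p.1 ∈ Ω <;> by_cases h2 : p.2 ∈ Ω <;> simp [Set.indicator, h1, h2]
    rw [this]
    exact ((hg.comp measurable_swap).const_mul k0).indicator (h.measurableSet.prod h.measurableSet)
  have hmB : Measurable fun p : Pt d × Pt d =>
      Ω.indicator (fun x => D.indicator (fun _ => T) (x, p.2)) p.1 := by
    have : (fun p : Pt d × Pt d => Ω.indicator (fun x => D.indicator (fun _ => T) (x, p.2)) p.1)
        = (Ω ×ˢ Set.univ ∩ D).indicator fun _ => T := by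
      ext p
      by_cases h1 : p.1 ∈ Ω <;> by_cases h2 : p ∈ D <;> simp [Set.indicator, h1, h2]
    rw [this]
    exact measurable_const.indicator ((h.measurableSet.prod MeasurableSet.univ).inter hD)
  have hmC : Measurable fun p : Pt d × Pt d =>
      Ω.indicator (fun u => D.indicator (fun _ => T) (p.1, u)) p.2 := by
    have : (fun p : Pt d × Pt d => Ω.indicator (fun u => D.indicator (fun _ => T) (p.1, u)) p.2)
        = (Set.univ ×ˢ Ω ∩ D).indicator fun _ => T := by
      ext p
      by_cases h1 : p.2 ∈ Ω <;> by_cases h2 : p ∈ D <;> simp [Set.indicator, h1, h2]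
    rw [this]
    exact measurable_const.indicator ((MeasurableSet.univ.prod h.measurableSet).inter hD)
  have hballvol : ∀ x : Pt d, ∫⁻ u, D.indicator (fun _ => T) (x, u)
      = T * volume (Metric.closedBall (0 : Pt d) (δ * ε)) := by
    intro x
    have : ∀ u, D.indicator (fun _ => T) (x, u)
        = (Metric.closedBall x (δ * ε)).indicator (fun _ => T) u := by
      intro u
      by_cases hu : dist u x ≤ δ * ε
      · rw [Set.indicator_of_mem (by simpa [D, dist_comm] using hu),
          Set.indicator_of_mem (by simpa using hu)]
      · rw [Set.indicator_of_notMem (by simpa [D, dist_comm] using hu),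
          Set.indicator_of_notMem (by simpa using hu)]
    simp only [this]
    rw [lintegral_indicator_const Metric.isClosed_closedBall.measurableSet,
      volume_closedBall_eq x]
  have hballvol' : ∀ u : Pt d, ∫⁻ x, D.indicator (fun _ => T) (x, u)
      = T * volume (Metric.closedBall (0 : Pt d) (δ * ε)) := by
    intro u
    rw [← hballvol u]
    refine lintegral_congr fun x => ?_
    by_cases hu : dist u x ≤ δ * ε
    · rw [Set.indicator_of_mem (by simpa [D, dist_comm] using hu),
        Set.indicator_of_mem (by simpa [D] using hu)]
    · rw [Set.indicator_of_notMem (by simpa [D, dist_comm] using hu),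
        Set.indicator_of_notMem (by simpa [D] using hu)]
  have hTV : T * volume (Metric.closedBall (0 : Pt d) (δ * ε)) * volume Ω
      ≤ ENNReal.ofReal (a⁻¹ * t ^ 2) * volume (Metric.closedBall (0 : Pt d) (δ * ε)) := by
    rw [ENNReal.ofReal_mul (inv_nonneg.2 h.pos.le)]
    calc _ ≤ T * volume (Metric.closedBall (0 : Pt d) (δ * ε)) * ENNReal.ofReal a⁻¹ := by
          gcongr; exact h.volume_le
      _ = _ := by simp only [T]; ring
  calc pairEnergy (δ * ε) (B.indicator f) (B.indicator (walk μ w f))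
      ≤ ∫⁻ x, ∫⁻ u, (Ω.indicator (fun x => Ω.indicator (fun u => k0 * g u x) u) x
        + (Ω.indicator (fun x => D.indicator (fun _ => T) (x, u)) x
          + Ω.indicator (fun u => D.indicator (fun _ => T) (x, u)) u)) := by
        unfold pairEnergy
        refine lintegral_mono fun x => ?_
        rw [← lintegral_indicator Metric.isClosed_closedBall.measurableSet]
        exact lintegral_mono fun u => hpt x u
    _ = (∫⁻ x, ∫⁻ u, Ω.indicator (fun x => Ω.indicator (fun u => k0 * g u x) u) x)
        + ((∫⁻ x, ∫⁻ u, Ω.indicator (fun x => D.indicator (fun _ => T) (x, u)) x)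
          + ∫⁻ x, ∫⁻ u, Ω.indicator (fun u => D.indicator (fun _ => T) (x, u)) u) := by
        rw [← lintegral_add_left (hmB.lintegral_prod_right'), ← lintegral_add_left
          (hmA.lintegral_prod_right')]
        refine lintegral_congr fun x => ?_
        have m1 : Measurable fun u => Ω.indicator (fun x => Ω.indicator (fun u => k0 * g u x) u) x :=
          hmA.comp measurable_prodMk_left
        have m2 : Measurable fun u => Ω.indicator (fun x => D.indicator (fun _ => T) (x, u)) x :=
          hmB.comp measurable_prodMk_left
        rw [lintegral_add_left m1, lintegral_add_left m2]
    _ ≤ _ := by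
        rw [two_mul]
        refine add_le_add ?_ (add_le_add ?_ ?_)
        · calc ∫⁻ x, ∫⁻ u, Ω.indicator (fun x => Ω.indicator (fun u => k0 * g u x) u) x
              = ∫⁻ x in Ω, ∫⁻ u in Ω, k0 * g u x := by
                rw [← lintegral_indicator h.measurableSet]
                refine lintegral_congr fun x => ?_
                by_cases hx : x ∈ Ω
                · simp only [Set.indicator_of_mem hx]
                  rw [lintegral_indicator h.measurableSet]
                · simp [Set.indicator_of_notMem hx]
            _ ≤ ENNReal.ofReal a⁻¹ * ∫⁻ x, ENNReal.ofReal a⁻¹ * ∫⁻ u, k0 * g u x ∂μ ∂μ := by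
                refine (h.setLIntegral_le _).trans ?_
                gcongr with x
                exact h.setLIntegral_le _
            _ = ENNReal.ofReal a⁻¹ * (ENNReal.ofReal a⁻¹ * (k0 * ∫⁻ u, ∫⁻ x, g u x ∂μ ∂μ)) := by
                have hgs : Measurable fun p : Pt d × Pt d => g p.2 p.1 := hg.comp measurable_swap
                rw [← lintegral_lintegral_swap (f := fun x u => g u x) hgs.aemeasurable,
                  ← lintegral_const_mul _ hgs.lintegral_prod_right',
                  ← lintegral_const_mul _ (hgs.lintegral_prod_right'.const_mul k0)]
                congr 1
                refine lintegral_congr fun x => ?_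
                rw [lintegral_const_mul]
                exact hgs.comp measurable_prodMk_left
            _ = _ := by
                rw [hw.lintegral_energy, ← ENNReal.ofReal_mul (by positivity),
                  ← ENNReal.ofReal_mul (inv_nonneg.2 h.pos.le),
                  ← ENNReal.ofReal_mul (inv_nonneg.2 h.pos.le)]
                congr 1; ring
        · calc ∫⁻ x, ∫⁻ u, Ω.indicator (fun x => D.indicator (fun _ => T) (x, u)) x
              = ∫⁻ _ in Ω, T * volume (Metric.closedBall (0 : Pt d) (δ * ε)) := by
                rw [← lintegral_indicator h.measurableSet]
                refine lintegral_congr fun x => ?_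
                by_cases hx : x ∈ Ω
                · simp only [Set.indicator_of_mem hx]
                  exact hballvol x
                · simp [Set.indicator_of_notMem hx]
            _ ≤ _ := by rw [setLIntegral_const]; exact hTV
        · calc ∫⁻ x, ∫⁻ u, Ω.indicator (fun u => D.indicator (fun _ => T) (x, u)) u
              = ∫⁻ _ in Ω, T * volume (Metric.closedBall (0 : Pt d) (δ * ε)) := by
                rw [lintegral_lintegral_swap hmC.aemeasurable,
                  ← lintegral_indicator h.measurableSet]
                refine lintegral_congr fun x => ?_
                by_cases hx : x ∈ Ω
                · simp only [Set.indicator_of_mem hx]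
                  exact hballvol' x
                · simp [Set.indicator_of_notMem hx]
            _ ≤ _ := by rw [setLIntegral_const]; exact hTV

end Comparable

/-! ### From Nash-type recursions to polynomial decay. -/

section Sequences

/-- A discrete differential inequality of Nash type forces polynomial decay. -/
theorem exists_decay_of_nash (d : ℕ) (K A : ℝ) (hK : 1 ≤ K) (hA : 0 ≤ A) :
    ∃ B : ℝ, 0 < B ∧ ∀ (m : ℕ) (α : ℕ → ℝ), Antitone α → (∀ k, 0 ≤ α k) → α 0 ≤ A →
      (∀ k N : ℕ, k + 2 ≤ m → 1 ≤ N → α k ≤ K * (((N : ℝ) ^ d)⁻¹ + N ^ 2 * (α k - α (k + 1))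
        + N ^ 2 * (√((k : ℝ) + 2) ^ (d + 2))⁻¹)) →
      ∀ k : ℕ, k + 2 ≤ m → α k ≤ B * (√((k : ℝ) + 1) ^ d)⁻¹ := by
  -- `D` is the price of replacing an index of at least half of `k` by `k`. The choice of `θ` gives
  -- `4 K θ D = 1 / 2`, so the inductive bound returns with factor `B / 2`; `B` has one summand for
  -- small `k` and one to absorb the remaining terms.
  set D : ℝ := 2 ^ (d + 2) with hD
  have hD1 : 1 ≤ D := one_le_pow₀ one_le_two
  set θ : ℝ := 1 / (8 * K * D) with hθ
  have hK0 : 0 < K := by linarith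
  have hθ0 : 0 < θ := by positivity
  set B : ℝ := A * (√(1 / θ)) ^ d + 2 * (K * (2 / √θ) ^ d + 1) with hB
  have hsq : 0 < √θ := Real.sqrt_pos.2 hθ0
  have hB0 : 0 < B := by positivity
  refine ⟨B, hB0, ?_⟩
  intro m α hanti hnn hα0 hrec k
  induction k using Nat.strong_induction_on with
  | _ k ih =>
    intro hkm
    have hk1 : (0 : ℝ) < (k : ℝ) + 1 := by positivity
    have hsk : 0 < √((k : ℝ) + 1) := Real.sqrt_pos.2 hk1
    by_cases hsmall : θ * ((k : ℝ) + 1) < 1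
    · have h1 : √((k : ℝ) + 1) ≤ √(1 / θ) := by
        apply Real.sqrt_le_sqrt
        rw [le_div_iff₀ hθ0]; linarith
      have h2 : √((k : ℝ) + 1) ^ d ≤ √(1 / θ) ^ d := by gcongr
      rw [← div_eq_mul_inv, le_div_iff₀ (by positivity)]
      calc α k * √((k : ℝ) + 1) ^ d ≤ A * √(1 / θ) ^ d := by
            have := (hanti (Nat.zero_le k)).trans hα0
            have := hnn k
            gcongr
        _ ≤ B := by
            have : 0 ≤ 2 * (K * (2 / √θ) ^ d + 1) := by positivity
            linarith
    push Not at hsmall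
    have hθ8 : θ ≤ 1 / 8 := by
      rw [hθ]
      apply one_div_le_one_div_of_le (by norm_num)
      nlinarith
    have hkpos : 1 ≤ k := by
      by_contra h0
      have : k = 0 := by omega
      subst this
      norm_num at hsmall
      linarith
    set h := k / 2 with hh
    have hhk : h < k := by omega
    -- The diffusive length scale, which balances `N ^ (-d)` against `N ^ 2` times the decrement of
    -- `α`.
    set N := ⌊√(θ * ((k : ℝ) + 1))⌋₊ with hN
    have hsN : 1 ≤ √(θ * ((k : ℝ) + 1)) := Real.one_le_sqrt.2 hsmall
    have hN1 : 1 ≤ N := Nat.le_floor (by simpa using hsN)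
    have hNle : (N : ℝ) ≤ √(θ * ((k : ℝ) + 1)) := Nat.floor_le (by positivity)
    have hNge : √(θ * ((k : ℝ) + 1)) / 2 ≤ N := by
      have h1 := Nat.lt_floor_add_one (√(θ * ((k : ℝ) + 1)))
      have h2 : (1 : ℝ) ≤ N := by exact_mod_cast hN1
      simp only [← hN] at h1
      linarith
    have hN2 : (N : ℝ) ^ 2 ≤ θ * ((k : ℝ) + 1) := by
      calc (N : ℝ) ^ 2 ≤ √(θ * ((k : ℝ) + 1)) ^ 2 := by gcongr
        _ = _ := Real.sq_sqrt (by positivity)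
    have hNd : ((N : ℝ) ^ d)⁻¹ ≤ (2 / √θ) ^ d * (√((k : ℝ) + 1) ^ d)⁻¹ := by
      rw [← inv_pow, ← inv_pow, ← mul_pow]
      gcongr
      rw [Real.sqrt_mul hθ0.le] at hNge
      rw [inv_le_comm₀ (by exact_mod_cast hN1) (by positivity)]
      refine le_trans (le_of_eq ?_) hNge
      field_simp
    have hkh : ((k : ℝ) + 1) / 4 ≤ ((k - h : ℕ) : ℝ) := by
      have : k + 1 ≤ 4 * (k - h) := by omega
      have : ((k : ℝ) + 1) ≤ 4 * ((k - h : ℕ) : ℝ) := by exact_mod_cast this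
      linarith
    have hkh0 : (0 : ℝ) < ((k - h : ℕ) : ℝ) := by linarith
    have hh4 : ((k : ℝ) + 1) / 4 ≤ (h : ℝ) + 1 := by
      have : k + 1 ≤ 4 * (h + 1) := by omega
      have : ((k : ℝ) + 1) ≤ 4 * ((h : ℝ) + 1) := by exact_mod_cast this
      linarith
    have hsh : √((k : ℝ) + 1) / 2 ≤ √((h : ℝ) + 1) := by
      apply Real.le_sqrt_of_sq_le
      rw [div_pow, Real.sq_sqrt hk1.le]; linarith
    have htail : ∀ i ∈ Finset.Ico h k, (√((i : ℝ) + 2) ^ (d + 2))⁻¹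
        ≤ D * (√((k : ℝ) + 1) ^ (d + 2))⁻¹ := by
      intro i hi
      have hi' : (h : ℝ) ≤ i := by exact_mod_cast (Finset.mem_Ico.1 hi).1
      have h1 : √((k : ℝ) + 1) / 2 ≤ √((i : ℝ) + 2) :=
        hsh.trans (Real.sqrt_le_sqrt (by linarith))
      calc (√((i : ℝ) + 2) ^ (d + 2))⁻¹ ≤ ((√((k : ℝ) + 1) / 2) ^ (d + 2))⁻¹ := by gcongr
        _ = _ := by rw [div_pow, inv_div, hD]; field_simp
    set S := (√((k : ℝ) + 1) ^ d)⁻¹ with hS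
    have hS0 : 0 < S := by positivity
    have hS2 : ((k : ℝ) + 1) * (√((k : ℝ) + 1) ^ (d + 2))⁻¹ = S := by
      rw [hS, pow_add, Real.sq_sqrt hk1.le]; field_simp
    have hαh : α h ≤ D * B * S := by
      refine (ih h hhk (by omega)).trans ?_
      have : (√((h : ℝ) + 1) ^ d)⁻¹ ≤ D * S := by
        calc (√((h : ℝ) + 1) ^ d)⁻¹ ≤ ((√((k : ℝ) + 1) / 2) ^ d)⁻¹ := by gcongr
          _ = 2 ^ d * S := by rw [div_pow, inv_div, hS]; field_simp
          _ ≤ D * S := by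
            gcongr
            exact pow_le_pow_right₀ one_le_two (by omega)
      calc _ ≤ B * (D * S) := by gcongr
        _ = _ := by ring
    -- The recursion is summed over the second half of the time interval: monotonicity bounds the
    -- left side below and the decrements telescope to at most `α h`.
    have hsum : ((k - h : ℕ) : ℝ) * α k ≤ K * (((k - h : ℕ) : ℝ) * ((N : ℝ) ^ d)⁻¹
        + N ^ 2 * (α h - α k) + N ^ 2 * (((k - h : ℕ) : ℝ) * (D * (√((k : ℝ) + 1) ^ (d + 2))⁻¹))) := by
      have e1 : ((k - h : ℕ) : ℝ) * α k ≤ ∑ i ∈ Finset.Ico h k, α i := by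
        have := Finset.card_nsmul_le_sum (Finset.Ico h k) α (α k)
          fun i hi => hanti (Finset.mem_Ico.1 hi).2.le
        simpa using this
      have e2 : ∑ i ∈ Finset.Ico h k, α i ≤ ∑ i ∈ Finset.Ico h k, K * (((N : ℝ) ^ d)⁻¹
          + N ^ 2 * (α i - α (i + 1)) + N ^ 2 * (D * (√((k : ℝ) + 1) ^ (d + 2))⁻¹)) := by
        refine Finset.sum_le_sum fun i hi => ?_
        refine (hrec i N (by have := (Finset.mem_Ico.1 hi).2; omega) hN1).trans ?_
        have := htail i hi
        gcongr
      refine e1.trans (e2.trans (le_of_eq ?_))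
      rw [← Finset.mul_sum, Finset.sum_add_distrib, Finset.sum_add_distrib, ← Finset.mul_sum,
        Finset.sum_const, Finset.sum_const, Nat.card_Ico, nsmul_eq_mul, nsmul_eq_mul]
      have : ∑ i ∈ Finset.Ico h k, (α i - α (i + 1)) = α h - α k := by
        have := Finset.sum_Ico_sub α hhk.le
        rw [← neg_sub (α k), ← this, ← Finset.sum_neg_distrib]
        simp
      rw [this]; ring
    have hfin : α k ≤ K * (((N : ℝ) ^ d)⁻¹ + 4 * θ * (D * B * S) + θ * D * S) := by
      have hN2h : (N : ℝ) ^ 2 ≤ ((k - h : ℕ) : ℝ) * (4 * θ) := by nlinarith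
      have h3 : (N : ℝ) ^ 2 * (α h - α k) ≤ ((k - h : ℕ) : ℝ) * (4 * θ) * (D * B * S) := by
        have h0 : 0 ≤ α h - α k := sub_nonneg.2 (hanti hhk.le)
        have h1 : α h - α k ≤ D * B * S := by linarith [hnn k]
        gcongr
      have h4 : (N : ℝ) ^ 2 * (((k - h : ℕ) : ℝ) * (D * (√((k : ℝ) + 1) ^ (d + 2))⁻¹))
          ≤ ((k - h : ℕ) : ℝ) * (θ * D * S) := by
        calc _ ≤ (θ * ((k : ℝ) + 1)) * (((k - h : ℕ) : ℝ) * (D * (√((k : ℝ) + 1) ^ (d + 2))⁻¹)) := by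
              gcongr
          _ = ((k - h : ℕ) : ℝ) * (θ * D * (((k : ℝ) + 1) * (√((k : ℝ) + 1) ^ (d + 2))⁻¹)) := by ring
          _ = _ := by rw [hS2]
      refine le_of_mul_le_mul_left (hsum.trans ?_) hkh0
      calc _ ≤ K * (((k - h : ℕ) : ℝ) * ((N : ℝ) ^ d)⁻¹ + ((k - h : ℕ) : ℝ) * (4 * θ) * (D * B * S)
            + ((k - h : ℕ) : ℝ) * (θ * D * S)) := by gcongr
        _ = _ := by ring
    have hKθ : K * θ * D = 1 / 8 := by rw [hθ]; field_simp
    have : α k ≤ (K * (2 / √θ) ^ d + B / 2 + 1 / 8) * S := by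
      refine hfin.trans ?_
      calc _ ≤ K * ((2 / √θ) ^ d * S + 4 * θ * (D * B * S) + θ * D * S) := by gcongr
        _ = (K * (2 / √θ) ^ d + 4 * (K * θ * D) * B + K * θ * D) * S := by ring
        _ = _ := by rw [hKθ]; ring
    refine this.trans ?_
    gcongr
    have : 0 ≤ A * (√(1 / θ)) ^ d := by positivity
    linarith

end Sequences

/-! ### How the radius `R_m` beats the Gaussian tails. -/

section Numerics

/-- In the main case the gap is `(L - 4 e) ^ 2 / 4`. It removes shifts of order `ε` inside a
Gaussian at the price of a factor `3 / 4` in the exponent and a constant in front. -/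
theorem three_quarters_sq_sub_le {s L e : ℝ} (hL : 0 ≤ L) (h : L - e ≤ s) :
    3 / 4 * L ^ 2 - 3 * e ^ 2 ≤ (max s 0) ^ 2 := by
  rcases le_total L e with h1 | h1
  · nlinarith [sq_nonneg (max s 0)]
  · have h2 : L - e ≤ max s 0 := h.trans (le_max_left _ _)
    have h3 : (L - e) ^ 2 ≤ (max s 0) ^ 2 := by
      have : 0 ≤ L - e := by linarith
      gcongr
    nlinarith [sq_nonneg (L - 4 * e)]

theorem log_scale_eq {d j : ℕ} (hj : 1 ≤ j) {ε : ℝ} (hε : 0 < ε) :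
    Real.log (j * (ε ^ (d + 2))⁻¹) = Real.log j - (d + 2) * Real.log ε := by
  have : (0 : ℝ) < j := by exact_mod_cast hj
  rw [Real.log_mul this.ne' (by positivity), Real.log_inv, Real.log_pow]
  push_cast; ring

theorem log_scale_nonneg {d j : ℕ} (hj : 1 ≤ j) {ε : ℝ} (hε : 0 < ε) (hε1 : ε ≤ 1) :
    0 ≤ Real.log (j * (ε ^ (d + 2))⁻¹) := by
  have h1 := Real.log_natCast_nonneg j
  have h2 := Real.log_nonpos hε.le hε1
  rw [log_scale_eq hj hε]
  nlinarith [mul_nonneg (by positivity : (0 : ℝ) ≤ (d : ℝ) + 2) (neg_nonneg.2 h2)]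

theorem sqrt_pow_eq_exp {x : ℝ} (hx : 0 < x) (n : ℕ) :
    (√x ^ n)⁻¹ = Real.exp (-(n / 2 * Real.log x)) := by
  rw [Real.exp_neg, ← Real.exp_log (Real.sqrt_pos.2 hx), ← Real.exp_nat_mul, Real.log_sqrt hx.le]
  congr 2; ring

/-- For the power of `j` this needs `3 d / 2 ≥ (d + 2) / 2`, which is where `d ≥ 1` enters. -/
theorem exp_neg_log_scale_le {d j : ℕ} (hd : 1 ≤ d) (hj : 1 ≤ j) {ε : ℝ} (hε : 0 < ε) (hε1 : ε ≤ 1) :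
    Real.exp (-(3 / 2 * d * Real.log (j * (ε ^ (d + 2))⁻¹))) ≤ ε ^ d * (√(j : ℝ) ^ (d + 2))⁻¹ := by
  have hj0 : (0 : ℝ) < j := by exact_mod_cast hj
  have hd1 : (1 : ℝ) ≤ d := by exact_mod_cast hd
  have h1 := Real.log_natCast_nonneg j
  have h2 := Real.log_nonpos hε.le hε1
  have h3 : ε ^ d = Real.exp (d * Real.log ε) := by rw [Real.exp_nat_mul, Real.exp_log hε]
  rw [sqrt_pow_eq_exp hj0, h3, ← Real.exp_add, log_scale_eq hj hε]
  apply Real.exp_le_exp.2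
  push_cast
  have h4 : 0 ≤ (d - 1) * Real.log j := mul_nonneg (by linarith) h1
  have h5 : 0 ≤ (d : ℝ) * (3 / 2 * (d + 2) - 1) * (-Real.log ε) :=
    mul_nonneg (mul_nonneg (by linarith) (by linarith)) (by linarith)
  nlinarith

theorem radiusK_mono_le {d j m : ℕ} (hj : 1 ≤ j) (hjm : j ≤ m) {ε : ℝ} (hε : 0 < ε) : radiusK d ε j ≤ radiusK d ε m := by
  have hj0 : (0 : ℝ) < j := by exact_mod_cast hj
  have hjm' : (j : ℝ) ≤ m := by exact_mod_cast hjm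
  unfold radiusK epsK
  gcongr

theorem half_radius_sq {d j : ℕ} (hj : 1 ≤ j) {ε : ℝ} (hε : 0 < ε) (hε1 : ε ≤ 1) :
    ((radiusK d ε j - 5 * ε) / 2) ^ 2 = 2 * d * Real.log (j * (ε ^ (d + 2))⁻¹) * (j * ε ^ 2) := by
  have h := log_scale_nonneg (d := d) hj hε hε1
  unfold radiusK epsK
  rw [add_sub_cancel_left, div_pow, mul_pow, mul_pow, Real.sq_sqrt (by positivity),
    Real.sq_sqrt (by positivity)]
  ring

theorem radius_sub_nonneg (d j : ℕ) {ε : ℝ} (hε : 0 < ε) : 0 ≤ (radiusK d ε j - 5 * ε) / 2 := by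
  unfold radiusK epsK
  rw [add_sub_cancel_left]; positivity

/-- The cut-off error at distance `R / 2 - ε`. As `R / 2 - 3 ε = (R - 5 ε) / 2 - ε / 2`, the
definition of `R_m` leaves a shift of only `ε / 2`, paid for by the factor `exp 1`. -/
theorem exp_tail_le {d j m : ℕ} (hd : 1 ≤ d) (hj : 1 ≤ j) (hjm : j ≤ m) {ε R : ℝ} (hε : 0 < ε)
    (hε1 : ε ≤ 1) (hR : radiusK d ε m ≤ R) :
    Real.exp (-(max (R / 2 - 3 * ε) 0) ^ 2 / (2 * j * ε ^ 2)) ^ 2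
      ≤ Real.exp 1 * (ε ^ d * (√(j : ℝ) ^ (d + 2))⁻¹) := by
  have hj0 : (0 : ℝ) < j := by exact_mod_cast hj
  have hj1 : (1 : ℝ) ≤ j := by exact_mod_cast hj
  have h1 := three_quarters_sq_sub_le (s := R / 2 - 3 * ε) (e := ε / 2) (radius_sub_nonneg d j hε)
    (by linarith [radiusK_mono_le (d := d) hj hjm hε])
  rw [half_radius_sq hj hε hε1] at h1
  calc _ ≤ Real.exp (1 + -(3 / 2 * d * Real.log (j * (ε ^ (d + 2))⁻¹))) := by
        rw [← Real.exp_nat_mul]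
        apply Real.exp_le_exp.2
        set Y := Real.log (j * (ε ^ (d + 2))⁻¹)
        have e1 : ((2 : ℕ) : ℝ) * (-(max (R / 2 - 3 * ε) 0) ^ 2 / (2 * j * ε ^ 2))
            = -((max (R / 2 - 3 * ε) 0) ^ 2 / (j * ε ^ 2)) := by
          push_cast; field_simp
        rw [e1]
        have : 3 / 2 * d * Y - 1 ≤ (max (R / 2 - 3 * ε) 0) ^ 2 / (j * ε ^ 2) := by
          rw [le_div_iff₀ (by positivity)]
          nlinarith [sq_pos_of_pos hε, mul_pos hj0 (sq_pos_of_pos hε),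
            mul_le_mul_of_nonneg_right hj1 (sq_nonneg ε)]
        linarith
    _ ≤ _ := by
        rw [Real.exp_add]
        gcongr
        exact exp_neg_log_scale_le hd hj hε hε1

/-- Beyond distance `R / 2` the Gaussian bound alone already gives the on-diagonal rate. -/
theorem exp_far_le {d j m : ℕ} (hj : 1 ≤ j) (hjm : j ≤ m) {ε R D : ℝ} (hε : 0 < ε)
    (hε1 : ε ≤ 1) (hR : radiusK d ε m ≤ R) (hD : R / 2 ≤ D) :
    Real.exp (-(max (D - 2 * ε) 0) ^ 2 / (2 * j * ε ^ 2)) ≤ (√(j : ℝ) ^ d)⁻¹ := by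
  have hj0 : (0 : ℝ) < j := by exact_mod_cast hj
  have h1 : (radiusK d ε j - 5 * ε) / 2 ≤ max (D - 2 * ε) 0 :=
    le_max_of_le_left (by linarith [radiusK_mono_le (d := d) hj hjm hε])
  have h2 : ((radiusK d ε j - 5 * ε) / 2) ^ 2 ≤ (max (D - 2 * ε) 0) ^ 2 := by
    have := radius_sub_nonneg d j hε
    gcongr
  rw [half_radius_sq hj hε hε1] at h2
  rw [sqrt_pow_eq_exp hj0]
  apply Real.exp_le_exp.2
  rw [neg_div, neg_le_neg_iff, le_div_iff₀ (by positivity)]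
  refine le_trans ?_ h2
  have h3 : Real.log j ≤ Real.log (j * (ε ^ (d + 2))⁻¹) := by
    rw [log_scale_eq hj hε]
    have := Real.log_nonpos hε.le hε1
    nlinarith [mul_nonneg (by positivity : (0 : ℝ) ≤ (d : ℝ) + 2) (neg_nonneg.2 this)]
  have h0 := Real.log_natCast_nonneg j
  calc (d : ℝ) / 2 * Real.log j * (2 * j * ε ^ 2) = (d * (j * ε ^ 2)) * Real.log j := by ring
    _ ≤ (d * (j * ε ^ 2)) * (2 * Real.log (j * (ε ^ (d + 2))⁻¹)) := by gcongr; linarith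
    _ = _ := by ring

end Numerics

/-! ### On-diagonal decay away from the boundary. -/

section OnDiagonal

variable {d : ℕ} {μ : Measure (Pt d)} {Ω : Set (Pt d)} {a A : ℝ}

theorem volume_ball_eq_ofReal {r : ℝ} (hr : 0 < r) :
    volume (Metric.ball (0 : Pt d) r)
      = ENNReal.ofReal (r ^ d * volume.real (Metric.ball (0 : Pt d) 1)) := by
  rw [Measure.addHaar_ball_of_pos _ _ hr, finrank_euclideanSpace_fin, ENNReal.ofReal_mul (by positivity),
    measureReal_def, ENNReal.ofReal_toReal measure_ball_lt_top.ne]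

theorem volume_closedBall_eq_ofReal {r : ℝ} (hr : 0 ≤ r) :
    volume (Metric.closedBall (0 : Pt d) r)
      = ENNReal.ofReal (r ^ d * volume.real (Metric.ball (0 : Pt d) 1)) := by
  rw [Measure.addHaar_closedBall _ _ hr, finrank_euclideanSpace_fin,
    ENNReal.ofReal_mul (by positivity), measureReal_def,
    ENNReal.ofReal_toReal measure_ball_lt_top.ne]

theorem volume_real_ball_pos : 0 < volume.real (Metric.ball (0 : Pt d) 1) :=
  ENNReal.toReal_pos (Metric.measure_ball_pos _ _ one_pos).ne' measure_ball_lt_top.ne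

theorem le_ofReal_div {p Z : ℝ} (hp : 0 < p) {X : ℝ≥0∞}
    (h : ENNReal.ofReal p * X ≤ ENNReal.ofReal Z) : X ≤ ENNReal.ofReal (Z / p) := by
  rw [ENNReal.ofReal_div_of_pos hp]
  rw [ENNReal.le_div_iff_mul_le (Or.inl (by simpa using hp)) (Or.inl ENNReal.ofReal_ne_top), mul_comm]
  exact h

theorem IsComparable.ae_deg (h : IsComparable μ Ω a A) {w : Pt d → Pt d → ℝ} {c : ℝ}
    (hdeg : ∀ x ∈ Ω, c ≤ kernelDeg μ w x) : ∀ᵐ y ∂μ, c ≤ kernelDeg μ w y :=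
  h.ae_mem.mono hdeg

/-- Mass conservation in Lebesgue measure: `c` removes the degree weight and `a⁻¹` the density. -/
theorem lintegral_heat_le (h : IsComparable μ Ω a A) [IsProbabilityMeasure μ]
    {w : Pt d → Pt d → ℝ} (hw : IsSymmKernel w) {c C : ℝ} (hc : 0 < c)
    (hdeg : ∀ x ∈ Ω, c ≤ kernelDeg μ w x) (hC : ∀ x, kernelDeg μ w x ≤ C) (k : ℕ) (y : Pt d) :
    ∫⁻ x in Ω, ENNReal.ofReal ((hw.heat μ hc k y : Pt d → ℝ) x)
      ≤ ENNReal.ofReal (a⁻¹ * (C / c)) := by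
  have ha := h.pos
  refine (h.setLIntegral_le _).trans ?_
  rw [ENNReal.ofReal_mul (by positivity)]
  gcongr
  obtain ⟨K, _, hK⟩ := exists_abs_le_coe (hw.heat μ hc k y)
  rw [← ofReal_integral_eq_lintegral_ofReal (integrable_of_abs_le (measurable_coe _) hK)
    (ae_of_all _ (hw.heat_nonneg hc k y))]
  apply ENNReal.ofReal_le_ofReal
  rw [le_div_iff₀ hc, ← integral_mul_const]
  refine le_trans ?_ ((hw.form_heat_one_le hc (h.ae_deg hdeg) k y).trans (hC y))
  rw [IsSymmKernel.form_apply]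
  refine integral_mono_ae ((integrable_of_abs_le (measurable_coe _) hK).mul_const c)
    (hw.integrable_mul_mul_deg _ _) ((h.ae_deg hdeg).mono fun x hx => ?_)
  simp only [IsSymmKernel.oneB, mul_one]
  exact mul_le_mul_of_nonneg_left hx (hw.heat_nonneg hc k y x)

set_option maxHeartbeats 1000000 in
-- `nonlocal_nash` at scale `δ ε` for the heat kernel cut off to a ball inside `Ω`, with mass
-- bounded by `lintegral_heat_le` and energy by `pairEnergy_indicator_le`. Working inside a ball
-- avoids any extension across the boundary; the price is the term in `t`.
theorem exists_form_heat_recursion (d : ℕ) {a A κ δ c C : ℝ} (ha : 0 < a) (hA : 0 < A)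
    (hκ : 0 < κ) (hδ : 0 < δ) (hc : 0 < c) (hC0 : 0 < C) :
    ∃ K : ℝ, 0 < K ∧ ∀ (μ : Measure (Pt d)) [IsProbabilityMeasure μ] (Ω : Set (Pt d)),
      IsComparable μ Ω a A → ∀ (w : Pt d → Pt d → ℝ) (ε Λ : ℝ) (hw : IsScaledKernel w ε Λ κ δ),
      (∀ x ∈ Ω, c ≤ kernelDeg μ w x) → (∀ x, kernelDeg μ w x ≤ C) →
      ∀ (y : Pt d) (r t : ℝ) (k N : ℕ), Metric.ball y r ⊆ Ω → 1 ≤ N →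
      (∀ x ∈ Ω, r - ε ≤ dist x y → (hw.heat μ hc k y : Pt d → ℝ) x ≤ t
        ∧ (hw.heat μ hc (k + 1) y : Pt d → ℝ) x ≤ t) →
      hw.form μ (hw.heat μ hc k y) (hw.heat μ hc k y) ≤ K * ((ε ^ d)⁻¹ * ((N : ℝ) ^ d)⁻¹
        + N ^ 2 * (hw.form μ (hw.heat μ hc k y) (hw.heat μ hc k y)
          - hw.form μ (hw.heat μ hc (k + 1) y) (hw.heat μ hc (k + 1) y)) + N ^ 2 * t ^ 2) := by
  set V := volume.real (Metric.ball (0 : Pt d) 1)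
  have hV : 0 < V := volume_real_ball_pos
  set I := a⁻¹ * (C / c)
  have hI : 0 < I := by positivity
  set K₁ := 2 * I ^ 2 / (δ ^ d * V)
  set K₂ := 4 * 2 ^ d * (κ⁻¹ * a⁻¹ ^ 2) / (δ ^ d * V)
  set K₃ := 8 * 2 ^ d * a⁻¹ + a⁻¹
  have hK₁ : 0 < K₁ := by positivity
  have hK₂ : 0 < K₂ := by positivity
  have hK₃ : 0 < K₃ := by positivity
  refine ⟨C * A * (K₁ + K₂ + K₃), by positivity, ?_⟩
  intro μ _ Ω h w ε Λ hw hdeg hC y r t k N hball hN ht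
  have hε := hw.eps_pos
  have hNr : (1 : ℝ) ≤ N := by exact_mod_cast hN
  have hN0 : (0 : ℝ) < N := by linarith
  set f := hw.heat μ hc k y with hf
  have hf0 : ∀ x, 0 ≤ (f : Pt d → ℝ) x := hw.heat_nonneg hc k y
  have hf1 : hw.walkB μ f = hw.heat μ hc (k + 1) y := (hw.heat_succ hc k y).symm
  have hg0 : ∀ x, 0 ≤ walk μ w f x := fun x => by
    have := hw.heat_nonneg (ν := μ) hc (k + 1) y x
    rwa [← hf1] at this
  set E := hw.form μ f f - hw.form μ (hw.heat μ hc (k + 1) y) (hw.heat μ hc (k + 1) y) with hE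
  have hE0 : 0 ≤ E := by rw [hE, ← hf1]; linarith [hw.form_walkB_self_le (ν := μ) f]
  have ht' : ∀ x ∈ Ω, r - ε ≤ dist x y → |(f : Pt d → ℝ) x| ≤ t ∧ |walk μ w f x| ≤ t := by
    intro x hx hxy
    rw [abs_of_nonneg (hf0 x), abs_of_nonneg (hg0 x)]
    have := ht x hx hxy
    rwa [← hf1] at this
  set B := Metric.ball y r
  set F : Pt d → ℝ := B.indicator f
  set G : Pt d → ℝ := B.indicator (walk μ w f)
  have hFm : Measurable F := (measurable_coe f).indicator measurableSet_ball
  have hGm : Measurable G := (measurable_coe (hw.walkB μ f)).indicator measurableSet_ball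
  have hF0 : ∀ x, 0 ≤ F x := fun x => Set.indicator_nonneg (fun x _ => hf0 x) x
  set J := ε ^ d * κ⁻¹ * a⁻¹ ^ 2 * E + 2 * (a⁻¹ * t ^ 2 * ((δ * ε) ^ d * V)) with hJ
  have hJ0 : 0 ≤ J := by positivity
  have hJle : pairEnergy (δ * ε) F G ≤ ENNReal.ofReal J := by
    refine (pairEnergy_indicator_le h hw f hball ht').trans (le_of_eq ?_)
    rw [hf1, volume_closedBall_eq_ofReal (by positivity), ← ENNReal.ofReal_mul (by positivity),
      two_mul_ofReal, ← ENNReal.ofReal_add (by positivity) (by positivity)]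
  have hIle : ∫⁻ x, ENNReal.ofReal (F x) ≤ ENNReal.ofReal I := by
    refine le_trans ?_ (lintegral_heat_le h hw.toIsSymmKernel hc hdeg hC k y)
    rw [← lintegral_indicator h.measurableSet]
    refine lintegral_mono fun x => ?_
    by_cases hx : x ∈ B
    · simp only [F, Set.indicator_of_mem hx, Set.indicator_of_mem (hball hx)]; exact le_rfl
    · simp [F, Set.indicator_of_notMem hx]
  set p := (δ * ε / 2) ^ d * V
  set q := (N * (δ * ε)) ^ d * V
  have hp : 0 < p := by positivity
  have hq : 0 < q := by positivity
  have hX : ∫⁻ x, ENNReal.ofReal (F x ^ 2)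
      ≤ ENNReal.ofReal ((2 * (p * I ^ 2) + q * (N ^ 2 * (4 * J))) / p / q) := by
    apply le_ofReal_div hq
    apply le_ofReal_div hp
    have hn := nonlocal_nash hFm hGm hF0 (δ := δ * ε) (N := N) (by omega)
    rw [volume_ball_eq_ofReal (by positivity), volume_ball_eq_ofReal (by positivity)] at hn
    refine hn.trans ?_
    rw [ENNReal.ofReal_add (by positivity) (by positivity), ← two_mul_ofReal,
      ENNReal.ofReal_mul (by positivity : 0 ≤ p), ENNReal.ofReal_pow hI.le,
      ENNReal.ofReal_mul (by positivity : 0 ≤ q),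
      ENNReal.ofReal_mul (by positivity : 0 ≤ (N : ℝ) ^ 2),
      ENNReal.ofReal_mul (by positivity : (0 : ℝ) ≤ 4), ENNReal.ofReal_pow (by positivity),
      ENNReal.ofReal_natCast, ENNReal.ofReal_ofNat]
    gcongr
  have hform : hw.form μ f f
      ≤ C * A * ((2 * (p * I ^ 2) + q * (N ^ 2 * (4 * J))) / p / q + a⁻¹ * t ^ 2) := by
    set X₀ := (2 * (p * I ^ 2) + q * (N ^ 2 * (4 * J))) / p / q with hX₀
    have hX₀0 : 0 ≤ X₀ := by positivity
    obtain ⟨M, _, hM⟩ := exists_abs_le_coe f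
    have hint : Integrable (fun x => (f : Pt d → ℝ) x ^ 2) μ :=
      integrable_of_abs_le ((measurable_coe f).pow_const 2) (C := M ^ 2) fun x => by
        rw [abs_pow]; have := hM x; gcongr
    have h1 : hw.form μ f f ≤ C * ∫ x, (f : Pt d → ℝ) x ^ 2 ∂μ := by
      rw [IsSymmKernel.form_apply, ← integral_const_mul]
      refine integral_mono (hw.integrable_mul_mul_deg _ _) (hint.const_mul C) fun x => ?_
      simp only
      rw [← sq, mul_comm]
      exact mul_le_mul_of_nonneg_right (hC x) (sq_nonneg _)
    have h2 : ∫ x, (f : Pt d → ℝ) x ^ 2 ∂μ ≤ A * (X₀ + a⁻¹ * t ^ 2) := by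
      rw [← ENNReal.ofReal_le_ofReal_iff (by positivity),
        ofReal_integral_eq_lintegral_ofReal hint (ae_of_all _ fun x => sq_nonneg _),
        ENNReal.ofReal_mul hA.le]
      refine (h.lintegral_le _).trans ?_
      gcongr
      rw [ENNReal.ofReal_add hX₀0 (by positivity)]
      calc ∫⁻ x in Ω, ENNReal.ofReal ((f : Pt d → ℝ) x ^ 2)
          ≤ ∫⁻ x in Ω, (ENNReal.ofReal (F x ^ 2) + ENNReal.ofReal (t ^ 2)) := by
            refine setLIntegral_mono' h.measurableSet fun x hx => ?_
            by_cases hxB : x ∈ B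
            · simp only [F, Set.indicator_of_mem hxB]
              exact le_self_add
            · refine le_add_of_nonneg_of_le zero_le (ENNReal.ofReal_le_ofReal ?_)
              have hxy : r ≤ dist x y := by simpa [B] using hxB
              have := (ht x hx (by linarith)).1
              have := hf0 x
              gcongr
        _ = (∫⁻ x in Ω, ENNReal.ofReal (F x ^ 2)) + ENNReal.ofReal (t ^ 2) * volume Ω := by
            rw [lintegral_add_right _ measurable_const, setLIntegral_const]
        _ ≤ _ := by
            refine add_le_add ((setLIntegral_le_lintegral _ _).trans hX) ?_
            rw [mul_comm a⁻¹, ENNReal.ofReal_mul (by positivity)]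
            gcongr
            exact h.volume_le
    calc _ ≤ C * (A * (X₀ + a⁻¹ * t ^ 2)) := h1.trans (by gcongr)
      _ = _ := by ring
  refine hform.trans ?_
  have hsplit : (2 * (p * I ^ 2) + q * (N ^ 2 * (4 * J))) / p / q + a⁻¹ * t ^ 2
      = K₁ * ((ε ^ d)⁻¹ * ((N : ℝ) ^ d)⁻¹) + K₂ * (N ^ 2 * E)
        + (8 * 2 ^ d * a⁻¹ * (N ^ 2 * t ^ 2) + a⁻¹ * t ^ 2) := by
    have e1 : (2 * (p * I ^ 2) + q * (N ^ 2 * (4 * J))) / p / q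
        = 2 * I ^ 2 / q + 4 * N ^ 2 * (J / p) := by
      field_simp
    have e2 : J / p = 2 ^ d * (κ⁻¹ * a⁻¹ ^ 2) / (δ ^ d * V) * E + 2 * 2 ^ d * a⁻¹ * t ^ 2 := by
      simp only [hJ, p, div_pow, mul_pow]
      field_simp
    rw [e1, e2]
    simp only [q, K₁, K₂, mul_pow]
    field_simp
    ring
  have hN2 : (1 : ℝ) ≤ N ^ 2 := one_le_pow₀ hNr
  have ht2 : 0 ≤ t ^ 2 := sq_nonneg t
  have hlast : 8 * 2 ^ d * a⁻¹ * (N ^ 2 * t ^ 2) + a⁻¹ * t ^ 2 ≤ K₃ * (N ^ 2 * t ^ 2) := by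
    simp only [K₃]
    have : a⁻¹ * t ^ 2 ≤ a⁻¹ * (N ^ 2 * t ^ 2) := by
      gcongr; nlinarith
    linarith
  rw [hsplit, mul_assoc (C * A)]
  gcongr
  have z1 : 0 ≤ (ε ^ d)⁻¹ * ((N : ℝ) ^ d)⁻¹ := by positivity
  have z2 : 0 ≤ N ^ 2 * E := by positivity
  have z3 : 0 ≤ N ^ 2 * t ^ 2 := by positivity
  nlinarith [mul_nonneg hK₁.le z2, mul_nonneg hK₁.le z3, mul_nonneg hK₂.le z1,
    mul_nonneg hK₂.le z3, mul_nonneg hK₃.le z1, mul_nonneg hK₃.le z2]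

/-- On-diagonal heat kernel bound at points away from the boundary. -/
theorem exists_form_heat_le {d : ℕ} (hd : 1 ≤ d) {a A κ δ c C Λ : ℝ} (ha : 0 < a) (hA : 0 < A)
    (hκ : 0 < κ) (hδ : 0 < δ) (hc : 0 < c) (hC0 : 0 < C) (hΛ : 0 < Λ) :
    ∃ K : ℝ, 0 < K ∧ ∀ (μ : Measure (Pt d)) [IsProbabilityMeasure μ] (Ω : Set (Pt d)),
      IsComparable μ Ω a A → ∀ (w : Pt d → Pt d → ℝ) (ε : ℝ) (hw : IsScaledKernel w ε Λ κ δ),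
      ε ≤ 1 → (∀ x ∈ Ω, c ≤ kernelDeg μ w x) → (∀ x, kernelDeg μ w x ≤ C) →
      ∀ (y : Pt d) (R : ℝ) (m : ℕ), Metric.ball y (R / 2) ⊆ Ω → radiusK d ε m ≤ R →
      ∀ k : ℕ, k + 2 ≤ m → hw.form μ (hw.heat μ hc k y) (hw.heat μ hc k y)
        ≤ K * (ε ^ d)⁻¹ * (√((k : ℝ) + 1) ^ d)⁻¹ := by
  obtain ⟨K₁, hK₁, hrec⟩ := exists_form_heat_recursion d ha hA hκ hδ hc hC0
  set T := 2 * Λ * C / c ^ 2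
  have hT : 0 < T := by positivity
  set K₂ := max 1 (K₁ * (1 + T ^ 2 * Real.exp 1))
  obtain ⟨B, hB, hdec⟩ := exists_decay_of_nash d K₂ (Λ / c * C) (le_max_left _ _) (by positivity)
  refine ⟨B, hB, ?_⟩
  intro μ _ Ω h w ε hw hε1 hdeg hC y R m hball hR k hk
  have hε := hw.eps_pos
  have hεd : 0 < ε ^ d := by positivity
  have hae := h.ae_deg hdeg
  -- The factor `ε ^ d` makes the sequence and its recursion independent of `ε`.
  set α : ℕ → ℝ := fun k => ε ^ d * hw.form μ (hw.heat μ hc k y) (hw.heat μ hc k y) with hα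
  have hanti : Antitone α := fun i j hij =>
    mul_le_mul_of_nonneg_left (hw.form_heat_self_antitone hc y hij) hεd.le
  have key := hdec m α hanti (fun k => mul_nonneg hεd.le (hw.form_self_nonneg _)) ?_ ?_ k hk
  · rw [mul_right_comm, ← div_eq_mul_inv _ (ε ^ d), le_div_iff₀ hεd, mul_comm]
    exact key
  · simp only [hα]
    rw [IsSymmKernel.heat_zero]
    calc _ ≤ ε ^ d * (Λ * (ε ^ d)⁻¹ / c * C) := by
          gcongr
          exact (hw.form_seed_self_le hc hae hw.le y).trans
            (mul_le_mul_of_nonneg_left (hC y) (by positivity))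
      _ = _ := by field_simp
  · intro i N hi hN
    -- The recursion at `i` involves `heat i` and `heat (i + 1)`, so `i + 2` steps at most; the
    -- weaker of the two Gaussians serves for both.
    set e := Real.exp (-(max (R / 2 - 3 * ε) 0) ^ 2 / (2 * ((i + 2 : ℕ) : ℝ) * ε ^ 2)) with he
    have htail : ∀ j ≤ i + 1, ∀ x ∈ Ω, R / 2 - ε ≤ dist x y →
        (hw.heat μ hc j y : Pt d → ℝ) x ≤ T * (ε ^ d)⁻¹ * e := by
      intro j hj x hx hxy
      refine (hw.heat_le_gaussian hc hε hw.range hw.le hae j (hC y) (hC x) (hdeg x hx)).trans ?_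
      have e1 : 2 * (Λ * (ε ^ d)⁻¹) * C / c ^ 2 = T * (ε ^ d)⁻¹ := by simp only [T]; ring
      rw [e1]
      gcongr
      rw [he]
      apply Real.exp_le_exp.2
      rw [neg_div, neg_div, neg_le_neg_iff]
      have hj' : (j : ℝ) + 1 ≤ ((i + 2 : ℕ) : ℝ) := by exact_mod_cast (by omega : j + 1 ≤ i + 2)
      have h5 : max (R / 2 - 3 * ε) 0 ≤ max (dist x y - 2 * ε) 0 :=
        max_le_max_right 0 (by linarith)
      rw [dist_comm y x]
      gcongr
    have hr := hrec μ Ω h w ε Λ hw hdeg hC y (R / 2) (T * (ε ^ d)⁻¹ * e) i N hball hN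
      fun x hx hxy => ⟨htail i (by omega) x hx hxy, htail (i + 1) le_rfl x hx hxy⟩
    have he2 : e ^ 2 ≤ Real.exp 1 * (ε ^ d * (√((i : ℝ) + 2) ^ (d + 2))⁻¹) := by
      have := exp_tail_le hd (j := i + 2) (by omega) hi hε hε1 hR
      push_cast at this he ⊢
      rw [he]; exact this
    set S := (√((i : ℝ) + 2) ^ (d + 2))⁻¹
    have hS : 0 ≤ S := by positivity
    have hNd : 0 ≤ ((N : ℝ) ^ d)⁻¹ := by positivity
    have hdiff : 0 ≤ α i - α (i + 1) := sub_nonneg.2 (hanti (Nat.le_succ i))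
    calc α i ≤ ε ^ d * (K₁ * ((ε ^ d)⁻¹ * ((N : ℝ) ^ d)⁻¹
        + N ^ 2 * (hw.form μ (hw.heat μ hc i y) (hw.heat μ hc i y)
          - hw.form μ (hw.heat μ hc (i + 1) y) (hw.heat μ hc (i + 1) y))
        + N ^ 2 * (T * (ε ^ d)⁻¹ * e) ^ 2)) := mul_le_mul_of_nonneg_left hr hεd.le
      _ = K₁ * (((N : ℝ) ^ d)⁻¹ + N ^ 2 * (α i - α (i + 1)) + N ^ 2 * (T ^ 2 * (ε ^ d)⁻¹ * e ^ 2)) := by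
          simp only [hα]; field_simp
      _ ≤ K₁ * (((N : ℝ) ^ d)⁻¹ + N ^ 2 * (α i - α (i + 1))
          + N ^ 2 * (T ^ 2 * (ε ^ d)⁻¹ * (Real.exp 1 * (ε ^ d * S)))) := by gcongr
      _ = K₁ * (((N : ℝ) ^ d)⁻¹ + N ^ 2 * (α i - α (i + 1))
          + T ^ 2 * Real.exp 1 * (N ^ 2 * S)) := by field_simp
      _ ≤ K₁ * ((1 + T ^ 2 * Real.exp 1) * (((N : ℝ) ^ d)⁻¹ + N ^ 2 * (α i - α (i + 1))
          + N ^ 2 * S)) := by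
          gcongr
          have z1 : 0 ≤ T ^ 2 * Real.exp 1 := by positivity
          have z2 : 0 ≤ (N : ℝ) ^ 2 * (α i - α (i + 1)) := by positivity
          have z3 : 0 ≤ (N : ℝ) ^ 2 * S := by positivity
          nlinarith [mul_nonneg z1 z2, mul_nonneg z1 hNd]
      _ = K₁ * (1 + T ^ 2 * Real.exp 1) * (((N : ℝ) ^ d)⁻¹ + N ^ 2 * (α i - α (i + 1))
          + N ^ 2 * S) := by ring
      _ ≤ _ := by
          gcongr
          exact le_max_right _ _

/-- Uniform decay of the heat kernel centred at a point away from the boundary. -/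
theorem exists_heat_le {d : ℕ} (hd : 1 ≤ d) {a A κ δ c C Λ : ℝ} (ha : 0 < a) (hA : 0 < A)
    (hκ : 0 < κ) (hδ : 0 < δ) (hc : 0 < c) (hC0 : 0 < C) (hΛ : 0 < Λ) :
    ∃ K : ℝ, 0 < K ∧ ∀ (μ : Measure (Pt d)) [IsProbabilityMeasure μ] (Ω : Set (Pt d)),
      IsComparable μ Ω a A → ∀ (w : Pt d → Pt d → ℝ) (ε : ℝ) (hw : IsScaledKernel w ε Λ κ δ),
      ε ≤ 1 → (∀ x ∈ Ω, c ≤ kernelDeg μ w x) → (∀ x, kernelDeg μ w x ≤ C) →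
      ∀ (x : Pt d) (R : ℝ) (m : ℕ), Metric.ball x R ⊆ Ω → radiusK d ε m ≤ R →
      ∀ j : ℕ, j + 1 ≤ m → ∀ z ∈ Ω, (hw.heat μ hc j x : Pt d → ℝ) z
        ≤ K * (ε ^ d)⁻¹ * (√((j : ℝ) + 1) ^ d)⁻¹ := by
  obtain ⟨K₁, hK₁, hdiag⟩ := exists_form_heat_le hd ha hA hκ hδ hc hC0 hΛ
  set T := 2 * Λ * C / c ^ 2
  have hT : 0 < T := by positivity
  refine ⟨K₁ * 2 ^ d / c + T + Λ / c, by positivity, ?_⟩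
  intro μ _ Ω h w ε hw hε1 hdeg hC x R m hball hR j hj z hz
  have hε := hw.eps_pos
  have hεd : 0 < ε ^ d := by positivity
  have hae := h.ae_deg hdeg
  have hR0 : 0 ≤ R := by
    refine le_trans ?_ hR
    unfold radiusK epsK; positivity
  have hs : 0 < √((j : ℝ) + 1) := Real.sqrt_pos.2 (by positivity)
  rcases Nat.eq_zero_or_pos j with rfl | hj0
  · rw [IsSymmKernel.heat_zero, hw.seed_apply hc x (hdeg z hz)]
    calc w x z / kernelDeg μ w z ≤ Λ * (ε ^ d)⁻¹ / c :=
          div_le_div₀ (by positivity) (hw.le x z) hc (hdeg z hz)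
      _ = Λ / c * (ε ^ d)⁻¹ := by ring
      _ ≤ (K₁ * 2 ^ d / c + T + Λ / c) * (ε ^ d)⁻¹ := by
          gcongr
          have : 0 ≤ K₁ * 2 ^ d / c := by positivity
          linarith
      _ = _ := by simp
  by_cases hfar : R / 2 ≤ dist x z
  · have h1 := hw.heat_le_gaussian hc hε hw.range hw.le hae j (hC x) (hC z) (hdeg z hz)
    have h2 := exp_far_le (d := d) (j := j + 1) (by omega) hj hε hε1 hR hfar
    push_cast at h2
    calc _ ≤ 2 * (Λ * (ε ^ d)⁻¹) * C / c ^ 2 * (√((j : ℝ) + 1) ^ d)⁻¹ := h1.trans (by gcongr)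
      _ = T * (ε ^ d)⁻¹ * (√((j : ℝ) + 1) ^ d)⁻¹ := by simp only [T]; ring
      _ ≤ _ := by
          gcongr
          have : 0 ≤ K₁ * 2 ^ d / c := by positivity
          have : 0 ≤ Λ / c := by positivity
          linarith
  · push Not at hfar
    have hbz : Metric.ball z (R / 2) ⊆ Ω := by
      refine Set.Subset.trans (Metric.ball_subset_ball' ?_) hball
      rw [dist_comm]; linarith
    have hbx : Metric.ball x (R / 2) ⊆ Ω :=
      (Metric.ball_subset_ball (by linarith)).trans hball
    -- Near `x` the point `z` is itself the centre of a ball of radius `R / 2` in `Ω`. Splitting the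
    -- time into halves and Cauchy-Schwarz reduce the value at `z` to two on-diagonal quantities.
    obtain ⟨j, rfl⟩ : ∃ j', j = j' + 1 := ⟨j - 1, by omega⟩
    set i := j / 2
    set i' := j - j / 2
    have hii : j = i + i' := by omega
    set Y := K₁ * (ε ^ d)⁻¹ * (√((i : ℝ) + 1) ^ d)⁻¹
    have hYz : hw.form μ (hw.heat μ hc i z) (hw.heat μ hc i z) ≤ Y :=
      hdiag μ Ω h w ε hw hε1 hdeg hC z R m hbz hR i (by omega)
    have hYx : hw.form μ (hw.heat μ hc i' x) (hw.heat μ hc i' x) ≤ Y := by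
      refine (hdiag μ Ω h w ε hw hε1 hdeg hC x R m hbx hR i' (by omega)).trans ?_
      have : (i : ℝ) ≤ i' := by exact_mod_cast (by omega : i ≤ i')
      simp only [Y]
      gcongr
    have hY0 : 0 ≤ Y := by positivity
    have h1 : kernelDeg μ w z * (hw.heat μ hc (j + 1) x : Pt d → ℝ) z ≤ Y := by
      rw [hw.deg_mul_heat_succ hc hae, hii, ← hw.form_heat_heat hc]
      calc _ ≤ √Y * √Y := (le_abs_self _).trans ((hw.form_sq_le _ _).trans
            (mul_le_mul (Real.sqrt_le_sqrt hYz) (Real.sqrt_le_sqrt hYx) (by positivity)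
              (by positivity)))
        _ = Y := Real.mul_self_sqrt hY0
    have h2 : (hw.heat μ hc (j + 1) x : Pt d → ℝ) z ≤ Y / c := by
      rw [le_div_iff₀ hc, mul_comm]
      exact (mul_le_mul_of_nonneg_right (hdeg z hz) (hw.heat_nonneg hc _ x z)).trans h1
    have h3 : (√((i : ℝ) + 1) ^ d)⁻¹ ≤ 2 ^ d * (√(((j + 1 : ℕ) : ℝ) + 1) ^ d)⁻¹ := by
      have h4 : √(((j + 1 : ℕ) : ℝ) + 1) / 2 ≤ √((i : ℝ) + 1) := by
        apply Real.le_sqrt_of_sq_le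
        rw [div_pow, Real.sq_sqrt (by positivity)]
        have : (j + 1) + 1 ≤ 4 * (i + 1) := by omega
        have : (((j + 1 : ℕ) : ℝ) + 1) ≤ 4 * ((i : ℝ) + 1) := by exact_mod_cast this
        linarith
      calc (√((i : ℝ) + 1) ^ d)⁻¹ ≤ ((√(((j + 1 : ℕ) : ℝ) + 1) / 2) ^ d)⁻¹ := by gcongr
        _ = _ := by rw [div_pow, inv_div]; field_simp
    calc _ ≤ Y / c := h2
      _ ≤ K₁ * (ε ^ d)⁻¹ * (2 ^ d * (√(((j + 1 : ℕ) : ℝ) + 1) ^ d)⁻¹) / c := by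
          simp only [Y]; gcongr
      _ = K₁ * 2 ^ d / c * (ε ^ d)⁻¹ * (√(((j + 1 : ℕ) : ℝ) + 1) ^ d)⁻¹ := by ring
      _ ≤ _ := by
          gcongr
          have : 0 ≤ Λ / c := by positivity
          linarith

end OnDiagonal

/-! ### Lipschitz domains and degree bounds up to the boundary. -/

section Domain

variable {d : ℕ} {Ω : Set (Pt d)}

/-- Above a Lipschitz graph there is room for a ball in the vertical direction. -/
theorem exists_ball_subset_of_graph {z e : Pt d} (he : ‖e‖ = 1) {r : ℝ} {L : ℝ≥0}
    {γ : (Submodule.span ℝ {e})ᗮ → ℝ} (hγ : LipschitzWith L γ)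
    (hΩ : ∀ y ∈ Metric.ball z r,
      (y ∈ Ω ↔ γ ((Submodule.span ℝ {e})ᗮ.orthogonalProjectionOnto y) < ⟪e, y⟫))
    {θ s : ℝ} (hθ0 : 0 < θ) (hθ : θ * (1 + L) ≤ 1 / 4) (hs0 : 0 < s) (hs : s ≤ r / 2) {x : Pt d}
    (hx : x ∈ Ω) (hxz : x ∈ Metric.ball z (r / 2)) :
    Metric.ball (x + (s / 2) • e) (θ * s) ⊆ Ω ∩ Metric.ball x s := by
  have hL : (0 : ℝ) ≤ L := L.coe_nonneg
  have hθ4 : θ ≤ 1 / 4 := by nlinarith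
  intro y hy
  set p := x + (s / 2) • e
  have hyp : ‖y - p‖ < θ * s := by rwa [Metric.mem_ball, dist_eq_norm] at hy
  have hyx : ‖y - x‖ < s := by
    have h1 : y - x = (y - p) + (s / 2) • e := by simp only [p]; abel
    have h2 : ‖(s / 2) • e‖ = s / 2 := by
      rw [norm_smul, he, mul_one, Real.norm_of_nonneg (by linarith)]
    have := norm_add_le (y - p) ((s / 2) • e)
    rw [← h1, h2] at this
    nlinarith
  refine ⟨?_, by rwa [Metric.mem_ball, dist_eq_norm]⟩
  have hxz' : ‖x - z‖ < r / 2 := by rwa [Metric.mem_ball, dist_eq_norm] at hxz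
  have hyz : y ∈ Metric.ball z r := by
    rw [Metric.mem_ball, dist_eq_norm]
    have := norm_add_le (y - x) (x - z)
    rw [sub_add_sub_cancel] at this
    linarith
  have hxz2 : x ∈ Metric.ball z r := by
    rw [Metric.mem_ball, dist_eq_norm]
    linarith [norm_nonneg (x - z)]
  rw [hΩ y hyz]
  have hx1 := (hΩ x hxz2).1 hx
  set π := (Submodule.span ℝ {e})ᗮ.orthogonalProjectionOnto
  -- The vertical shift is invisible to `π`, so the graph rises by at most `L θ s`, while the height
  -- gains at least `s / 2 - θ s`; `θ (1 + L) ≤ 1 / 4` decides.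
  have hπ : π y - π x = π (y - p) := by
    have h1 : y - p = (y - x) - (s / 2) • e := by simp only [p]; abel
    have h2 : π e = 0 := Submodule.orthogonalProjectionOnto_orthogonalComplement_singleton_eq_zero e
    rw [h1, map_sub, map_sub, map_smul, h2, smul_zero, sub_zero]
  have hdist : γ (π y) - γ (π x) ≤ L * (θ * s) := by
    have h1 := hγ.dist_le_mul (π y) (π x)
    have h2 : dist (π y) (π x) ≤ θ * s := by
      rw [dist_eq_norm, hπ]
      exact (Submodule.norm_orthogonalProjectionOnto_apply_le _ _).trans hyp.le
    have h3 := le_abs_self (γ (π y) - γ (π x))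
    rw [← Real.dist_eq] at h3
    exact h3.trans (h1.trans (by gcongr))
  have hinner : ⟪e, x⟫ + s / 2 - θ * s ≤ ⟪e, y⟫ := by
    have h1 : y = x + (s / 2) • e + (y - p) := by simp only [p]; abel
    have h2 : ⟪e, y⟫ = ⟪e, x⟫ + s / 2 + ⟪e, y - p⟫ := by
      conv_lhs => rw [h1]
      rw [inner_add_right, inner_add_right, inner_smul_right, real_inner_self_eq_norm_sq, he]
      ring
    have h3 := abs_real_inner_le_norm e (y - p)
    rw [he, one_mul] at h3
    have := neg_abs_le ⟪e, y - p⟫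
    linarith
  nlinarith

/-- A connected set that meets `Ω` and misses its frontier stays in `Ω`. -/
theorem ball_subset_of_disjoint_frontier (hΩ : IsOpen Ω) {x : Pt d} (hx : x ∈ Ω) {s : ℝ}
    (hs : 0 < s) (h : ∀ z ∈ frontier Ω, s ≤ dist x z) : Metric.ball x s ⊆ Ω := by
  have hpre : IsPreconnected (Metric.ball x s) := (convex_ball x s).isPreconnected
  refine hpre.subset_left_of_subset_union hΩ (isClosed_closure (s := Ω)).isOpen_compl ?_ ?_ ?_
  · exact Set.disjoint_left.2 fun y hy hy' => hy' (subset_closure hy)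
  · intro y hy
    by_cases hyΩ : y ∈ Ω
    · exact Or.inl hyΩ
    · refine Or.inr fun hyc => ?_
      have := h y (by rw [hΩ.frontier_eq]; exact ⟨hyc, hyΩ⟩)
      rw [Metric.mem_ball, dist_comm] at hy
      linarith
  · exact ⟨x, Metric.mem_ball_self hs, hx⟩

/-- The interior corkscrew condition for bounded Lipschitz domains. -/
theorem IsLipschitzDomain.exists_corkscrew (h : IsLipschitzDomain Ω) :
    ∃ θ : ℝ, 0 < θ ∧ θ ≤ 1 ∧ ∀ x ∈ Ω, ∀ s : ℝ, 0 < s → s ≤ 1 →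
      ∃ p : Pt d, Metric.ball p (θ * s) ⊆ Ω ∩ Metric.ball x s := by
  have hcomp : IsCompact (frontier Ω) :=
    (Metric.isCompact_of_isClosed_isBounded isClosed_frontier
      (h.isBounded.closure.subset frontier_subset_closure))
  have hloc : ∃ θ r : ℝ, 0 < θ ∧ θ ≤ 1 ∧ 0 < r ∧ r ≤ 1 ∧ ∀ x ∈ Ω, ∀ s : ℝ, 0 < s → s ≤ r →
      (∃ z ∈ frontier Ω, dist x z < s) →
      ∃ p : Pt d, Metric.ball p (θ * s) ⊆ Ω ∩ Metric.ball x s := by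
    -- Compactness of the frontier makes the constants of the local graphs uniform: the property
    -- passes to unions by taking minima.
    refine hcomp.induction_on (p := fun S => ∃ θ r : ℝ, 0 < θ ∧ θ ≤ 1 ∧ 0 < r ∧ r ≤ 1 ∧ ∀ x ∈ Ω,
      ∀ s : ℝ, 0 < s → s ≤ r → (∃ z ∈ S, dist x z < s) →
      ∃ p : Pt d, Metric.ball p (θ * s) ⊆ Ω ∩ Metric.ball x s) ?_ ?_ ?_ ?_
    · exact ⟨1, 1, one_pos, le_rfl, one_pos, le_rfl, by simp⟩
    · rintro S T hST ⟨θ, r, h1, h2, h3, h4, h5⟩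
      exact ⟨θ, r, h1, h2, h3, h4, fun x hx s hs hsr ⟨z, hz, hxz⟩ =>
        h5 x hx s hs hsr ⟨z, hST hz, hxz⟩⟩
    · rintro S T ⟨θ, r, h1, h2, h3, h4, h5⟩ ⟨θ', r', h1', h2', h3', h4', h5'⟩
      refine ⟨min θ θ', min r r', lt_min h1 h1', (min_le_left _ _).trans h2, lt_min h3 h3',
        (min_le_left _ _).trans h4, ?_⟩
      rintro x hx s hs hsr ⟨z, hz | hz, hxz⟩
      · obtain ⟨p, hp⟩ := h5 x hx s hs (hsr.trans (min_le_left _ _)) ⟨z, hz, hxz⟩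
        exact ⟨p, (Metric.ball_subset_ball (by gcongr; exact min_le_left _ _)).trans hp⟩
      · obtain ⟨p, hp⟩ := h5' x hx s hs (hsr.trans (min_le_right _ _)) ⟨z, hz, hxz⟩
        exact ⟨p, (Metric.ball_subset_ball (by gcongr; exact min_le_right _ _)).trans hp⟩
    · intro z hz
      obtain ⟨e, he, r, hr, L, γ, hγ, hgraph⟩ := h.lipschitz_boundary z hz
      have hL : (0 : ℝ) ≤ L := L.coe_nonneg
      refine ⟨Metric.ball z (r / 4), mem_nhdsWithin_of_mem_nhds (Metric.ball_mem_nhds z (by linarith)),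
        1 / (4 * (1 + L)), min 1 (r / 4), by positivity, ?_, by positivity, min_le_left _ _, ?_⟩
      · rw [div_le_one (by positivity)]; linarith
      rintro x hx s hs hsr ⟨z', hz', hxz'⟩
      have hsr4 : s ≤ r / 4 := hsr.trans (min_le_right _ _)
      refine ⟨_, exists_ball_subset_of_graph he hγ hgraph (by positivity) ?_ hs (by linarith) hx ?_⟩
      · rw [div_mul_eq_mul_div, one_mul, div_le_div_iff₀ (by positivity) (by positivity)]; linarith
      · rw [Metric.mem_ball] at hz' ⊢
        have := dist_triangle x z' z
        linarith
  obtain ⟨θ, r, hθ, hθ1, hr, hr1, hcork⟩ := hloc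
  refine ⟨θ * r, by positivity, by nlinarith, ?_⟩
  intro x hx s hs hs1
  -- Scales above the local one are cut down to `r`; since `s' ≥ r s`, the constant becomes `θ r`.
  -- Far from the frontier the ball about `x` itself serves.
  set s' := min s r
  have hs' : 0 < s' := lt_min hs hr
  have hrs : r * s ≤ s' := le_min (by nlinarith) (by nlinarith)
  have hball : Metric.ball x s' ⊆ Metric.ball x s := Metric.ball_subset_ball (min_le_left _ _)
  by_cases hz : ∃ z ∈ frontier Ω, dist x z < s'
  · obtain ⟨p, hp⟩ := hcork x hx s' hs' (min_le_right _ _) hz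
    refine ⟨p, (Metric.ball_subset_ball ?_).trans (hp.trans (Set.inter_subset_inter_right _ hball))⟩
    rw [mul_assoc]; gcongr
  · push Not at hz
    refine ⟨x, Set.subset_inter ?_ (Metric.ball_subset_ball ?_)⟩
    · refine (Metric.ball_subset_ball ?_).trans (ball_subset_of_disjoint_frontier h.isOpen hx hs' hz)
      nlinarith
    · nlinarith [mul_le_one₀ hθ1 hr.le hr1]

variable {μ : Measure (Pt d)} {a A : ℝ} {w : Pt d → Pt d → ℝ} {ε Λ κ δ : ℝ}

/-- The corkscrew ball has volume of order `ε ^ d` and sits where `w x` is at least `κ ε ^ (-d)`, so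
degrees stay bounded below even near the boundary. -/
theorem le_kernelDeg_of_ball_subset (h : IsComparable μ Ω a A) [IsProbabilityMeasure μ]
    (hw : IsScaledKernel w ε Λ κ δ) {x p : Pt d} {θ : ℝ} (hθ : 0 < θ)
    (hp : Metric.ball p (θ * (δ * ε)) ⊆ Ω ∩ Metric.ball x (δ * ε)) :
    κ * (a * ((θ * δ) ^ d * volume.real (Metric.ball (0 : Pt d) 1))) ≤ kernelDeg μ w x := by
  have hε := hw.eps_pos
  have hδ := hw.delta_pos
  have ha := h.pos
  set V := volume.real (Metric.ball (0 : Pt d) 1)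
  have hV : 0 < V := volume_real_ball_pos
  set B := Metric.ball p (θ * (δ * ε))
  have hvol : a * ((θ * (δ * ε)) ^ d * V) ≤ μ.real B := by
    rw [measureReal_def, ← ENNReal.ofReal_le_iff_le_toReal (measure_ne_top _ _),
      ENNReal.ofReal_mul ha.le, ← volume_ball_eq_ofReal (by positivity),
      ← Measure.addHaar_ball_center volume p]
    have := h.lower B
    rwa [Measure.smul_apply, smul_eq_mul, Measure.restrict_apply measurableSet_ball,
      Set.inter_eq_left.2 (fun y hy => (hp hy).1)] at this
  have h1 : κ * (ε ^ d)⁻¹ * μ.real B ≤ ∫ y in B, w x y ∂μ := by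
    have := setIntegral_mono_on (μ := μ) (s := B) (f := fun _ => κ * (ε ^ d)⁻¹) (g := w x)
      (integrable_const _).integrableOn (hw.integrable_left x).integrableOn measurableSet_ball ?_
    · rw [setIntegral_const, smul_eq_mul, mul_comm] at this
      exact this
    · intro y hy
      refine hw.ge x y ?_
      rw [dist_comm]
      exact (Metric.mem_ball.1 (hp hy).2).le
  have h2 : ∫ y in B, w x y ∂μ ≤ kernelDeg μ w x :=
    setIntegral_le_integral (hw.integrable_left x) (ae_of_all _ (hw.nonneg x))
  have hκ := hw.kappa_pos
  calc _ = κ * (ε ^ d)⁻¹ * (a * ((θ * (δ * ε)) ^ d * V)) := by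
        simp only [mul_pow]; field_simp
    _ ≤ κ * (ε ^ d)⁻¹ * μ.real B := by gcongr
    _ ≤ _ := h1.trans h2

theorem kernelDeg_le_of_isComparable (h : IsComparable μ Ω a A) [IsProbabilityMeasure μ]
    (hw : IsScaledKernel w ε Λ κ δ) (hA : 0 ≤ A) (hΛ : 0 ≤ Λ) (x : Pt d) :
    kernelDeg μ w x ≤ Λ * (A * volume.real (Metric.ball (0 : Pt d) 1)) := by
  have hε := hw.eps_pos
  set V := volume.real (Metric.ball (0 : Pt d) 1)
  have hV : 0 < V := volume_real_ball_pos
  set B := Metric.closedBall x ε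
  have hvol : μ.real B ≤ A * (ε ^ d * V) := by
    refine ENNReal.toReal_le_of_le_ofReal (by positivity) ?_
    rw [ENNReal.ofReal_mul hA, ← volume_closedBall_eq_ofReal hε.le, ← volume_closedBall_eq x]
    refine (h.upper B).trans ?_
    rw [Measure.smul_apply, smul_eq_mul]
    gcongr
    exact Measure.restrict_le_self
  have h1 : kernelDeg μ w x ≤ ∫ y, B.indicator (fun _ => Λ * (ε ^ d)⁻¹) y ∂μ := by
    refine integral_mono (hw.integrable_left x)
      ((integrable_const _).indicator Metric.isClosed_closedBall.measurableSet) fun y => ?_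
    by_cases hy : y ∈ B
    · rw [Set.indicator_of_mem hy]; exact hw.le x y
    · rw [Set.indicator_of_notMem hy, hw.range x y]
      rw [dist_comm]; simpa [B] using hy
  rw [integral_indicator_const _ Metric.isClosed_closedBall.measurableSet, smul_eq_mul] at h1
  calc _ ≤ μ.real B * (Λ * (ε ^ d)⁻¹) := h1
    _ ≤ A * (ε ^ d * V) * (Λ * (ε ^ d)⁻¹) := by gcongr
    _ = _ := by field_simp

end Domain

/-! ### The profile `η` yields a kernel at scale `ε`. -/

section Profile

variable {d : ℕ} {η : ℝ → ℝ}

theorem IsKernelProfile.measurable_etaAt (hη : IsKernelProfile d η) {ε : ℝ} (hε : 0 < ε) :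
    Measurable (Function.uncurry (etaAt (d := d) η ε)) := by
  -- Nothing is known about `η` on the negative axis; freezing it there gives a globally monotone,
  -- hence measurable, function.
  have h1 : Measurable fun t : ℝ => η (max t 0) := by
    refine Antitone.measurable fun s t hst => ?_
    exact hη.antitone (Set.mem_Ici.2 (le_max_right _ _)) (Set.mem_Ici.2 (le_max_right _ _)) (max_le_max_right 0 hst)
  have h2 : (Function.uncurry (etaAt (d := d) η ε)) = fun p : Pt d × Pt d =>
      (ε ^ d)⁻¹ * (fun t : ℝ => η (max t 0)) (‖p.1 - p.2‖ / ε) := by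
    ext ⟨x, y⟩
    simp only [Function.uncurry, etaAt, etaScaled]
    rw [max_eq_left (by positivity)]
  rw [h2]
  exact (h1.comp (by fun_prop)).const_mul _

theorem IsKernelProfile.exists_half (hη : IsKernelProfile d η) :
    ∃ δ : ℝ, 0 < δ ∧ δ ≤ 1 ∧ ∀ t, 0 ≤ t → t ≤ δ → η 0 / 2 ≤ η t := by
  have h0 := hη.pos_zero
  have := hη.continuousAt_zero.eventually (lt_mem_nhds (half_lt_self h0))
  rw [eventually_nhdsWithin_iff, Metric.eventually_nhds_iff] at this
  obtain ⟨r, hr, h⟩ := this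
  refine ⟨min (r / 2) 1, by positivity, min_le_right _ _, fun t ht ht' => (h ?_ ht).le⟩
  rw [Real.dist_eq, sub_zero, abs_of_nonneg ht]
  linarith [min_le_left (r / 2) 1]

theorem IsKernelProfile.isScaledKernel (hη : IsKernelProfile d η) {δ : ℝ} (hδ : 0 < δ)
    (hδ1 : δ ≤ 1) (h : ∀ t, 0 ≤ t → t ≤ δ → η 0 / 2 ≤ η t) {ε : ℝ} (hε : 0 < ε) :
    IsScaledKernel (d := d) (etaAt η ε) ε (η 0) (η 0 / 2) δ where
  meas := hη.measurable_etaAt hε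
  symm x y := by simp only [etaAt, norm_sub_rev]
  nonneg x y := mul_nonneg (by positivity) (hη.nonneg _ (by positivity))
  bdd := ⟨(ε ^ d)⁻¹ * η 0, fun x y => by
    have := hη.antitone (Set.mem_Ici.2 le_rfl) (Set.mem_Ici.2 (by positivity)) (by positivity : 0 ≤ ‖x - y‖ / ε)
    simp only [etaAt, etaScaled]
    gcongr⟩
  eps_pos := hε
  kappa_pos := half_pos hη.pos_zero
  delta_pos := hδ
  delta_le := hδ1
  range x y hxy := by
    simp only [etaAt, etaScaled]
    rw [hη.support _ (by rwa [one_lt_div hε, ← dist_eq_norm]), mul_zero]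
  le x y := by
    have := hη.antitone (Set.mem_Ici.2 le_rfl) (Set.mem_Ici.2 (by positivity)) (by positivity : 0 ≤ ‖x - y‖ / ε)
    simp only [etaAt, etaScaled]
    rw [mul_comm]
    gcongr
  ge x y hxy := by
    simp only [etaAt, etaScaled]
    rw [mul_comm]
    gcongr
    exact h _ (by positivity) (by rwa [div_le_iff₀ hε, ← dist_eq_norm])

end Profile

/-! ### The sampling law. -/

section Density

variable {d : ℕ} {Ω : Set (Pt d)} {ρ : Pt d → ℝ} {ρmin ρmax : ℝ}

theorem densityLaw_isComparable (hΩ : MeasurableSet Ω) (hρmin : 0 < ρmin)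
    (hρ : IsDensityBetween Ω ρmin ρmax ρ) :
    IsComparable (densityLaw Ω ρ) Ω ρmin ρmax where
  measurableSet := hΩ
  pos := hρmin
  lower := by
    rw [← withDensity_const]
    exact withDensity_mono ((ae_restrict_mem hΩ).mono fun x hx =>
      ENNReal.ofReal_le_ofReal (hρ.lower x hx))
  upper := by
    rw [← withDensity_const]
    exact withDensity_mono ((ae_restrict_mem hΩ).mono fun x hx =>
      ENNReal.ofReal_le_ofReal (hρ.upper x hx))

theorem integral_densityLaw (hΩ : MeasurableSet Ω) (hρmin : 0 < ρmin)
    (hρ : IsDensityBetween Ω ρmin ρmax ρ) (hm : AEMeasurable ρ (volume.restrict Ω)) (f : Pt d → ℝ) :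
    ∫ y, f y ∂densityLaw Ω ρ = ∫ y in Ω, ρ y * f y := by
  rw [densityLaw, integral_withDensity_eq_integral_toReal_smul₀ hm.ennreal_ofReal
    (ae_of_all _ fun _ => ENNReal.ofReal_lt_top)]
  refine setIntegral_congr_fun hΩ fun y hy => ?_
  simp only [smul_eq_mul]
  rw [ENNReal.toReal_ofReal (hρmin.le.trans (hρ.lower y hy))]

end Density

/-! ### Bernstein inequalities for independent samples. -/

section Concentration

variable {S : Type*} [MeasurableSpace S] {P : Measure S} [IsProbabilityMeasure P]
  {E : Type*} [MeasurableSpace E] {μ : Measure E} [IsProbabilityMeasure μ]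

theorem integrable_of_ae_abs_le {f : E → ℝ} (hf : Measurable f) {C : ℝ}
    (hC : ∀ᵐ x ∂μ, |f x| ≤ C) : Integrable f μ :=
  Integrable.of_bound hf.aestronglyMeasurable C hC

/-- Integrate `exp u ≤ 1 + u + u ^ 2`, valid for `|u| ≤ 1`; the linear term has mean zero. -/
theorem integral_exp_le_of_abs_le {g : E → ℝ} (hg : Measurable g) {B V s : ℝ}
    (hB : ∀ᵐ y ∂μ, |g y| ≤ B) (h0 : ∫ y, g y ∂μ = 0) (hV : ∫ y, g y ^ 2 ∂μ ≤ V) (hs : 0 ≤ s)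
    (hsB : s * B ≤ 1) : ∫ y, Real.exp (s * g y) ∂μ ≤ Real.exp (s ^ 2 * V) := by
  have i1 : Integrable g μ := integrable_of_ae_abs_le hg hB
  have i2 : Integrable (fun y => g y ^ 2) μ :=
    integrable_of_ae_abs_le (hg.pow_const 2) (C := B ^ 2) (hB.mono fun y hy => by
      rw [abs_pow]; gcongr)
  have hsg : ∀ᵐ y ∂μ, |s * g y| ≤ 1 := hB.mono fun y hy => by
    rw [abs_mul, abs_of_nonneg hs]
    exact (mul_le_mul_of_nonneg_left hy hs).trans hsB
  calc ∫ y, Real.exp (s * g y) ∂μ ≤ ∫ y, (1 + s * g y + s ^ 2 * g y ^ 2) ∂μ := by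
        refine integral_mono_ae ?_ ?_ ?_
        · refine integrable_of_ae_abs_le (hg.const_mul s).exp (C := Real.exp 1) (hsg.mono fun y hy => ?_)
          rw [abs_of_pos (Real.exp_pos _)]
          exact Real.exp_le_exp.2 ((le_abs_self _).trans hy)
        · exact ((integrable_const _).add (i1.const_mul s)).add (i2.const_mul _)
        · refine hsg.mono fun y hy => ?_
          have := (abs_le.1 (Real.abs_exp_sub_one_sub_id_le hy)).2
          simp only
          nlinarith
    _ = 1 + s ^ 2 * ∫ y, g y ^ 2 ∂μ := by
        have i3 : Integrable (fun y => 1 + s * g y) μ := (integrable_const _).add (i1.const_mul s)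
        rw [integral_add i3 (i2.const_mul _), integral_add (integrable_const _) (i1.const_mul s),
          integral_const_mul, integral_const_mul, h0]
        simp
    _ ≤ s ^ 2 * V + 1 := by
        have := mul_le_mul_of_nonneg_left hV (sq_nonneg s)
        linarith
    _ ≤ _ := Real.add_one_le_exp _

/-- **Bernstein's inequality** (upper tail, before optimising the exponent). -/
theorem measureReal_sum_ge_le {ι : Type*} {X : ι → S → E} (hX : ∀ i, Measurable (X i))
    (hind : iIndepFun X P) (hlaw : ∀ i, P.map (X i) = μ) (J : Finset ι) {g : E → ℝ}
    (hg : Measurable g) {B V s : ℝ} (hB : ∀ᵐ y ∂μ, |g y| ≤ B) (h0 : ∫ y, g y ∂μ = 0)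
    (hV : ∫ y, g y ^ 2 ∂μ ≤ V) (hs : 0 ≤ s) (hsB : s * B ≤ 1) (t : ℝ) :
    P.real {ω | t ≤ ∑ j ∈ J, g (X j ω)} ≤ Real.exp (-s * t + s ^ 2 * V * J.card) := by
  have hind' : iIndepFun (fun i => g ∘ X i) P := hind.comp (fun _ => g) fun _ => hg
  have hm : ∀ i, Measurable (g ∘ X i) := fun i => hg.comp (hX i)
  have hsum : (fun ω => ∑ j ∈ J, g (X j ω)) = ∑ j ∈ J, g ∘ X j := by
    ext ω; simp
  have hbd : ∀ᵐ ω ∂P, ∀ j ∈ J, |g (X j ω)| ≤ B := by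
    rw [Filter.eventually_all_finset]
    intro j _
    have : ∀ᵐ y ∂(P.map (X j)), |g y| ≤ B := by rw [hlaw j]; exact hB
    exact ae_of_ae_map (hX j).aemeasurable this
  have hint : Integrable (fun ω => Real.exp (s * (∑ j ∈ J, g ∘ X j) ω)) P := by
    refine integrable_of_ae_abs_le ?_ (C := Real.exp (s * (J.card * B))) (hbd.mono fun ω hω => ?_)
    · rw [← hsum]
      exact ((Finset.measurable_sum J fun j _ => hm j).const_mul s).exp
    · rw [abs_of_pos (Real.exp_pos _)]
      apply Real.exp_le_exp.2
      refine mul_le_mul_of_nonneg_left ?_ hs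
      rw [← hsum]
      have := Finset.sum_le_card_nsmul J (fun j => g (X j ω)) B
        fun j hj => (le_abs_self _).trans (hω j hj)
      simpa using this
  have h1 := measure_ge_le_exp_mul_mgf (X := ∑ j ∈ J, g ∘ X j) (μ := P) t hs hint
  rw [hind'.mgf_sum hm J] at h1
  have h2 : ∏ i ∈ J, mgf (g ∘ X i) P s ≤ Real.exp (s ^ 2 * V * J.card) := by
    have : ∀ i ∈ J, mgf (g ∘ X i) P s ≤ Real.exp (s ^ 2 * V) := by
      intro i _
      have e1 : mgf (g ∘ X i) P s = ∫ y, Real.exp (s * g y) ∂μ := by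
        rw [← hlaw i, mgf, integral_map (hX i).aemeasurable]
        · rfl
        · exact (hg.const_mul s).exp.aestronglyMeasurable
      rw [e1]
      exact integral_exp_le_of_abs_le hg hB h0 hV hs hsB
    calc _ ≤ ∏ _i ∈ J, Real.exp (s ^ 2 * V) := Finset.prod_le_prod (fun i _ => mgf_nonneg) this
      _ = _ := by rw [Finset.prod_const, ← Real.exp_nat_mul]; ring_nf
  rw [Real.exp_add]
  rw [← hsum] at h1
  exact h1.trans (by gcongr)

/-- Two-sided deviations of a sum of independent variables from its mean. -/
theorem measureReal_abs_sum_sub_ge_le {ι : Type*} {X : ι → S → E} (hX : ∀ i, Measurable (X i))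
    (hind : iIndepFun X P) (hlaw : ∀ i, P.map (X i) = μ) (J : Finset ι) {g : E → ℝ}
    (hg : Measurable g) {B V s : ℝ} (hB : ∀ᵐ y ∂μ, |g y| ≤ B) (hV : ∫ y, g y ^ 2 ∂μ ≤ V)
    (hs : 0 ≤ s) (hsB : s * (2 * B) ≤ 1) (t : ℝ) :
    P.real {ω | t ≤ |∑ j ∈ J, (g (X j ω) - ∫ y, g y ∂μ)|}
      ≤ 2 * Real.exp (-s * t + s ^ 2 * V * J.card) := by
  set e := ∫ y, g y ∂μ
  have i1 : Integrable g μ := integrable_of_ae_abs_le hg hB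
  have i2 : Integrable (fun y => g y ^ 2) μ :=
    integrable_of_ae_abs_le (hg.pow_const 2) (C := B ^ 2) (hB.mono fun y hy => by
      rw [abs_pow]; gcongr)
  have he : |e| ≤ B := by
    have := norm_integral_le_of_norm_le_const (μ := μ) (f := g) (C := B) hB
    simpa using this
  have hgm : Measurable fun y => g y - e := hg.sub_const e
  have hB' : ∀ᵐ y ∂μ, |g y - e| ≤ 2 * B := hB.mono fun y hy => by
    have := abs_sub (g y) e
    linarith
  have h0 : ∫ y, (g y - e) ∂μ = 0 := by
    rw [integral_sub i1 (integrable_const _)]; simp [e]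
  have hV' : ∫ y, (g y - e) ^ 2 ∂μ ≤ V := by
    have e1 : ∀ y, (g y - e) ^ 2 = g y ^ 2 - (2 * e) * g y + e ^ 2 := fun y => by ring
    have i3 : Integrable (fun y => g y ^ 2 - (2 * e) * g y) μ := i2.sub (i1.const_mul _)
    simp only [e1]
    rw [integral_add i3 (integrable_const _), integral_sub i2 (i1.const_mul _), integral_const_mul]
    simp only [integral_const, probReal_univ, one_smul]
    nlinarith [sq_nonneg e]
  have h1 := measureReal_sum_ge_le hX hind hlaw J hgm hB' h0 hV' hs hsB t
  have h2 := measureReal_sum_ge_le hX hind hlaw J (g := fun y => -(g y - e)) hgm.neg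
    (by simpa only [abs_neg] using hB') (by rw [integral_neg, h0, neg_zero])
    (by simpa only [neg_sq] using hV') hs hsB t
  have hsub : {ω | t ≤ |∑ j ∈ J, (g (X j ω) - e)|} ⊆
      {ω | t ≤ ∑ j ∈ J, (g (X j ω) - e)} ∪ {ω | t ≤ ∑ j ∈ J, -(g (X j ω) - e)} := by
    intro ω hω
    have hω' : t ≤ |∑ j ∈ J, (g (X j ω) - e)| := hω
    rw [le_abs] at hω'
    rcases hω' with h | h
    · exact Or.inl h
    · refine Or.inr ?_
      change t ≤ ∑ j ∈ J, -(g (X j ω) - e)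
      rwa [Finset.sum_neg_distrib]
  calc _ ≤ _ := measureReal_mono hsub
    _ ≤ _ := measureReal_union_le _ _
    _ ≤ _ := by rw [two_mul]; exact add_le_add h1 h2

/-- Conditional version: the summand may depend on the sample points with index in `T`, provided
these indices are left out of the sum. -/
theorem measureReal_abs_sum_sub_ge_le_of_dependent {ι : Type*} [Fintype ι] [DecidableEq ι]
    {X : ι → S → E} (hX : ∀ i, Measurable (X i)) (hind : iIndepFun X P)
    (hlaw : ∀ i, P.map (X i) = μ) (T : Finset ι) {F : Type*} [MeasurableSpace F]
    {ψ : (T → E) → F} (hψ : Measurable ψ) {G : F → E → ℝ} (hG : Measurable (Function.uncurry G))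
    {F₀ : Set F} (hF₀ : MeasurableSet F₀) {B V s : ℝ}
    (hB : ∀ z ∈ F₀, ∀ᵐ y ∂μ, |G z y| ≤ B) (hV : ∀ z ∈ F₀, ∫ y, G z y ^ 2 ∂μ ≤ V)
    (hs : 0 ≤ s) (hsB : s * (2 * B) ≤ 1) (t : ℝ) :
    P.real {ω | ψ (fun i => X i ω) ∈ F₀ ∧ t ≤ |∑ j ∈ Tᶜ, (G (ψ fun i => X i ω) (X j ω)
        - ∫ y, G (ψ fun i => X i ω) y ∂μ)|}
      ≤ 2 * Real.exp (-s * t + s ^ 2 * V * (Tᶜ : Finset ι).card) := by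
  set Z : S → F := fun ω => ψ fun i : T => X i ω
  set Y : S → ((Tᶜ : Finset ι) → E) := fun ω i => X i ω
  have hZ : Measurable Z := hψ.comp (measurable_pi_lambda _ fun i => hX i)
  have hY : Measurable Y := measurable_pi_lambda _ fun i => hX i
  have hindep : IndepFun Z Y P := by
    have := hind.indepFun_finset T Tᶜ disjoint_compl_right hX
    exact this.comp hψ measurable_id
  have hmap := (indepFun_iff_map_prod_eq_prod_map_map hZ.aemeasurable hY.aemeasurable).1 hindep
  set Bad : Set (F × ((Tᶜ : Finset ι) → E)) := {p | p.1 ∈ F₀ ∧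
    t ≤ |∑ j : (Tᶜ : Finset ι), (G p.1 (p.2 j) - ∫ y, G p.1 y ∂μ)|}
  have hmean : Measurable fun z => ∫ y, G z y ∂μ :=
    (StronglyMeasurable.integral_prod_right hG.stronglyMeasurable).measurable
  have hBad : MeasurableSet Bad := by
    suffices h2 : Measurable fun p : F × ((Tᶜ : Finset ι) → E) =>
        |∑ j : (Tᶜ : Finset ι), (G p.1 (p.2 j) - ∫ y, G p.1 y ∂μ)| from
      (measurable_fst hF₀).inter (measurableSet_le measurable_const h2)
    refine _root_.continuous_abs.measurable.comp (Finset.measurable_sum _ fun j _ => ?_)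
    refine Measurable.sub ?_ (hmean.comp measurable_fst)
    exact hG.comp (measurable_fst.prodMk ((measurable_pi_apply j).comp measurable_snd))
  have hset : {ω | ψ (fun i => X i ω) ∈ F₀ ∧ t ≤ |∑ j ∈ Tᶜ, (G (ψ fun i => X i ω) (X j ω)
        - ∫ y, G (ψ fun i => X i ω) y ∂μ)|} = (fun ω => (Z ω, Y ω)) ⁻¹' Bad := by
    ext ω
    simp only [Bad, Set.mem_preimage, Set.mem_ofPred_eq, Z, Y]
    rw [Finset.sum_coe_sort (Tᶜ) fun j => G (ψ fun i => X i ω) (X j ω)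
        - ∫ y, G (ψ fun i => X i ω) y ∂μ]
  rw [hset, measureReal_def]
  refine ENNReal.toReal_le_of_le_ofReal (by positivity) ?_
  -- By independence the joint law is a product, so the parameter `z` can be frozen and the
  -- unconditional bound applied to the remaining points.
  rw [← Measure.map_apply (hZ.prodMk hY) hBad, hmap, Measure.prod_apply hBad]
  have : IsProbabilityMeasure (P.map Z) := Measure.isProbabilityMeasure_map hZ.aemeasurable
  calc ∫⁻ z, (P.map Y) (Prod.mk z ⁻¹' Bad) ∂(P.map Z)
      ≤ ∫⁻ _, ENNReal.ofReal (2 * Real.exp (-s * t + s ^ 2 * V * (Tᶜ : Finset ι).card)) ∂(P.map Z) := by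
        refine lintegral_mono fun z => ?_
        rw [Measure.map_apply hY (measurable_prodMk_left hBad)]
        by_cases hz : z ∈ F₀
        · have h1 := measureReal_abs_sum_sub_ge_le hX hind hlaw Tᶜ
            (hG.comp measurable_prodMk_left : Measurable (G z)) (hB z hz) (hV z hz) hs hsB t
          rw [measureReal_def] at h1
          rw [ENNReal.le_ofReal_iff_toReal_le (measure_ne_top _ _) (by positivity)]
          refine le_trans (le_of_eq ?_) h1
          congr 2
          ext ω
          simp only [Bad, Set.mem_preimage, Set.mem_ofPred_eq, hz, true_and, Y]
          rw [Finset.sum_coe_sort (Tᶜ) fun j => G z (X j ω) - ∫ y, G z y ∂μ]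
          rfl
        · have : Y ⁻¹' (Prod.mk z ⁻¹' Bad) = ∅ := by
            ext ω; simp [Bad, hz]
          rw [this]; simp
    _ = _ := by simp

/-- The deviation bound at the scales of the random geometric graph: kernels of size `B / e` with
second moment `V / e`, deviations of relative size `τ lam`. -/
theorem measureReal_deviation_le {ι : Type*} [Fintype ι] [DecidableEq ι]
    {X : ι → S → E} (hX : ∀ i, Measurable (X i)) (hind : iIndepFun X P)
    (hlaw : ∀ i, P.map (X i) = μ) (T : Finset ι) {F : Type*} [MeasurableSpace F]
    {ψ : (T → E) → F} (hψ : Measurable ψ) {G : F → E → ℝ} (hG : Measurable (Function.uncurry G))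
    {F₀ : Set F} (hF₀ : MeasurableSet F₀) {B V τ e lam : ℝ} (hB0 : 0 < B) (hV0 : 0 < V) (hτ : 0 < τ)
    (he : 0 < e) (hlam : 0 < lam) (hlam1 : lam ≤ 1)
    (hB : ∀ z ∈ F₀, ∀ᵐ y ∂μ, |G z y| ≤ B * e⁻¹) (hV : ∀ z ∈ F₀, ∫ y, G z y ^ 2 ∂μ ≤ V * e⁻¹) :
    P.real {ω | ψ (fun i => X i ω) ∈ F₀ ∧ Fintype.card ι * (τ * lam) ≤
        |∑ j ∈ Tᶜ, (G (ψ fun i => X i ω) (X j ω) - ∫ y, G (ψ fun i => X i ω) y ∂μ)|}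
      ≤ 2 * Real.exp (-(min (1 / (2 * B)) (τ / (2 * V)) * (τ / 2) * Fintype.card ι * e * lam ^ 2)) := by
  -- With exponent `s = θ lam e`, the first entry ensures `s * (2 B / e) ≤ 1`, and the second makes
  -- the variance term at most half of the linear one.
  set θ := min (1 / (2 * B)) (τ / (2 * V))
  have hθ : 0 < θ := lt_min (by positivity) (by positivity)
  have hθ1 : θ * (2 * B) ≤ 1 := by
    have := min_le_left (1 / (2 * B)) (τ / (2 * V))
    rwa [le_div_iff₀ (by positivity)] at this
  have hθ2 : θ * (2 * V) ≤ τ := by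
    have := min_le_right (1 / (2 * B)) (τ / (2 * V))
    rwa [le_div_iff₀ (by positivity)] at this
  have h1 := measureReal_abs_sum_sub_ge_le_of_dependent hX hind hlaw T hψ hG hF₀ hB hV
    (s := θ * lam * e) (by positivity) (by
      have : θ * lam * e * (2 * (B * e⁻¹)) = lam * (θ * (2 * B)) := by field_simp
      rw [this]
      nlinarith [mul_pos hθ hB0]) (Fintype.card ι * (τ * lam))
  refine h1.trans ?_
  gcongr
  have hcard : ((Tᶜ : Finset ι).card : ℝ) ≤ Fintype.card ι := by
    exact_mod_cast Finset.card_le_univ _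
  have e1 : (θ * lam * e) ^ 2 * (V * e⁻¹) = θ * e * lam ^ 2 * (θ * V) := by field_simp
  rw [e1]
  have h2 : θ * e * lam ^ 2 * (θ * V) * ((Tᶜ : Finset ι).card : ℝ)
      ≤ θ * e * lam ^ 2 * (τ / 2) * Fintype.card ι := by
    gcongr
    linarith
  nlinarith

end Concentration

/-! ### Comparison principle and Duhamel expansion for the adjoint walk. -/

section AdjointWalk

variable {E : Type*} [MeasurableSpace E] {ν : Measure E} [IsFiniteMeasure ν] {w : E → E → ℝ}

namespace IsSymmKernel

omit [IsFiniteMeasure ν] in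
theorem exists_abs_inv_deg_mul_le {c : ℝ} (hc : 0 < c)
    (hae : ∀ᵐ y ∂ν, c ≤ kernelDeg ν w y) (hw : IsSymmKernel w) (f : boundedMeasurable E) :
    ∃ C, 0 ≤ C ∧ ∀ z, ∀ᵐ y ∂ν, |w z y * (kernelDeg ν w y)⁻¹ * (f : E → ℝ) y| ≤ C := by
  obtain ⟨C, hC0, hC⟩ := exists_abs_le_coe f
  obtain ⟨B, hB0, hB⟩ := hw.exists_bound
  refine ⟨B * c⁻¹ * C, by positivity, fun z => hae.mono fun y hy => ?_⟩
  rw [abs_mul, abs_mul, abs_inv, abs_of_pos (hc.trans_le hy)]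
  exact mul_le_mul (mul_le_mul (hB z y) (inv_anti₀ hc hy)
    (inv_nonneg.2 (hc.le.trans hy)) hB0) (hC y) (abs_nonneg _) (by positivity)

theorem measurable_adjWalk_integrand (hw : IsSymmKernel w) (f : boundedMeasurable E) (z : E) :
    Measurable fun y => w z y * (kernelDeg ν w y)⁻¹ * (f : E → ℝ) y :=
  ((hw.meas_left z).mul hw.measurable_deg.inv).mul (measurable_coe f)

theorem integrable_adjWalk {c : ℝ} (hc : 0 < c) (hae : ∀ᵐ y ∂ν, c ≤ kernelDeg ν w y)
    (hw : IsSymmKernel w) (f : boundedMeasurable E) (z : E) :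
    Integrable (fun y => w z y * (kernelDeg ν w y)⁻¹ * (f : E → ℝ) y) ν := by
  obtain ⟨C, _, hC⟩ := hw.exists_abs_inv_deg_mul_le hc hae f
  exact Integrable.of_bound (hw.measurable_adjWalk_integrand f z).aestronglyMeasurable C (hC z)

/-- The adjoint of the transition operator on bounded functions. -/
def adjWalkB (hw : IsSymmKernel w) (ν : Measure E) [IsFiniteMeasure ν] {c : ℝ} (hc : 0 < c)
    (hae : ∀ᵐ y ∂ν, c ≤ kernelDeg ν w y) : Module.End ℝ (boundedMeasurable E) where
  toFun f := ⟨adjWalk ν w f, by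
      have := hw.measurable_integral_mul (ν := ν)
        (f := fun y => (kernelDeg ν w y)⁻¹ * (f : E → ℝ) y)
        (hw.measurable_deg.inv.mul (measurable_coe f))
      have e : adjWalk ν w (f : E → ℝ)
          = fun z => ∫ y, w z y * ((kernelDeg ν w y)⁻¹ * (f : E → ℝ) y) ∂ν := by
        ext z; simp only [adjWalk, mul_assoc]
      rwa [e], by
      obtain ⟨C, _, hC⟩ := hw.exists_abs_inv_deg_mul_le hc hae f
      exact ⟨C * ν.real Set.univ, fun z => by
        have := norm_integral_le_of_norm_le_const (μ := ν)
          (f := fun y => w z y * (kernelDeg ν w y)⁻¹ * (f : E → ℝ) y) (hC z)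
        exact this⟩⟩
  map_add' f g := by
    ext z
    simp only [adjWalk, Submodule.coe_add, Pi.add_apply, mul_add]
    exact integral_add (hw.integrable_adjWalk hc hae f z) (hw.integrable_adjWalk hc hae g z)
  map_smul' r f := by
    ext z
    simp only [adjWalk, Submodule.coe_smul, Pi.smul_apply, smul_eq_mul, RingHom.id_apply]
    rw [← integral_const_mul]
    congr 1; ext y; ring

variable {c : ℝ} {hc : 0 < c} {hae : ∀ᵐ y ∂ν, c ≤ kernelDeg ν w y}

theorem adjWalkB_apply (hw : IsSymmKernel w) (f : boundedMeasurable E) (z : E) :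
    (hw.adjWalkB ν hc hae f : E → ℝ) z = adjWalk ν w f z := rfl

theorem coe_adjWalkB_pow (hw : IsSymmKernel w) (f : boundedMeasurable E) (k : ℕ) :
    ((hw.adjWalkB ν hc hae ^ k) f : E → ℝ) = (adjWalk ν w)^[k] f := by
  induction k with
  | zero => rfl
  | succ k ih =>
    rw [Function.iterate_succ_apply', ← ih, pow_succ', Module.End.mul_apply]; rfl

theorem abs_adjWalkB_le (hw : IsSymmKernel w) {f g : boundedMeasurable E}
    (h : ∀ᵐ y ∂ν, |(f : E → ℝ) y| ≤ (g : E → ℝ) y) (z : E) :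
    |(hw.adjWalkB ν hc hae f : E → ℝ) z| ≤ (hw.adjWalkB ν hc hae g : E → ℝ) z := by
  rw [adjWalkB_apply, adjWalkB_apply, adjWalk, adjWalk]
  refine abs_integral_le_integral_abs.trans (integral_mono_ae
    (hw.integrable_adjWalk hc hae f z).abs (hw.integrable_adjWalk hc hae g z)
    (h.mono fun y hy => ?_))
  simp only
  rw [abs_mul, abs_mul, abs_inv, abs_of_nonneg (hw.nonneg z y), abs_of_nonneg (hw.deg_nonneg y)]
  exact mul_le_mul_of_nonneg_left hy (mul_nonneg (hw.nonneg z y) (inv_nonneg.2 (hw.deg_nonneg y)))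

/-- The degree is the density of the stationary measure; its multiples are the barriers in
`abs_le_sum_mul_deg`. -/
theorem adjWalkB_degB (hw : IsSymmKernel w) : hw.adjWalkB ν hc hae (hw.degB ν) = hw.degB ν := by
  ext z
  rw [adjWalkB_apply, adjWalk]
  refine integral_congr_ae (hae.mono fun y hy => ?_)
  have : kernelDeg ν w y ≠ 0 := (hc.trans_le hy).ne'
  change w z y * (kernelDeg ν w y)⁻¹ * kernelDeg ν w y = w z y
  field_simp

/-- Comparison principle: an inhomogeneous adjoint walk stays below a supersolution. -/
theorem abs_le_of_supersolution (hw : IsSymmKernel w) {N : Set E} (hN : ∀ᵐ y ∂ν, y ∈ N)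
    {D F β : ℕ → boundedMeasurable E} {K : ℕ}
    (h0 : ∀ z ∈ N, |(D 0 : E → ℝ) z| ≤ (F 0 : E → ℝ) z)
    (hD : ∀ k < K, ∀ z ∈ N, |(D (k + 1) : E → ℝ) z - (hw.adjWalkB ν hc hae (D k) : E → ℝ) z|
      ≤ (β k : E → ℝ) z)
    (hF : ∀ k < K, ∀ z ∈ N, (hw.adjWalkB ν hc hae (F k) : E → ℝ) z + (β k : E → ℝ) z
      ≤ (F (k + 1) : E → ℝ) z) :
    ∀ k ≤ K, ∀ z ∈ N, |(D k : E → ℝ) z| ≤ (F k : E → ℝ) z := by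
  intro k
  induction k with
  | zero => exact fun _ => h0
  | succ k ih =>
    intro hk z hz
    have h1 := hw.abs_adjWalkB_le (hc := hc) (hae := hae)
      (hN.mono fun y hy => ih (by omega) y hy) z
    have h2 := hD k (by omega) z hz
    have h3 := hF k (by omega) z hz
    have h4 := abs_sub_abs_le_abs_sub ((D (k + 1) : E → ℝ) z)
      ((hw.adjWalkB ν hc hae (D k) : E → ℝ) z)
    linarith

/-- Since the degree is invariant, sources measured in multiples of it simply add up, with no loss
over time. -/
theorem abs_le_sum_mul_deg (hw : IsSymmKernel w) {N : Set E} (hN : ∀ᵐ y ∂ν, y ∈ N)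
    {D β : ℕ → boundedMeasurable E} {K : ℕ} (h0 : ∀ z ∈ N, (D 0 : E → ℝ) z = 0)
    (hD : ∀ k < K, ∀ z ∈ N, |(D (k + 1) : E → ℝ) z - (hw.adjWalkB ν hc hae (D k) : E → ℝ) z|
      ≤ (β k : E → ℝ) z) {s : ℕ → ℝ}
    (hβ : ∀ k < K, ∀ z ∈ N, (β k : E → ℝ) z ≤ s k * kernelDeg ν w z) :
    ∀ k ≤ K, ∀ z ∈ N, |(D k : E → ℝ) z| ≤ (∑ j ∈ Finset.range k, s j) * kernelDeg ν w z := by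
  refine hw.abs_le_of_supersolution hN (hc := hc) (hae := hae)
    (F := fun k => (∑ j ∈ Finset.range k, s j) • hw.degB ν) (β := β) ?_ hD ?_
  · intro z hz
    rw [h0 z hz]; simp
  · intro k hk z hz
    have := hβ k hk z hz
    simp only [map_smul, adjWalkB_degB, Finset.sum_range_succ, add_smul]
    change (∑ j ∈ Finset.range k, s j) * kernelDeg ν w z + (β k : E → ℝ) z
      ≤ (∑ j ∈ Finset.range k, s j) * kernelDeg ν w z + s k * kernelDeg ν w z
    linarith

/-- Duhamel's formula: the source created at step `j` is transported for the remaining `k - 1 - j`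
steps. It keeps the spatial decay that the supremum bound loses. -/
theorem abs_le_sum_iterate (hw : IsSymmKernel w) {N : Set E} (hN : ∀ᵐ y ∂ν, y ∈ N)
    {D β : ℕ → boundedMeasurable E} {K : ℕ} (h0 : ∀ z ∈ N, (D 0 : E → ℝ) z = 0)
    (hD : ∀ k < K, ∀ z ∈ N, |(D (k + 1) : E → ℝ) z - (hw.adjWalkB ν hc hae (D k) : E → ℝ) z|
      ≤ (β k : E → ℝ) z) :
    ∀ k ≤ K, ∀ z ∈ N, |(D k : E → ℝ) z|
      ≤ ∑ j ∈ Finset.range k, (adjWalk ν w)^[k - 1 - j] (β j) z := by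
  have := hw.abs_le_of_supersolution hN (hc := hc) (hae := hae)
    (F := fun k => ∑ j ∈ Finset.range k, (hw.adjWalkB ν hc hae ^ (k - 1 - j)) (β j)) (β := β)
    (fun z hz => by rw [h0 z hz]; simp) hD ?_
  · intro k hk z hz
    refine (this k hk z hz).trans_eq ?_
    rw [Submodule.coe_sum, Finset.sum_apply]
    simp only [coe_adjWalkB_pow]
  · intro k hk z hz
    refine le_of_eq ?_
    rw [Finset.sum_range_succ, map_sum, ← Pi.add_apply, ← Submodule.coe_add]
    have e : ∀ j ∈ Finset.range k, hw.adjWalkB ν hc hae ((hw.adjWalkB ν hc hae ^ (k - 1 - j)) (β j))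
        = (hw.adjWalkB ν hc hae ^ (k + 1 - 1 - j)) (β j) := by
      intro j hj
      have : k + 1 - 1 - j = (k - 1 - j) + 1 := by
        have := Finset.mem_range.1 hj; omega
      rw [this, pow_succ', Module.End.mul_apply]
    rw [Finset.sum_congr rfl e]
    simp

end IsSymmKernel

end AdjointWalk

/-! ### Volume growth of a measure with bounded degrees. -/

section Volume

variable {d : ℕ} {ν : Measure (Pt d)} [IsFiniteMeasure ν] {w : Pt d → Pt d → ℝ} {ε Λ κ δ : ℝ}

/-- Either the ball carries no mass, or it contains a point of `N` whose `δ ε`-ball covers it, and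
there the kernel is bounded below while the degree is bounded above. -/
theorem IsScaledKernel.measureReal_closedBall_half_le (hw : IsScaledKernel w ε Λ κ δ) {N : Set (Pt d)}
    (hN : ∀ᵐ y ∂ν, y ∈ N) {C : ℝ} (hC0 : 0 ≤ C) (hC : ∀ y ∈ N, kernelDeg ν w y ≤ C) (p : Pt d) :
    ν.real (Metric.closedBall p (δ * ε / 2)) ≤ C / κ * ε ^ d := by
  have hε := hw.eps_pos
  have hκ := hw.kappa_pos
  by_cases h : ∃ y ∈ N, y ∈ Metric.closedBall p (δ * ε / 2)
  · obtain ⟨y, hyN, hy⟩ := h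
    have hsub : Metric.closedBall p (δ * ε / 2) ⊆ Metric.closedBall y (δ * ε) := by
      refine Metric.closedBall_subset_closedBall' ?_
      rw [Metric.mem_closedBall, dist_comm] at hy
      linarith
    have h1 : κ * (ε ^ d)⁻¹ * ν.real (Metric.closedBall y (δ * ε)) ≤ kernelDeg ν w y := by
      have e1 : κ * (ε ^ d)⁻¹ * ν.real (Metric.closedBall y (δ * ε))
          = ∫ u, (Metric.closedBall y (δ * ε)).indicator (fun _ => κ * (ε ^ d)⁻¹) u ∂ν := by
        rw [integral_indicator_const _ measurableSet_closedBall, smul_eq_mul, mul_comm]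
      rw [e1, kernelDeg]
      refine integral_mono ((integrable_const _).indicator measurableSet_closedBall)
        (hw.integrable_left y) fun u => ?_
      refine Set.indicator_apply_le' (fun hu => ?_) fun _ => hw.nonneg y u
      exact hw.ge y u (by rwa [dist_comm])
    have h2 := (h1.trans (hC y hyN))
    have h3 : ν.real (Metric.closedBall y (δ * ε)) ≤ C / κ * ε ^ d := by
      rw [div_mul_eq_mul_div, le_div_iff₀ hκ]
      have hε' : 0 < ε ^ d := by positivity
      calc _ = (κ * (ε ^ d)⁻¹ * ν.real (Metric.closedBall y (δ * ε))) * ε ^ d := by field_simp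
        _ ≤ _ := by gcongr
    exact (measureReal_mono hsub).trans h3
  · push Not at h
    have : ν (Metric.closedBall p (δ * ε / 2)) = 0 := by
      rw [measure_eq_zero_iff_ae_notMem]
      exact hN.mono h
    rw [measureReal_def, this]
    simp only [ENNReal.toReal_zero]
    positivity

/-- A measure with bounded degrees has at most Euclidean volume growth at scales above `ε`. -/
theorem IsScaledKernel.measureReal_closedBall_le (hw : IsScaledKernel w ε Λ κ δ) {N : Set (Pt d)}
    (hN : ∀ᵐ y ∂ν, y ∈ N) {C : ℝ} (hC0 : 0 ≤ C) (hC : ∀ y ∈ N, kernelDeg ν w y ≤ C) (z : Pt d)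
    {s : ℝ} (hs : 0 ≤ s) :
    ν.real (Metric.closedBall z (s * ε)) ≤ C / κ * (2 / δ) ^ d * (ε ^ d * (s + 1) ^ d) := by
  have hε := hw.eps_pos
  have hκ := hw.kappa_pos
  have hδ := hw.delta_pos
  set V := volume.real (Metric.ball (0 : Pt d) 1)
  have hV : 0 < V := volume_real_ball_pos
  set r := δ * ε / 2 with hr
  have hr0 : 0 < r := by positivity
  set A := Metric.closedBall z (s * ε)
  set A' := Metric.closedBall z ((s + 1) * ε)
  have hS : MeasurableSet {q : Pt d × Pt d | dist q.1 q.2 ≤ r} :=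
    measurableSet_le (measurable_fst.dist measurable_snd) measurable_const
  have hsub : ∀ y ∈ A, Metric.closedBall y r ⊆ A' := by
    intro y hy
    refine Metric.closedBall_subset_closedBall' ?_
    rw [Metric.mem_closedBall] at hy
    have : r ≤ ε := by rw [hr]; nlinarith [hw.delta_le]
    linarith
  have h1 : ν A * ENNReal.ofReal (r ^ d * V) ≤ ∫⁻ y in A, volume (Metric.closedBall y r) ∂ν := by
    simp only [volume_closedBall_eq, volume_closedBall_eq_ofReal hr0.le]
    rw [lintegral_const, Measure.restrict_apply_univ, mul_comm]
  -- Fubini replaces a covering argument: the `ν`-mass of `A` is averaged over all balls of radius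
  -- `r` centred in `A'`.
  have h2 : ∫⁻ y in A, volume (Metric.closedBall y r) ∂ν
      ≤ ∫⁻ p in A', ν (Metric.closedBall p r) := by
    have e1 : ∀ y ∈ A, volume (Metric.closedBall y r)
        = ∫⁻ p in A', {q : Pt d × Pt d | dist q.1 q.2 ≤ r}.indicator 1 (y, p) := by
      intro y hy
      have e2 : (fun p => {q : Pt d × Pt d | dist q.1 q.2 ≤ r}.indicator (1 : Pt d × Pt d → ℝ≥0∞) (y, p))
          = (Metric.closedBall y r).indicator 1 := by
        ext p
        by_cases h : dist y p ≤ r <;>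
            simp [Set.indicator, Metric.mem_closedBall, dist_comm p y, h]
      rw [e2, lintegral_indicator_one measurableSet_closedBall,
        Measure.restrict_apply measurableSet_closedBall, Set.inter_eq_left.2 (hsub y hy)]
    rw [setLIntegral_congr_fun measurableSet_closedBall e1]
    rw [lintegral_lintegral_swap]
    · refine lintegral_mono fun p => ?_
      have e3 : (fun y => {q : Pt d × Pt d | dist q.1 q.2 ≤ r}.indicator (1 : Pt d × Pt d → ℝ≥0∞) (y, p))
          = (Metric.closedBall p r).indicator 1 := by
        ext y
        by_cases h : dist y p ≤ r <;> simp [Set.indicator, Metric.mem_closedBall, h]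
      beta_reduce
      rw [e3, lintegral_indicator_one measurableSet_closedBall]
      exact Measure.restrict_apply_le _ _
    · exact (measurable_one.indicator hS).aemeasurable
  have h3 : ∫⁻ p in A', ν (Metric.closedBall p r)
      ≤ ENNReal.ofReal (C / κ * ε ^ d) * ENNReal.ofReal (((s + 1) * ε) ^ d * V) := by
    calc _ ≤ ∫⁻ _ in A', ENNReal.ofReal (C / κ * ε ^ d) := by
          refine lintegral_mono fun p => ?_
          rw [ENNReal.le_ofReal_iff_toReal_le (measure_ne_top _ _) (by positivity)]
          exact hw.measureReal_closedBall_half_le hN hC0 hC p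
      _ = _ := by
          rw [lintegral_const, Measure.restrict_apply_univ, volume_closedBall_eq,
            volume_closedBall_eq_ofReal (by positivity)]
  have h4 := (h1.trans h2).trans h3
  rw [← ENNReal.ofReal_mul (by positivity)] at h4
  have h5 := ENNReal.toReal_mono ENNReal.ofReal_ne_top h4
  rw [ENNReal.toReal_mul, ENNReal.toReal_ofReal (by positivity), ENNReal.toReal_ofReal (by positivity)]
    at h5
  have h6 : ν.real A * (r ^ d * V) ≤ (C / κ * (2 / δ) ^ d * (ε ^ d * (s + 1) ^ d)) * (r ^ d * V) := by
    refine h5.trans_eq ?_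
    rw [hr, mul_pow, div_pow, div_pow, mul_pow]
    field_simp
  exact le_of_mul_le_mul_right h6 (by positivity)

end Volume

/-! ### Gaussian scales and their composition. -/

section Scale

/-- Bound for the transition density after `j + 1` steps at scale `ε` and distance `D`. -/
def tailScale (d : ℕ) (ε : ℝ) (j : ℕ) (D : ℝ) : ℝ :=
  (ε ^ d)⁻¹ * min (√((j : ℝ) + 1) ^ d)⁻¹ (Real.exp (-(3 * D ^ 2 / (8 * ((j : ℝ) + 1) * ε ^ 2))))

variable {d : ℕ} {ε : ℝ}

theorem tailScale_pos (hε : 0 < ε) (j : ℕ) (D : ℝ) : 0 < tailScale d ε j D := by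
  unfold tailScale
  have : 0 < √((j : ℝ) + 1) := Real.sqrt_pos.2 (by positivity)
  have := Real.exp_pos (-(3 * D ^ 2 / (8 * ((j : ℝ) + 1) * ε ^ 2)))
  positivity

theorem tailScale_le_sup (hε : 0 < ε) (j : ℕ) (D : ℝ) :
    tailScale d ε j D ≤ (ε ^ d)⁻¹ * (√((j : ℝ) + 1) ^ d)⁻¹ := by
  unfold tailScale
  gcongr
  exact min_le_left _ _

theorem tailScale_le_exp (hε : 0 < ε) (j : ℕ) (D : ℝ) :
    tailScale d ε j D ≤ (ε ^ d)⁻¹ * Real.exp (-(3 * D ^ 2 / (8 * ((j : ℝ) + 1) * ε ^ 2))) := by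
  unfold tailScale
  gcongr
  exact min_le_right _ _

theorem continuous_tailScale (j : ℕ) : Continuous (tailScale d ε j) := by
  unfold tailScale
  fun_prop

/-- The rate `3 / 8` of `tailScale` is `3 / 4` from `three_quarters_sq_sub_le` times the rate `1 /
2` of Carne-Varopoulos. -/
theorem exp_max_sub_le (hε : 0 < ε) (j : ℕ) {D s e : ℝ} (hD : 0 ≤ D) (hs : D - e * ε ≤ s) :
    Real.exp (-(max s 0) ^ 2 / (2 * ((j : ℝ) + 1) * ε ^ 2))
      ≤ Real.exp (3 / 2 * e ^ 2) * Real.exp (-(3 * D ^ 2 / (8 * ((j : ℝ) + 1) * ε ^ 2))) := by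
  rw [← Real.exp_add]
  apply Real.exp_le_exp.2
  have h1 := three_quarters_sq_sub_le hD hs
  have hj : (1 : ℝ) ≤ (j : ℝ) + 1 := by linarith [(Nat.cast_nonneg j : (0 : ℝ) ≤ j)]
  have h2 : 3 / 2 * e ^ 2 + -(3 * D ^ 2 / (8 * ((j : ℝ) + 1) * ε ^ 2))
      = (3 * e ^ 2 * ε ^ 2 * ((j : ℝ) + 1) - 3 / 4 * D ^ 2) / (2 * ((j : ℝ) + 1) * ε ^ 2) := by
    field_simp
    ring
  rw [h2]
  gcongr
  have h3 : 3 * e ^ 2 * ε ^ 2 ≤ 3 * e ^ 2 * ε ^ 2 * ((j : ℝ) + 1) :=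
    le_mul_of_one_le_right (by positivity) hj
  nlinarith

/-- The shift `3 ε` is `2 ε` from the Gaussian bound plus one step between neighbouring points; `27
/ 2` is `3 / 2 * 3 ^ 2`. -/
theorem le_tailScale (hε : 0 < ε) {j : ℕ} {D s h K₁ K₂ : ℝ} (hK₁ : 0 ≤ K₁) (hK₂ : 0 ≤ K₂)
    (h1 : h ≤ K₁ * (ε ^ d)⁻¹ * (√((j : ℝ) + 1) ^ d)⁻¹)
    (h2 : h ≤ K₂ * (ε ^ d)⁻¹ * Real.exp (-(max s 0) ^ 2 / (2 * ((j : ℝ) + 1) * ε ^ 2)))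
    (hD : 0 ≤ D) (hs : D - 3 * ε ≤ s) :
    h ≤ (K₁ + K₂ * Real.exp (27 / 2)) * tailScale d ε j D := by
  have h3 := exp_max_sub_le hε j hD hs
  norm_num at h3
  set E := Real.exp (-(3 * D ^ 2 / (8 * ((j : ℝ) + 1) * ε ^ 2)))
  have hE : 0 < E := Real.exp_pos _
  have hε' : 0 < (ε ^ d)⁻¹ := by positivity
  have hq : 0 < (√((j : ℝ) + 1) ^ d)⁻¹ := by
    have : 0 < √((j : ℝ) + 1) := Real.sqrt_pos.2 (by positivity)
    positivity
  have hexp := Real.exp_pos (27 / 2)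
  have hsum1 : K₁ ≤ K₁ + K₂ * Real.exp (27 / 2) := by
    have := mul_nonneg hK₂ hexp.le
    linarith
  have hsum2 : K₂ * Real.exp (27 / 2) ≤ K₁ + K₂ * Real.exp (27 / 2) := by linarith
  unfold tailScale
  rw [← mul_assoc, mul_min_of_nonneg _ _ (by positivity)]
  refine le_min (h1.trans (by gcongr)) ?_
  calc h ≤ K₂ * (ε ^ d)⁻¹ * (Real.exp (27 / 2) * E) := h2.trans (by gcongr)
    _ = (K₂ * Real.exp (27 / 2)) * (ε ^ d)⁻¹ * E := by ring
    _ ≤ _ := by gcongr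

theorem add_sq_div_add_le {a b p q : ℝ} (hp : 0 < p) (hq : 0 < q) :
    (a + b) ^ 2 / (p + q) ≤ a ^ 2 / p + b ^ 2 / q := by
  rw [div_add_div _ _ hp.ne' hq.ne', div_le_div_iff₀ (by positivity) (by positivity)]
  nlinarith [mul_nonneg (by positivity : 0 ≤ p * q) (sq_nonneg (a * q - b * p)),
    sq_nonneg (a * q - b * p), mul_pos hp hq]

/-- A pointwise semigroup property: times add while distances obey the triangle inequality, by
convexity of `a ^ 2 / p`. -/
theorem exp_mul_exp_le (hε : 0 < ε) {a b D p q : ℝ} (hp : 0 < p) (hq : 0 < q)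
    (hD0 : 0 ≤ D) (hD : D ≤ a + b) :
    Real.exp (-(3 * a ^ 2 / (8 * p * ε ^ 2))) * Real.exp (-(3 * b ^ 2 / (8 * q * ε ^ 2)))
      ≤ Real.exp (-(3 * D ^ 2 / (8 * (p + q) * ε ^ 2))) := by
  rw [← Real.exp_add]
  apply Real.exp_le_exp.2
  have h1 := add_sq_div_add_le (a := a) (b := b) hp hq
  have h2 : D ^ 2 / (p + q) ≤ (a + b) ^ 2 / (p + q) := by gcongr
  have e1 : ∀ u v : ℝ, 3 * u ^ 2 / (8 * v * ε ^ 2) = 3 / (8 * ε ^ 2) * (u ^ 2 / v) := by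
    intro u v; rw [div_mul_div_comm]; ring_nf
  rw [e1, e1, e1, ← neg_add, ← mul_add]
  have : 0 < 3 / (8 * ε ^ 2) := by positivity
  nlinarith

end Scale

/-! ### One-step errors and their transport. -/

section Perturbation

variable {d : ℕ} {w : Pt d → Pt d → ℝ} {ε Λ κ δ c C K lam : ℝ} {μ ν : Measure (Pt d)}
  [IsProbabilityMeasure μ] [IsProbabilityMeasure ν] {Ω N : Set (Pt d)} {x : Pt d} {m : ℕ}

/-- The measure `ν`, carried by `N ⊆ Ω`, approximates `μ` up to a relative error `lam` when tested
against the kernel `w` and against the transition densities of the `μ`-walk started at `x`. -/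
structure IsPerturbation (hw : IsScaledKernel w ε Λ κ δ) (hc : 0 < c) (μ ν : Measure (Pt d))
    [IsProbabilityMeasure μ] [IsProbabilityMeasure ν] (Ω N : Set (Pt d)) (x : Pt d)
    (C K lam : ℝ) (m : ℕ) : Prop where
  ae_mem : ∀ᵐ y ∂μ, y ∈ Ω
  ae_mem_nodes : ∀ᵐ y ∂ν, y ∈ N
  subset : N ⊆ Ω
  mem : x ∈ Ω
  le_deg : ∀ y ∈ Ω, c ≤ kernelDeg μ w y
  deg_le : ∀ y, kernelDeg μ w y ≤ C
  lam_pos : 0 < lam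
  lam_le : lam ≤ 1
  K_nonneg : 0 ≤ K
  deg_sub : ∀ y ∈ insert x N, |kernelDeg ν w y - kernelDeg μ w y| ≤ c / 2 * lam
  heat_le : ∀ j, j + 1 ≤ m → ∀ z ∈ N, ∀ y ∈ Ω, dist z y ≤ ε →
    (hw.heat μ hc j x : Pt d → ℝ) y ≤ K * tailScale d ε j (dist x z)
  integral_sub : ∀ j, j + 2 ≤ m → ∀ z ∈ N, |∫ y, w z y * (hw.heat μ hc j x : Pt d → ℝ) y ∂ν
    - ∫ y, w z y * (hw.heat μ hc j x : Pt d → ℝ) y ∂μ| ≤ lam * tailScale d ε j (dist x z)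

namespace IsPerturbation

variable {hw : IsScaledKernel w ε Λ κ δ} {hc : 0 < c}

theorem half_le_deg (h : IsPerturbation hw hc μ ν Ω N x C K lam m) {y : Pt d}
    (hy : y ∈ insert x N) : c / 2 ≤ kernelDeg ν w y := by
  have hyΩ : y ∈ Ω := by
    rcases hy with rfl | hy
    · exact h.mem
    · exact h.subset hy
  have h1 := (abs_le.1 (h.deg_sub y hy)).1
  have h2 := h.le_deg y hyΩ
  nlinarith [h.lam_le]

theorem deg_le_add (h : IsPerturbation hw hc μ ν Ω N x C K lam m) {y : Pt d}
    (hy : y ∈ insert x N) : kernelDeg ν w y ≤ C + c / 2 := by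
  have h1 := (abs_le.1 (h.deg_sub y hy)).2
  have h2 := h.deg_le y
  nlinarith [h.lam_le]

theorem ae_le_deg (h : IsPerturbation hw hc μ ν Ω N x C K lam m) :
    ∀ᵐ y ∂μ, c ≤ kernelDeg μ w y := h.ae_mem.mono h.le_deg

theorem ae_half_le_deg (h : IsPerturbation hw hc μ ν Ω N x C K lam m) :
    ∀ᵐ y ∂ν, c / 2 ≤ kernelDeg ν w y :=
  h.ae_mem_nodes.mono fun _ hy => h.half_le_deg (Set.mem_insert_of_mem x hy)

theorem C_pos (h : IsPerturbation hw hc μ ν Ω N x C K lam m) : 0 < C :=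
  hc.trans_le ((h.le_deg x h.mem).trans (h.deg_le x))

/-- The error made by replacing one step of the `μ`-walk by a step of the `ν`-walk. -/
theorem abs_adjWalk_sub_le (h : IsPerturbation hw hc μ ν Ω N x C K lam m) {k : ℕ}
    (hk : k + 2 ≤ m) {z : Pt d} (hz : z ∈ N) :
    |adjWalk ν w ((adjWalk μ w)^[k] (w x)) z - adjWalk μ w ((adjWalk μ w)^[k] (w x)) z|
      ≤ lam * (1 + K * (C + c / 2)) * tailScale d ε k (dist x z) := by
  have hε := hw.eps_pos
  set b := tailScale d ε k (dist x z)
  have hb : 0 < b := tailScale_pos hε _ _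
  set f := hw.heat μ hc k x
  have hφ : ∀ y ∈ Ω, (adjWalk μ w)^[k] (w x) y = kernelDeg μ w y * (f : Pt d → ℝ) y :=
    fun y hy => hw.adjWalk_iterate_kernel hc h.ae_le_deg x k (h.le_deg y hy)
  have e1 : adjWalk μ w ((adjWalk μ w)^[k] (w x)) z = ∫ y, w z y * (f : Pt d → ℝ) y ∂μ := by
    refine integral_congr_ae (h.ae_mem.mono fun y hy => ?_)
    have : kernelDeg μ w y ≠ 0 := (hc.trans_le (h.le_deg y hy)).ne'
    beta_reduce
    rw [hφ y hy]; field_simp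
  -- Here `deg_μ` is replaced by `deg_ν` under the integral: the discrepancy `c / 2 * lam` against
  -- `deg_ν ≥ c / 2` is a relative error `lam`. The change of measure in the integral is
  -- `integral_sub`.
  have hpt : ∀ᵐ y ∂ν, |w z y * (kernelDeg ν w y)⁻¹ * (adjWalk μ w)^[k] (w x) y
      - w z y * (f : Pt d → ℝ) y| ≤ w z y * (lam * (K * b)) := by
    refine h.ae_mem_nodes.mono fun y hy => ?_
    by_cases hzy : ε < dist z y
    · rw [hw.range z y hzy]; simp
    have hyΩ := h.subset hy
    have hdν := h.half_le_deg (Set.mem_insert_of_mem x hy)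
    have hdν0 : 0 < kernelDeg ν w y := by linarith
    have hf0 : 0 ≤ (f : Pt d → ℝ) y := hw.heat_nonneg hc k x y
    have hf : (f : Pt d → ℝ) y ≤ K * b := h.heat_le k (by omega) z hz y hyΩ (not_lt.1 hzy)
    have e2 : w z y * (kernelDeg ν w y)⁻¹ * (adjWalk μ w)^[k] (w x) y - w z y * (f : Pt d → ℝ) y
        = w z y * (-((kernelDeg ν w y - kernelDeg μ w y) / kernelDeg ν w y) * (f : Pt d → ℝ) y) := by
      rw [hφ y hyΩ]; field_simp; ring
    rw [e2, abs_mul, abs_of_nonneg (hw.nonneg z y), abs_mul, abs_neg, abs_div, abs_of_pos hdν0,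
      abs_of_nonneg hf0]
    refine mul_le_mul_of_nonneg_left ?_ (hw.nonneg z y)
    refine mul_le_mul ?_ hf hf0 h.lam_pos.le
    rw [div_le_iff₀ hdν0]
    have h3 := h.deg_sub y (Set.mem_insert_of_mem x hy)
    nlinarith [h.lam_pos]
  have hint1 : Integrable (fun y => w z y * (kernelDeg ν w y)⁻¹ * (adjWalk μ w)^[k] (w x) y) ν := by
    have := hw.integrable_adjWalk (by positivity) h.ae_half_le_deg
      ((hw.adjWalkB μ hc h.ae_le_deg ^ k) ⟨w x, hw.meas_left x, by
        obtain ⟨B, _, hB⟩ := hw.exists_bound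
        exact ⟨B, hB x⟩⟩) z
    rwa [hw.coe_adjWalkB_pow] at this
  have hint2 := hw.integrable_mul (ν := ν) z f
  have e3 : |adjWalk ν w ((adjWalk μ w)^[k] (w x)) z - ∫ y, w z y * (f : Pt d → ℝ) y ∂ν|
      ≤ lam * (K * b) * (C + c / 2) := by
    rw [adjWalk, ← MeasureTheory.integral_sub hint1 hint2]
    calc _ ≤ ∫ y, w z y * (lam * (K * b)) ∂ν :=
          abs_integral_le_integral_abs.trans (integral_mono_ae (hint1.sub hint2).abs
            ((hw.integrable_left z).mul_const _) hpt)
      _ = lam * (K * b) * kernelDeg ν w z := by rw [integral_mul_const, kernelDeg, mul_comm]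
      _ ≤ _ := by
          have := h.K_nonneg
          have := h.lam_pos
          exact mul_le_mul_of_nonneg_left (h.deg_le_add (Set.mem_insert_of_mem x hz)) (by positivity)
  have e4 := h.integral_sub k hk z hz
  rw [e1]
  calc _ ≤ _ := abs_sub_le _ (∫ y, w z y * (f : Pt d → ℝ) y ∂ν) _
    _ ≤ lam * (K * b) * (C + c / 2) + lam * b := add_le_add e3 e4
    _ = _ := by ring

/-- One term of the error expansion: the error of a single step, transported by the `ν`-walk. -/
theorem adjWalk_iterate_le_exp (h : IsPerturbation hw hc μ ν Ω N x C K lam m) {β : boundedMeasurable (Pt d)}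
    {j l : ℕ} {T : ℝ} (hT : 0 ≤ T) (hβ : ∀ y ∈ N, |(β : Pt d → ℝ) y| ≤ T * tailScale d ε j (dist x y))
    {z : Pt d} (hz : z ∈ N) :
    (adjWalk ν w)^[l] β z ≤ T * (1 + 2 * Λ * (C + c / 2) / (c / 2) ^ 2 * Real.exp 6
        * ((C + c / 2) / κ * (2 / δ) ^ d)) * ((ε ^ d)⁻¹ * ((l : ℝ) + j + 2) ^ d
        * Real.exp (-(3 * dist x z ^ 2 / (8 * ((l : ℝ) + j + 1) * ε ^ 2)))) := by
  have hε := hw.eps_pos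
  have hκ := hw.kappa_pos
  have hδ := hw.delta_pos
  have hC := h.C_pos
  have hεd : 0 < ε ^ d := by positivity
  have hΛ : 0 ≤ Λ := by
    have := (hw.nonneg x x).trans (hw.le x x)
    exact nonneg_of_mul_nonneg_left this (by positivity)
  set G := 2 * Λ * (C + c / 2) / (c / 2) ^ 2 * Real.exp 6 with hG
  set Vc := (C + c / 2) / κ * (2 / δ) ^ d with hVc
  have hG0 : 0 ≤ G := by positivity
  have hVc0 : 0 ≤ Vc := by positivity
  cases l with
  | zero =>
    have h1 := (le_abs_self _).trans (hβ z hz)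
    have h2 := tailScale_le_exp (d := d) hε j (dist x z)
    rw [Function.iterate_zero, id]
    refine h1.trans ?_
    simp only [Nat.cast_zero, zero_add]
    set E := Real.exp (-(3 * dist x z ^ 2 / (8 * ((j : ℝ) + 1) * ε ^ 2)))
    have hE : 0 < E := Real.exp_pos _
    have hj : (1 : ℝ) ≤ ((j : ℝ) + 2) ^ d := one_le_pow₀ (by linarith [(Nat.cast_nonneg j : (0 : ℝ) ≤ j)])
    calc T * tailScale d ε j (dist x z) ≤ T * 1 * ((ε ^ d)⁻¹ * 1 * E) := by
          rw [mul_one, mul_one]; gcongr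
      _ ≤ _ := by
          gcongr
          have := mul_nonneg hG0 hVc0
          linarith
  | succ l =>
    have hc2 : 0 < c / 2 := by positivity
    rw [hw.adjWalk_iterate_succ_eq hc2 h.ae_half_le_deg β l z]
    set E := Real.exp (-(3 * dist x z ^ 2 / (8 * (((l + 1 : ℕ) : ℝ) + j + 1) * ε ^ 2))) with hE'
    have hE : 0 < E := Real.exp_pos _
    -- The walk cannot leave this ball in `l + 1` steps. The product of the two Gaussians is bounded
    -- uniformly on it, and its `ν`-mass supplies the polynomial factor.
    set A := Metric.closedBall z (((l : ℝ) + 1) * ε)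
    have hpt : ∀ᵐ y ∂ν, (hw.heat ν hc2 l z : Pt d → ℝ) y * (β : Pt d → ℝ) y
        ≤ A.indicator (fun _ => T * G * ((ε ^ d)⁻¹ * (ε ^ d)⁻¹ * E)) y := by
      refine h.ae_mem_nodes.mono fun y hy => ?_
      by_cases hyA : y ∈ A
      · rw [Set.indicator_of_mem hyA]
        have h1 := hw.heat_le_gaussian hc2 hε hw.range hw.le h.ae_half_le_deg l
          (h.deg_le_add (Set.mem_insert_of_mem x hz)) (h.deg_le_add (Set.mem_insert_of_mem x hy))
          (h.half_le_deg (Set.mem_insert_of_mem x hy))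
        have h2 := exp_max_sub_le hε l (D := dist z y) (e := 2) dist_nonneg le_rfl
        have h3 : (hw.heat ν hc2 l z : Pt d → ℝ) y
            ≤ G * ((ε ^ d)⁻¹ * Real.exp (-(3 * dist z y ^ 2 / (8 * ((l : ℝ) + 1) * ε ^ 2)))) := by
          refine h1.trans ?_
          calc _ ≤ 2 * (Λ * (ε ^ d)⁻¹) * (C + c / 2) / (c / 2) ^ 2 * _ :=
                mul_le_mul_of_nonneg_left h2 (by positivity)
            _ = _ := by rw [hG]; norm_num; ring
        have h4 := (le_abs_self _).trans ((hβ y hy).trans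
          (mul_le_mul_of_nonneg_left (tailScale_le_exp hε j (dist x y)) hT))
        have h5 := exp_mul_exp_le hε (a := dist z y) (b := dist x y) (D := dist x z)
          (p := (l : ℝ) + 1) (q := (j : ℝ) + 1) (by positivity) (by positivity) dist_nonneg
          (by rw [add_comm, dist_comm z y]; exact dist_triangle _ _ _)
        have h6 : (l : ℝ) + 1 + ((j : ℝ) + 1) = ((l + 1 : ℕ) : ℝ) + j + 1 := by push_cast; ring
        rw [h6] at h5
        calc _ ≤ G * ((ε ^ d)⁻¹ * Real.exp (-(3 * dist z y ^ 2 / (8 * ((l : ℝ) + 1) * ε ^ 2))))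
              * (T * ((ε ^ d)⁻¹ * Real.exp (-(3 * dist x y ^ 2 / (8 * ((j : ℝ) + 1) * ε ^ 2))))) := by
              refine (mul_le_mul_of_nonneg_left h4 (hw.heat_nonneg hc2 l z y)).trans ?_
              exact mul_le_mul_of_nonneg_right h3 (by positivity)
          _ = T * G * ((ε ^ d)⁻¹ * (ε ^ d)⁻¹
              * (Real.exp (-(3 * dist z y ^ 2 / (8 * ((l : ℝ) + 1) * ε ^ 2)))
              * Real.exp (-(3 * dist x y ^ 2 / (8 * ((j : ℝ) + 1) * ε ^ 2))))) := by ring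
          _ ≤ _ := by gcongr
      · rw [Set.indicator_of_notMem hyA, hw.heat_eq_zero hc2 hw.range l, zero_mul]
        rw [Metric.mem_closedBall, not_le, dist_comm] at hyA
        exact hyA
    have hmA : MeasurableSet A := measurableSet_closedBall
    have hvol : ν.real A ≤ Vc * (ε ^ d * ((l : ℝ) + 1 + 1) ^ d) :=
      hw.measureReal_closedBall_le h.ae_mem_nodes (by positivity)
        (fun y hy => h.deg_le_add (Set.mem_insert_of_mem x hy)) z (by positivity)
    have hintβ : Integrable (fun y => (hw.heat ν hc2 l z : Pt d → ℝ) y * (β : Pt d → ℝ) y) ν := by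
      obtain ⟨B₁, hB₁, hf⟩ := exists_abs_le_coe (hw.heat ν hc2 l z)
      obtain ⟨B₂, hB₂, hg⟩ := exists_abs_le_coe β
      refine integrable_of_abs_le ((measurable_coe _).mul (measurable_coe _)) (C := B₁ * B₂)
        fun y => ?_
      rw [abs_mul]
      exact mul_le_mul (hf y) (hg y) (abs_nonneg _) hB₁
    calc _ ≤ ∫ y, A.indicator (fun _ => T * G * ((ε ^ d)⁻¹ * (ε ^ d)⁻¹ * E)) y ∂ν :=
          integral_mono_ae hintβ ((integrable_const _).indicator hmA) hpt
      _ = ν.real A * (T * G * ((ε ^ d)⁻¹ * (ε ^ d)⁻¹ * E)) := by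
          rw [integral_indicator_const _ hmA, smul_eq_mul]
      _ ≤ Vc * (ε ^ d * ((l : ℝ) + 1 + 1) ^ d) * (T * G * ((ε ^ d)⁻¹ * (ε ^ d)⁻¹ * E)) := by gcongr
      _ = T * (G * Vc) * ((ε ^ d)⁻¹ * ((l : ℝ) + 1 + 1) ^ d * E) := by field_simp
      _ ≤ _ := by
          have h7 : (l : ℝ) + 1 + 1 ≤ ((l + 1 : ℕ) : ℝ) + j + 2 := by
            push_cast
            linarith [(Nat.cast_nonneg j : (0 : ℝ) ≤ j)]
          have h8 : G * Vc ≤ 1 + G * Vc := by linarith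
          gcongr

end IsPerturbation

end Perturbation

/-! ### Accumulated error of the two walks. -/

section Comparison

/-- A kernel with one argument fixed, as a bounded function. -/
def IsSymmKernel.rowB {E : Type*} [MeasurableSpace E] {w : E → E → ℝ} (hw : IsSymmKernel w) (x : E) :
    boundedMeasurable E :=
  ⟨w x, hw.meas_left x, hw.exists_bound.imp fun _ h => h.2 x⟩

variable {d : ℕ} {w : Pt d → Pt d → ℝ} {ε Λ κ δ c C K lam : ℝ} {μ ν : Measure (Pt d)}
  [IsProbabilityMeasure μ] [IsProbabilityMeasure ν] {Ω N : Set (Pt d)} {x : Pt d} {m : ℕ}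

/-- The scale of the accumulated error after `k` steps. -/
def errorScale (d : ℕ) (ε : ℝ) (k : ℕ) (D : ℝ) : ℝ :=
  (ε ^ d)⁻¹ * min (∑ j ∈ Finset.range k, (√((j : ℝ) + 1) ^ d)⁻¹)
    (((k : ℝ) + 1) ^ (d + 1) * Real.exp (-(3 * D ^ 2 / (8 * k * ε ^ 2))))

theorem inv_sqrt_pow_pos (d j : ℕ) : 0 < (√((j : ℝ) + 1) ^ d)⁻¹ := by
  have : 0 < √((j : ℝ) + 1) := Real.sqrt_pos.2 (by positivity)
  positivity

theorem errorScale_le_succ (hε : 0 < ε) {k : ℕ} (hk : 1 ≤ k) (D : ℝ) :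
    errorScale d ε k D ≤ errorScale d ε (k + 1) D := by
  have hk' : (0 : ℝ) < k := by exact_mod_cast hk
  unfold errorScale
  gcongr
  · exact Nat.le_succ k
  all_goals linarith

theorem tailScale_le_errorScale_succ (hε : 0 < ε) (k : ℕ) (D : ℝ) :
    tailScale d ε k D ≤ errorScale d ε (k + 1) D := by
  unfold errorScale tailScale
  gcongr
  · rw [Finset.sum_range_succ]
    exact le_add_of_nonneg_left (Finset.sum_nonneg fun j _ => (inv_sqrt_pow_pos d j).le)
  · push_cast
    refine le_mul_of_one_le_left (Real.exp_pos _).le (one_le_pow₀ ?_)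
    linarith [(Nat.cast_nonneg k : (0 : ℝ) ≤ k)]

namespace IsPerturbation

variable {hw : IsScaledKernel w ε Λ κ δ} {hc : 0 < c}

/-- The same Duhamel sources are estimated twice: `abs_le_sum_mul_deg` gives the first entry of the
minimum in `errorScale`, `abs_le_sum_iterate` with `adjWalk_iterate_le_exp` the second. -/
theorem abs_iterate_sub_le (h : IsPerturbation hw hc μ ν Ω N x C K lam m) {k : ℕ} (hk : k + 1 ≤ m)
    (hk1 : 1 ≤ k) {z : Pt d} (hz : z ∈ N) :
    |(adjWalk ν w)^[k] (w x) z - (adjWalk μ w)^[k] (w x) z|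
      ≤ lam * (1 + K * (C + c / 2)) * (2 / c * (C + c / 2) + (1 + 2 * Λ * (C + c / 2) / (c / 2) ^ 2
        * Real.exp 6 * ((C + c / 2) / κ * (2 / δ) ^ d))) * errorScale d ε k (dist x z) := by
  have hε := hw.eps_pos
  have hκ := hw.kappa_pos
  have hδ := hw.delta_pos
  have hC := h.C_pos
  have hlam := h.lam_pos
  have hK := h.K_nonneg
  have hεd : 0 < (ε ^ d)⁻¹ := by positivity
  have hk0 : (0 : ℝ) < k := by exact_mod_cast hk1
  have hΛ : 0 ≤ Λ := by
    have := (hw.nonneg x x).trans (hw.le x x)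
    exact nonneg_of_mul_nonneg_left this (by positivity)
  set M := 1 + 2 * Λ * (C + c / 2) / (c / 2) ^ 2 * Real.exp 6 * ((C + c / 2) / κ * (2 / δ) ^ d)
  have hM : 0 ≤ M := by positivity
  set T := lam * (1 + K * (C + c / 2))
  have hT : 0 ≤ T := by positivity
  have hc2 : 0 < c / 2 := by positivity
  let D : ℕ → boundedMeasurable (Pt d) := fun k =>
    (hw.adjWalkB ν hc2 h.ae_half_le_deg ^ k) (hw.rowB x)
      - (hw.adjWalkB μ hc h.ae_le_deg ^ k) (hw.rowB x)
  let β : ℕ → boundedMeasurable (Pt d) := fun k => ⟨fun z => T * tailScale d ε k (dist x z),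
    ((continuous_tailScale k).measurable.comp (measurable_const.dist measurable_id)).const_mul T,
    T * ((ε ^ d)⁻¹ * (√((k : ℝ) + 1) ^ d)⁻¹), fun z => by
      have := (tailScale_pos (d := d) hε k (dist x z)).le
      rw [abs_of_nonneg (by positivity)]
      exact mul_le_mul_of_nonneg_left (tailScale_le_sup hε k _) hT⟩
  have hDapp : ∀ k z, (D k : Pt d → ℝ) z = (adjWalk ν w)^[k] (w x) z - (adjWalk μ w)^[k] (w x) z := by
    intro k z
    simp only [D, Submodule.coe_sub, Pi.sub_apply, hw.coe_adjWalkB_pow]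
    rfl
  have h0 : ∀ z ∈ N, (D 0 : Pt d → ℝ) z = 0 := fun z _ => by rw [hDapp]; simp
  have hstep : ∀ i < m - 1, ∀ z ∈ N,
      |(D (i + 1) : Pt d → ℝ) z - (hw.adjWalkB ν hc2 h.ae_half_le_deg (D i) : Pt d → ℝ) z|
        ≤ (β i : Pt d → ℝ) z := by
    intro i hi z hz
    have e1 : (D (i + 1) : Pt d → ℝ) z - (hw.adjWalkB ν hc2 h.ae_half_le_deg (D i) : Pt d → ℝ) z
        = adjWalk ν w ((adjWalk μ w)^[i] (w x)) z - adjWalk μ w ((adjWalk μ w)^[i] (w x)) z := by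
      rw [hDapp]
      simp only [D, map_sub, Submodule.coe_sub, Pi.sub_apply, hw.adjWalkB_apply, hw.coe_adjWalkB_pow,
        Function.iterate_succ_apply']
      change adjWalk ν w ((adjWalk ν w)^[i] (w x)) z - adjWalk μ w ((adjWalk μ w)^[i] (w x)) z
        - (adjWalk ν w ((adjWalk ν w)^[i] (w x)) z - adjWalk ν w ((adjWalk μ w)^[i] (w x)) z) = _
      ring
    rw [e1]
    exact h.abs_adjWalk_sub_le (by omega) hz
  have hsup := hw.abs_le_sum_mul_deg h.ae_mem_nodes h0 hstep
    (s := fun j => T * (2 / c) * ((ε ^ d)⁻¹ * (√((j : ℝ) + 1) ^ d)⁻¹)) (by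
      intro i hi z hz
      have h1 : 1 ≤ 2 / c * kernelDeg ν w z := by
        have := h.half_le_deg (Set.mem_insert_of_mem x hz)
        rw [div_mul_eq_mul_div, one_le_div hc]; linarith
      have h2 := inv_sqrt_pow_pos d i
      calc T * tailScale d ε i (dist x z) ≤ T * ((ε ^ d)⁻¹ * (√((i : ℝ) + 1) ^ d)⁻¹) * 1 := by
            rw [mul_one]; exact mul_le_mul_of_nonneg_left (tailScale_le_sup hε i _) hT
        _ ≤ T * ((ε ^ d)⁻¹ * (√((i : ℝ) + 1) ^ d)⁻¹) * (2 / c * kernelDeg ν w z) := by gcongr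
        _ = _ := by ring) k (by omega) z hz
  have hgauss := hw.abs_le_sum_iterate h.ae_mem_nodes h0 hstep k (by omega) z hz
  rw [hDapp] at hsup hgauss
  rw [← Finset.mul_sum, ← Finset.mul_sum] at hsup
  set S := ∑ j ∈ Finset.range k, (√((j : ℝ) + 1) ^ d)⁻¹
  have hS : 0 ≤ S := Finset.sum_nonneg fun j _ => (inv_sqrt_pow_pos d j).le
  set E := Real.exp (-(3 * dist x z ^ 2 / (8 * k * ε ^ 2)))
  have hE : 0 < E := Real.exp_pos _
  unfold errorScale
  rw [← mul_assoc, mul_min_of_nonneg _ _ (by positivity)]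
  refine le_min ?_ ?_
  · calc _ ≤ T * (2 / c) * ((ε ^ d)⁻¹ * S) * kernelDeg ν w z := hsup
      _ ≤ T * (2 / c) * ((ε ^ d)⁻¹ * S) * (C + c / 2) := by
          gcongr
          exact h.deg_le_add (Set.mem_insert_of_mem x hz)
      _ = T * (2 / c * (C + c / 2)) * (ε ^ d)⁻¹ * S := by ring
      _ ≤ _ := by
          gcongr
          linarith
  · have hterm : ∀ j ∈ Finset.range k, (adjWalk ν w)^[k - 1 - j] (β j) z
        ≤ T * M * ((ε ^ d)⁻¹ * ((k : ℝ) + 1) ^ d * E) := by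
      intro j hj
      have hj' := Finset.mem_range.1 hj
      have h1 := h.adjWalk_iterate_le_exp (β := β j) (l := k - 1 - j) hT (fun y _ => by
        change |T * tailScale d ε j (dist x y)| ≤ _
        have := (tailScale_pos (d := d) hε j (dist x y)).le
        rw [abs_of_nonneg (by positivity)]) hz
      -- Creation and transport times always add up to `k`, so every term has the same Gaussian and
      -- summation costs one more factor `k`.
      have e2 : ((k - 1 - j : ℕ) : ℝ) + j + 1 = k := by
        have : k - 1 - j + j + 1 = k := by omega
        exact_mod_cast this
      have e3 : ((k - 1 - j : ℕ) : ℝ) + j + 2 = k + 1 := by linarith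
      rw [e2, e3] at h1
      exact h1
    have hsum := Finset.sum_le_card_nsmul _ _ _ hterm
    rw [Finset.card_range, nsmul_eq_mul] at hsum
    calc _ ≤ _ := hgauss
      _ ≤ k * (T * M * ((ε ^ d)⁻¹ * ((k : ℝ) + 1) ^ d * E)) := hsum
      _ ≤ ((k : ℝ) + 1) * (T * M * ((ε ^ d)⁻¹ * ((k : ℝ) + 1) ^ d * E)) := by
          gcongr; linarith
      _ = T * M * (ε ^ d)⁻¹ * (((k : ℝ) + 1) ^ (d + 1) * E) := by ring
      _ ≤ _ := by
          gcongr
          have : 0 ≤ 2 / c * (C + c / 2) := by positivity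
          linarith

/-- Comparison of the heat kernels of the two walks. -/
theorem abs_heatKernel_sub_le (h : IsPerturbation hw hc μ ν Ω N x C K lam m) {k : ℕ} (hk : k + 1 ≤ m)
    (hk1 : 1 ≤ k) {z : Pt d} (hz : z ∈ N) :
    |(kernelDeg ν w x)⁻¹ * (adjWalk ν w)^[k] (w x) z - (kernelDeg μ w x)⁻¹ * (adjWalk μ w)^[k] (w x) z|
      ≤ (2 / c * ((1 + K * (C + c / 2)) * (2 / c * (C + c / 2) + (1 + 2 * Λ * (C + c / 2) / (c / 2) ^ 2
        * Real.exp 6 * ((C + c / 2) / κ * (2 / δ) ^ d)))) + C * K / c)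
        * (lam * errorScale d ε (k + 1) (dist x z)) := by
  have hε := hw.eps_pos
  have hC := h.C_pos
  have hlam := h.lam_pos
  have hK := h.K_nonneg
  set Q := (1 + K * (C + c / 2)) * (2 / c * (C + c / 2) + (1 + 2 * Λ * (C + c / 2) / (c / 2) ^ 2
        * Real.exp 6 * ((C + c / 2) / κ * (2 / δ) ^ d))) with hQ
  have hΛ : 0 ≤ Λ := by
    have := (hw.nonneg x x).trans (hw.le x x)
    exact nonneg_of_mul_nonneg_left this (by positivity)
  have hQ0 : 0 ≤ Q := by
    have := hw.kappa_pos
    have := hw.delta_pos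
    positivity
  have h1 := h.abs_iterate_sub_le hk hk1 hz
  have h1' : |(adjWalk ν w)^[k] (w x) z - (adjWalk μ w)^[k] (w x) z|
      ≤ Q * (lam * errorScale d ε (k + 1) (dist x z)) := by
    refine h1.trans ?_
    calc _ = Q * (lam * errorScale d ε k (dist x z)) := by rw [hQ]; ring
      _ ≤ _ := by
          have := errorScale_le_succ (d := d) hε hk1 (dist x z)
          gcongr
  have hdν := h.half_le_deg (Set.mem_insert x N)
  have hdμ := h.le_deg x h.mem
  have hν0 : 0 < kernelDeg ν w x := by linarith
  have hμ0 : 0 < kernelDeg μ w x := by linarith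
  have hzΩ := h.subset hz
  have hφ : (adjWalk μ w)^[k] (w x) z = kernelDeg μ w z * (hw.heat μ hc k x : Pt d → ℝ) z :=
    hw.adjWalk_iterate_kernel hc h.ae_le_deg x k (h.le_deg z hzΩ)
  have hheat := h.heat_le k hk z hz z hzΩ (by rw [dist_self]; exact hε.le)
  have hheat0 := hw.heat_nonneg (ν := μ) hc k x z
  have htail := tailScale_le_errorScale_succ (d := d) hε k (dist x z)
  have hφ0 : 0 ≤ (adjWalk μ w)^[k] (w x) z := by
    rw [hφ]; exact mul_nonneg (hw.deg_nonneg z) hheat0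
  have hφ1 : (adjWalk μ w)^[k] (w x) z ≤ C * (K * errorScale d ε (k + 1) (dist x z)) := by
    rw [hφ]
    refine mul_le_mul (h.deg_le z) (hheat.trans ?_) hheat0 hC.le
    gcongr
  have hinv : |(kernelDeg ν w x)⁻¹ - (kernelDeg μ w x)⁻¹| ≤ lam / c := by
    rw [inv_sub_inv hν0.ne' hμ0.ne', abs_div, abs_of_pos (mul_pos hν0 hμ0), abs_sub_comm,
      div_le_div_iff₀ (mul_pos hν0 hμ0) hc]
    have h3 := h.deg_sub x (Set.mem_insert x N)
    have h4 : c / 2 * c ≤ kernelDeg ν w x * kernelDeg μ w x := by gcongr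
    nlinarith
  -- The second summand, from the normalisation at `x`, is of size `tailScale k`; this is why the
  -- error is measured at `k + 1`.
  have e1 : (kernelDeg ν w x)⁻¹ * (adjWalk ν w)^[k] (w x) z - (kernelDeg μ w x)⁻¹ * (adjWalk μ w)^[k] (w x) z
      = (kernelDeg ν w x)⁻¹ * ((adjWalk ν w)^[k] (w x) z - (adjWalk μ w)^[k] (w x) z)
        + ((kernelDeg ν w x)⁻¹ - (kernelDeg μ w x)⁻¹) * (adjWalk μ w)^[k] (w x) z := by ring
  rw [e1, add_mul]
  refine (abs_add_le _ _).trans (add_le_add ?_ ?_)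
  · rw [abs_mul, abs_inv, abs_of_pos hν0, mul_assoc]
    refine mul_le_mul ?_ h1' (abs_nonneg _) (by positivity)
    rw [inv_le_comm₀ hν0 (by positivity), inv_div]
    exact hdν
  · rw [abs_mul, abs_of_nonneg hφ0]
    calc _ ≤ lam / c * (C * (K * errorScale d ε (k + 1) (dist x z))) :=
          mul_le_mul hinv hφ1 hφ0 (by positivity)
      _ = _ := by ring

end IsPerturbation

end Comparison

/-! ### From `errorScale` to `phiError`. -/

section ErrorTerm

theorem sum_inv_sqrt_le (k : ℕ) : ∑ j ∈ Finset.range k, (√((j : ℝ) + 1))⁻¹ ≤ 2 * √(k : ℝ) := by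
  induction k with
  | zero => simp
  | succ k ih =>
    rw [Finset.sum_range_succ]
    push_cast
    have hb : 0 < √((k : ℝ) + 1) := Real.sqrt_pos.2 (by positivity)
    have h1 : (√((k : ℝ) + 1))⁻¹ ≤ 2 * √((k : ℝ) + 1) - 2 * √(k : ℝ) := by
      have h2 := Real.sq_sqrt (by positivity : (0 : ℝ) ≤ (k : ℝ) + 1)
      have h3 := Real.sq_sqrt (by positivity : (0 : ℝ) ≤ (k : ℝ))
      rw [inv_le_iff_one_le_mul₀ hb]
      nlinarith [sq_nonneg (√((k : ℝ) + 1) - √(k : ℝ))]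
    linarith

theorem sum_inv_le_log (k : ℕ) :
    ∑ j ∈ Finset.range k, ((j : ℝ) + 1)⁻¹ ≤ 2 * Real.log ((k : ℝ) + 1) := by
  induction k with
  | zero => simp
  | succ k ih =>
    rw [Finset.sum_range_succ]
    push_cast
    have hk : (0 : ℝ) ≤ k := Nat.cast_nonneg k
    have h1 := Real.one_sub_inv_le_log_of_pos (x := ((k : ℝ) + 1 + 1) / ((k : ℝ) + 1)) (by positivity)
    rw [Real.log_div (by positivity) (by positivity), inv_div] at h1
    have h2 : ((k : ℝ) + 1)⁻¹ ≤ 2 * (1 - ((k : ℝ) + 1) / ((k : ℝ) + 1 + 1)) := by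
      rw [inv_le_iff_one_le_mul₀ (by positivity)]
      have : 1 - ((k : ℝ) + 1) / ((k : ℝ) + 1 + 1) = 1 / ((k : ℝ) + 1 + 1) := by
        field_simp; ring
      rw [this, mul_one_div, div_mul_eq_mul_div, le_div_iff₀ (by positivity)]
      linarith
    linarith

/-- Telescoping with `b⁻³ ≤ 2 / a - 2 / b` for consecutive roots `a`, `b`. The bound is uniform in
`k` and covers all `d ≥ 3` by `sum_inv_sqrt_pow_anti`. -/
theorem sum_inv_sqrt_cube_le (k : ℕ) :
    ∑ j ∈ Finset.range (k + 1), (√((j : ℝ) + 1) ^ 3)⁻¹ ≤ 3 - 2 * (√((k : ℝ) + 1))⁻¹ := by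
  induction k with
  | zero => norm_num
  | succ k ih =>
    rw [Finset.sum_range_succ]
    push_cast
    set a := √((k : ℝ) + 1)
    set b := √((k : ℝ) + 1 + 1)
    have ha : 0 < a := Real.sqrt_pos.2 (by positivity)
    have hab : a ≤ b := Real.sqrt_le_sqrt (by linarith)
    have hb : 0 < b := ha.trans_le hab
    have h2 : b ^ 2 = a ^ 2 + 1 := by
      rw [Real.sq_sqrt (by positivity), Real.sq_sqrt (by positivity)]
    have h1 : (b ^ 3)⁻¹ ≤ 2 * a⁻¹ - 2 * b⁻¹ := by
      have e1 : 2 * a⁻¹ - 2 * b⁻¹ = 2 * (b - a) / (a * b) := by field_simp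
      have e2 : (b - a) * (b + a) = 1 := by nlinarith
      have e3 : b - a = 1 / (b + a) := by
        rw [eq_div_iff (by positivity)]; exact e2
      have e4 : 2 * (b - a) / (a * b) = 2 / ((b + a) * (a * b)) := by rw [e3]; field_simp
      rw [e1, e4, inv_le_iff_one_le_mul₀ (by positivity), div_mul_eq_mul_div,
        one_le_div (by positivity)]
      have h3 : (b + a) * (a * b) ≤ (b + b) * (b * b) := by gcongr
      nlinarith
    linarith

theorem sum_inv_sqrt_pow_anti {p q : ℕ} (h : p ≤ q) (k : ℕ) :
    ∑ j ∈ Finset.range k, (√((j : ℝ) + 1) ^ q)⁻¹ ≤ ∑ j ∈ Finset.range k, (√((j : ℝ) + 1) ^ p)⁻¹ := by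
  refine Finset.sum_le_sum fun j _ => ?_
  have h1 : 1 ≤ √((j : ℝ) + 1) := by
    rw [Real.one_le_sqrt]; linarith [(Nat.cast_nonneg j : (0 : ℝ) ≤ j)]
  have := inv_sqrt_pow_pos p j
  gcongr

theorem sum_le_Theta {d : ℕ} (hd : 1 ≤ d) (k : ℕ) :
    ∑ j ∈ Finset.range k, (√((j : ℝ) + 1) ^ d)⁻¹ ≤ 3 * Theta d k := by
  unfold Theta
  split_ifs with h1 h2
  · subst h1
    simp only [pow_one]
    exact (sum_inv_sqrt_le k).trans (by linarith [Real.sqrt_nonneg (k : ℝ)])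
  · subst h2
    have e : ∀ j : ℕ, √((j : ℝ) + 1) ^ 2 = (j : ℝ) + 1 := fun j => Real.sq_sqrt (by positivity)
    simp only [e]
    refine (sum_inv_le_log k).trans ?_
    have := Real.log_nonneg (by linarith [(Nat.cast_nonneg k : (0 : ℝ) ≤ k)] : (1 : ℝ) ≤ (k : ℝ) + 1)
    linarith
  · have h3 : 3 ≤ d := by omega
    have h3' : (3 : ℝ) ≤ d := by exact_mod_cast h3
    have h4 : (1 : ℝ) ≤ (d : ℝ) / ((d : ℝ) - 2) := by
      rw [one_le_div (by linarith)]; linarith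
    have h5 : ∑ j ∈ Finset.range k, (√((j : ℝ) + 1) ^ 3)⁻¹ ≤ 3 := by
      cases k with
      | zero => simp
      | succ k =>
        have := sum_inv_sqrt_cube_le k
        have : 0 ≤ (√((k : ℝ) + 1))⁻¹ := by positivity
        linarith
    have := sum_inv_sqrt_pow_anti h3 k
    linarith

/-- If `√k u ≥ 1` the first entry suffices; otherwise the second equals `k u` times `(√k u) ^ (2 d)
u ^ (d - 1) ≤ 1`. -/
theorem min_sqrt_pow_mul_le {d : ℕ} (hd : 1 ≤ d) {k u : ℝ} (hk : 1 ≤ k) (hu0 : 0 ≤ u) (hu : u ≤ 1) :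
    min √k (k ^ (d + 1) * u ^ (3 * d)) ≤ k * u := by
  have hsq := Real.sq_sqrt (by linarith : 0 ≤ k)
  have hs : 0 ≤ √k := Real.sqrt_nonneg k
  rcases le_total 1 (√k * u) with h | h
  · refine (min_le_left _ _).trans ?_
    calc √k = √k * 1 := (mul_one _).symm
      _ ≤ √k * (√k * u) := by gcongr
      _ = √k ^ 2 * u := by ring
      _ = k * u := by rw [hsq]
  · refine (min_le_right _ _).trans ?_
    obtain ⟨e, rfl⟩ : ∃ e, d = e + 1 := ⟨d - 1, by omega⟩
    have e1 : k ^ (e + 1 + 1) * u ^ (3 * (e + 1)) = k * u * ((√k * u) ^ (2 * (e + 1)) * u ^ e) := by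
      rw [mul_pow, pow_mul √k, hsq]; ring
    rw [e1]
    have h1 : (√k * u) ^ (2 * (e + 1)) ≤ 1 := pow_le_one₀ (by positivity) h
    have h2 : u ^ e ≤ 1 := pow_le_one₀ hu0 hu
    have h3 : (√k * u) ^ (2 * (e + 1)) * u ^ e ≤ 1 := mul_le_one₀ h1 (by positivity) h2
    exact mul_le_of_le_one_right (by positivity) h3

/-- The Gaussian of `errorScale` is at most the power `3 d` of the one in `phiError`, which lets
`min_sqrt_pow_mul_le` absorb `(k + 1) ^ (d + 1)`. -/
theorem errorScale_le_phiError {d : ℕ} (hd : 1 ≤ d) {ε : ℝ} (hε : 0 < ε) {k : ℕ} (hk : 1 ≤ k)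
    (z : Pt d) : errorScale d ε k ‖z‖ ≤ 2 ^ (d + 2) * ((ε ^ d)⁻¹ * phiError ε k z) := by
  have hd' : (1 : ℝ) ≤ d := by exact_mod_cast hd
  have hk' : (1 : ℝ) ≤ k := by exact_mod_cast hk
  have hk0 : (0 : ℝ) < k := by linarith
  set S := ∑ j ∈ Finset.range k, (√((j : ℝ) + 1) ^ d)⁻¹ with hS
  set E := Real.exp (-(3 * ‖z‖ ^ 2 / (8 * k * ε ^ 2)))
  set u := Real.exp (-(max (‖z‖ - ε) 0) ^ 2 / (8 * d * epsK ε k ^ 2)) with hu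
  have hu0 : 0 ≤ u := (Real.exp_pos _).le
  have hu1 : u ≤ 1 := Real.exp_le_one_iff.2 (by
    rw [neg_div]; exact neg_nonpos.2 (by positivity))
  have hE : E ≤ u ^ (3 * d) := by
    rw [hu, ← Real.exp_nat_mul]
    apply Real.exp_le_exp.2
    have e1 : ((3 * d : ℕ) : ℝ) * (-(max (‖z‖ - ε) 0) ^ 2 / (8 * d * epsK ε k ^ 2))
        = -(3 * (max (‖z‖ - ε) 0) ^ 2 / (8 * k * ε ^ 2)) := by
      unfold epsK
      rw [mul_pow, Real.sq_sqrt hk0.le]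
      push_cast
      field_simp
    rw [e1]
    have h1 : max (‖z‖ - ε) 0 ≤ ‖z‖ := max_le (by linarith) (norm_nonneg z)
    gcongr
  have hSk : S ≤ 2 * √(k : ℝ) := by
    have := sum_inv_sqrt_pow_anti hd k
    simp only [pow_one] at this
    exact this.trans (sum_inv_sqrt_le k)
  have h2d : (4 : ℝ) ≤ 2 ^ (d + 2) := by
    rw [pow_add]
    have : (1 : ℝ) ≤ 2 ^ d := one_le_pow₀ one_le_two
    linarith
  have hkey : min S (((k : ℝ) + 1) ^ (d + 1) * E) ≤ 2 ^ (d + 2) * (k * u) := by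
    have h1 : ((k : ℝ) + 1) ^ (d + 1) * E ≤ 2 ^ (d + 2) * ((k : ℝ) ^ (d + 1) * u ^ (3 * d)) := by
      have h2 : ((k : ℝ) + 1) ^ (d + 1) ≤ 2 ^ (d + 2) * (k : ℝ) ^ (d + 1) := by
        calc ((k : ℝ) + 1) ^ (d + 1) ≤ (2 * (k : ℝ)) ^ (d + 1) := by gcongr; linarith
          _ = 2 ^ (d + 1) * (k : ℝ) ^ (d + 1) := mul_pow _ _ _
          _ ≤ _ := by
            gcongr
            · exact one_le_two
            · omega
      rw [← mul_assoc]
      gcongr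
    have h3 : S ≤ 2 ^ (d + 2) * √(k : ℝ) := hSk.trans (by
      have := Real.sqrt_nonneg (k : ℝ)
      nlinarith)
    calc _ ≤ min (2 ^ (d + 2) * √(k : ℝ)) (2 ^ (d + 2) * ((k : ℝ) ^ (d + 1) * u ^ (3 * d))) :=
          min_le_min h3 h1
      _ = 2 ^ (d + 2) * min √(k : ℝ) ((k : ℝ) ^ (d + 1) * u ^ (3 * d)) :=
          (mul_min_of_nonneg _ _ (by positivity)).symm
      _ ≤ _ := by
          have := min_sqrt_pow_mul_le hd hk' hu0 hu1
          gcongr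
  have hST : S ≤ 2 ^ (d + 2) * Theta d k := by
    have h1 := sum_le_Theta hd k
    have h0 : 0 ≤ S := Finset.sum_nonneg fun j _ => (inv_sqrt_pow_pos d j).le
    nlinarith
  have hfin : min S (((k : ℝ) + 1) ^ (d + 1) * E) ≤ 2 ^ (d + 2) * phiError ε k z := by
    rw [phiError, mul_min_of_nonneg _ _ (by positivity)]
    exact le_min ((min_le_left _ _).trans hST) hkey
  calc errorScale d ε k ‖z‖ = (ε ^ d)⁻¹ * min S (((k : ℝ) + 1) ^ (d + 1) * E) := rfl
    _ ≤ (ε ^ d)⁻¹ * (2 ^ (d + 2) * phiError ε k z) := by gcongr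
    _ = _ := by ring

end ErrorTerm

/-! ### The graph as a walk on the empirical measure. -/

section EmpiricalMeasure

variable {d n : ℕ} {η : ℝ → ℝ} {ε : ℝ}

/-- The empirical measure of a family of points. -/
def empirical {E : Type*} [MeasurableSpace E] (xs : Fin n → E) : Measure E :=
  (n : ℝ≥0∞)⁻¹ • ∑ i, Measure.dirac (xs i)

instance isProbabilityMeasure_empirical {E : Type*} [MeasurableSpace E] [NeZero n] (xs : Fin n → E) :
    IsProbabilityMeasure (empirical xs) := by
  constructor
  simp only [empirical, Measure.smul_apply, Measure.finsetSum_apply, smul_eq_mul, measure_univ]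
  simp only [Finset.sum_const, Finset.card_univ, Fintype.card_fin, nsmul_eq_mul, mul_one]
  exact ENNReal.inv_mul_cancel (by exact_mod_cast NeZero.ne n) (ENNReal.natCast_ne_top n)

theorem integral_empirical {E : Type*} [MeasurableSpace E] [MeasurableSingletonClass E]
    (xs : Fin n → E) (f : E → ℝ) : ∫ y, f y ∂empirical xs = (n : ℝ)⁻¹ * ∑ i, f (xs i) := by
  rw [empirical, integral_smul_measure, integral_finsetSum_measure fun i _ => integrable_dirac (by simp)]
  simp

theorem ae_mem_range_empirical {E : Type*} [MeasurableSpace E] [MeasurableSingletonClass E]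
    (xs : Fin n → E) : ∀ᵐ y ∂empirical xs, y ∈ Set.range xs := by
  have hm : MeasurableSet (Set.range xs)ᶜ := (Set.finite_range xs).measurableSet.compl
  rw [ae_iff]
  change empirical xs (Set.range xs)ᶜ = 0
  simp [empirical, Measure.finsetSum_apply, Measure.dirac_apply' _ hm]

theorem kernelDeg_empirical (xs : Fin n → Pt d) (x : Pt d) :
    kernelDeg (empirical xs) (etaAt η ε) x = (n : ℝ)⁻¹ * degree η ε xs x :=
  integral_empirical xs _

/-- The graph heat kernel in terms of the walk on the empirical measure. -/
theorem heatKernel_eq_adjWalk [NeZero n] (xs : Fin n → Pt d) (x : Pt d) (k : ℕ) (i : Fin n) :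
    heatKernel η ε xs x (k + 1) i = (kernelDeg (empirical xs) (etaAt η ε) x)⁻¹
      * (adjWalk (empirical xs) (etaAt η ε))^[k] (etaAt η ε x) (xs i) := by
  have hn' : (n : ℝ) ≠ 0 := by exact_mod_cast NeZero.ne n
  induction k generalizing i with
  | zero =>
    rw [kernelDeg_empirical, Function.iterate_zero, id, mul_inv, inv_inv]
    simp only [heatKernel, etaAt, norm_sub_rev]
    ring
  | succ k ih =>
    have e : heatKernel η ε xs x (k + 1 + 1) i
        = ∑ j, etaAt η ε (xs i) (xs j) / degree η ε xs (xs j) * heatKernel η ε xs x (k + 1) j := by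
      simp only [heatKernel, adjRWLaplacian, Pi.sub_apply]
      ring
    rw [e, Function.iterate_succ_apply', adjWalk, integral_empirical, Finset.mul_sum, Finset.mul_sum]
    refine Finset.sum_congr rfl fun j _ => ?_
    rw [ih j, kernelDeg_empirical, kernelDeg_empirical, mul_inv, mul_inv, inv_inv]
    field_simp

end EmpiricalMeasure

/-! ### The averaging operator as an adjoint walk. -/

section Averaging

variable {d : ℕ} {η : ℝ → ℝ} {ε : ℝ}

theorem rhoHat_eq_kernelDeg {Ω : Set (Pt d)} {ρmin ρmax : ℝ} {ρ : Pt d → ℝ} (hΩ : MeasurableSet Ω)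
    (hρmin : 0 < ρmin) (hρ : IsDensityBetween Ω ρmin ρmax ρ)
    (hm : AEMeasurable ρ (volume.restrict Ω)) (x : Pt d) :
    rhoHat Ω η ρ ε x = kernelDeg (densityLaw Ω ρ) (etaAt η ε) x := by
  rw [kernelDeg, integral_densityLaw hΩ hρmin hρ hm, rhoHat]
  congr 1; ext y; ring

theorem averaging_eq_adjWalk {Ω : Set (Pt d)} {ρmin ρmax : ℝ} {ρ : Pt d → ℝ} (hΩ : MeasurableSet Ω)
    (hρmin : 0 < ρmin) (hρ : IsDensityBetween Ω ρmin ρmax ρ)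
    (hm : AEMeasurable ρ (volume.restrict Ω)) :
    averaging Ω η ρ ε = adjWalk (densityLaw Ω ρ) (etaAt η ε) := by
  ext φ x
  rw [adjWalk, integral_densityLaw hΩ hρmin hρ hm, averaging]
  congr 1; ext y
  rw [rhoHat_eq_kernelDeg hΩ hρmin hρ hm]; ring

theorem IsC1Holder.aemeasurable {Ω : Set (Pt d)} {α : ℝ≥0} {ρ : Pt d → ℝ} (h : IsC1Holder Ω α ρ)
    (hΩ : IsOpen Ω) : AEMeasurable ρ (volume.restrict Ω) :=
  ContinuousOn.aemeasurable (fun x hx => (h.1 x hx).continuousAt.continuousWithinAt)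
    hΩ.measurableSet

end Averaging

/-! ### Empirical means with summands depending on sample points. -/

section Deviation

variable {S : Type*} [MeasurableSpace S] {P : Measure S} [IsProbabilityMeasure P]
  {E : Type*} [MeasurableSpace E] {μ : Measure E} [IsProbabilityMeasure μ]

/-- Deviation of an empirical mean from its expectation, for a summand depending on at most two of
the sample points. -/
theorem measureReal_abs_average_sub_gt_le {n : ℕ} {X : Fin n → S → E} (hX : ∀ i, Measurable (X i))
    (hind : iIndepFun X P) (hlaw : ∀ i, P.map (X i) = μ) {T : Finset (Fin n)} (hT : T.card ≤ 2)
    {F : Type*} [MeasurableSpace F] {ψ : (T → E) → F} (hψ : Measurable ψ) {G : F → E → ℝ}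
    (hG : Measurable (Function.uncurry G)) {F₀ : Set F} (hF₀ : MeasurableSet F₀) {Ω : Set E}
    (hΩ : ∀ᵐ y ∂μ, y ∈ Ω) {B V τ e lam : ℝ} (hB0 : 0 < B) (hV0 : 0 < V) (hτ : 0 < τ)
    (he : 0 < e) (hlam : 0 < lam) (hlam1 : lam ≤ 1)
    (hB : ∀ z ∈ F₀, ∀ y ∈ Ω, |G z y| ≤ B * e⁻¹) (hV : ∀ z ∈ F₀, ∫ y, G z y ^ 2 ∂μ ≤ V * e⁻¹)
    (hself : 4 * (B * e⁻¹) ≤ n * (τ * lam)) :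
    P.real {ω | (∀ i, X i ω ∈ Ω) ∧ ψ (fun i => X i ω) ∈ F₀ ∧
        2 * (τ * lam) < |(n : ℝ)⁻¹ * ∑ j, G (ψ fun i => X i ω) (X j ω)
          - ∫ y, G (ψ fun i => X i ω) y ∂μ|}
      ≤ 2 * Real.exp (-(min (1 / (2 * B)) (τ / (2 * V)) * (τ / 2) * n * e * lam ^ 2)) := by
  have hn : (0 : ℝ) < n := by
    have h1 : 0 < n * (τ * lam) := lt_of_lt_of_le (by positivity) hself
    exact pos_of_mul_pos_left h1 (by positivity)
  have hdev := measureReal_deviation_le hX hind hlaw T hψ hG hF₀ hB0 hV0 hτ he hlam hlam1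
    (fun z hz => hΩ.mono fun y hy => hB z hz y hy) hV
  rw [Fintype.card_fin] at hdev
  refine (measureReal_mono ?_).trans hdev
  rintro ω ⟨hωΩ, hωF, hω⟩
  refine ⟨hωF, ?_⟩
  set z := ψ fun i => X i ω
  set I := ∫ y, G z y ∂μ
  have hI : |I| ≤ B * e⁻¹ := by
    have := norm_integral_le_of_norm_le_const (μ := μ) (f := G z) (C := B * e⁻¹)
      (hΩ.mono fun y hy => hB z hωF y hy)
    simpa using this
  have e1 : (n : ℝ)⁻¹ * ∑ j, G z (X j ω) - I
      = (n : ℝ)⁻¹ * (∑ j ∈ T, (G z (X j ω) - I) + ∑ j ∈ Tᶜ, (G z (X j ω) - I)) := by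
    rw [Finset.sum_add_sum_compl, Finset.sum_sub_distrib]
    simp only [Finset.sum_const, Finset.card_univ, Fintype.card_fin, nsmul_eq_mul]
    field_simp
  -- The at most two points on which the summand depends escape Bernstein; they are bounded
  -- trivially and `hself` absorbs them, whence the factor `2` in the deviation.
  have hTsum : |∑ j ∈ T, (G z (X j ω) - I)| ≤ 4 * (B * e⁻¹) := by
    refine (Finset.abs_sum_le_sum_abs _ _).trans ?_
    have h1 : ∀ j ∈ T, |G z (X j ω) - I| ≤ 2 * (B * e⁻¹) := fun j _ => by
      have h2 := hB z hωF (X j ω) (hωΩ j)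
      have h3 := abs_sub (G z (X j ω)) I
      linarith
    have h4 := Finset.sum_le_card_nsmul _ _ _ h1
    rw [nsmul_eq_mul] at h4
    have h5 : (T.card : ℝ) ≤ 2 := by exact_mod_cast hT
    have h6 : 0 ≤ B * e⁻¹ := by positivity
    nlinarith
  rw [e1, abs_mul, abs_of_pos (inv_pos.2 hn), lt_inv_mul_iff₀ hn] at hω
  have h7 := abs_add_le (∑ j ∈ T, (G z (X j ω) - I)) (∑ j ∈ Tᶜ, (G z (X j ω) - I))
  change n * (τ * lam) ≤ _
  linarith

end Deviation

/-! ### Test functions for the heat kernel. -/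

section Domain

variable {d : ℕ} {μ : Measure (Pt d)} [IsProbabilityMeasure μ] {Ω : Set (Pt d)}
  {w : Pt d → Pt d → ℝ} {ε Λ κ δ c C : ℝ}

/-- Provides measurability of the condition on a random centre `x`. -/
theorem isClosed_setOf_ball_subset {E : Type*} [PseudoMetricSpace E] (Ω : Set E) (R : ℝ) :
    IsClosed {x | Metric.ball x R ⊆ Ω} := by
  rw [← isOpen_compl_iff]
  have : {x | Metric.ball x R ⊆ Ω}ᶜ = ⋃ y ∈ Ωᶜ, Metric.ball y R := by
    ext x
    simp only [Set.mem_compl_iff, Set.mem_ofPred_eq, Set.not_subset, Set.mem_iUnion, Metric.mem_ball,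
      exists_prop]
    exact ⟨fun ⟨y, hy, hy'⟩ => ⟨y, hy', by rwa [dist_comm]⟩,
      fun ⟨y, hy, hy'⟩ => ⟨y, by rwa [dist_comm], hy⟩⟩
  rw [this]
  exact isOpen_biUnion fun y _ => Metric.isOpen_ball

theorem heat_le_mul_tailScale (hw : IsScaledKernel w ε Λ κ δ) (hc : 0 < c) (hΛ : 0 < Λ)
    (hdeg : ∀ x ∈ Ω, c ≤ kernelDeg μ w x) (hC : ∀ x, kernelDeg μ w x ≤ C)
    (hae : ∀ᵐ y ∂μ, y ∈ Ω) {K : ℝ} (hK : 0 < K) {x : Pt d} {j : ℕ}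
    (hheat : ∀ z ∈ Ω, (hw.heat μ hc j x : Pt d → ℝ) z ≤ K * (ε ^ d)⁻¹ * (√((j : ℝ) + 1) ^ d)⁻¹)
    (z : Pt d) {y : Pt d} (hy : y ∈ Ω) (hzy : dist z y ≤ ε) :
    (hw.heat μ hc j x : Pt d → ℝ) y
      ≤ (K + 2 * Λ * C / c ^ 2 * Real.exp (27 / 2)) * tailScale d ε j (dist x z) := by
  have hε := hw.eps_pos
  have hC0 : 0 < C := hc.trans_le ((hdeg y hy).trans (hC y))
  have h2 := hw.heat_le_gaussian hc hε hw.range hw.le (hae.mono hdeg) j (hC x) (hC y) (hdeg y hy)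
  refine le_tailScale (s := dist x y - 2 * ε) hε hK.le (by positivity) (hheat y hy) (h2.trans_eq ?_)
    dist_nonneg ?_
  · ring
  · have := dist_triangle x y z
    rw [dist_comm y z] at this
    linarith

/-- The kernel of the heat-kernel deviations. -/
def heatTest (hw : IsScaledKernel w ε Λ κ δ) (μ : Measure (Pt d)) [IsProbabilityMeasure μ]
    (hc : 0 < c) (j : ℕ) (p : Pt d × Pt d) (y : Pt d) : ℝ :=
  (tailScale d ε j (dist p.1 p.2))⁻¹ * (w p.2 y * (hw.heat μ hc j p.1 : Pt d → ℝ) y)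

theorem measurable_heatTest (hw : IsScaledKernel w ε Λ κ δ) (hc : 0 < c) (j : ℕ) :
    Measurable (Function.uncurry (heatTest hw μ hc j)) := by
  have h1 : Measurable fun q : (Pt d × Pt d) × Pt d => (tailScale d ε j (dist q.1.1 q.1.2))⁻¹ :=
    ((continuous_tailScale j).measurable.comp
      ((measurable_fst.comp measurable_fst).dist (measurable_snd.comp measurable_fst))).inv
  have h2 : Measurable fun q : (Pt d × Pt d) × Pt d => w q.1.2 q.2 :=
    hw.meas.comp ((measurable_snd.comp measurable_fst).prodMk measurable_snd)
  have h3 : Measurable fun q : (Pt d × Pt d) × Pt d => (hw.heat μ hc j q.1.1 : Pt d → ℝ) q.2 :=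
    (hw.measurable_heat hc j).comp ((measurable_fst.comp measurable_fst).prodMk measurable_snd)
  exact h1.mul (h2.mul h3)

/-- Divided by `tailScale`, the test function is no larger than a multiple of `w`. One deviation of
size `lam` then gives the full spatial and temporal decay. -/
theorem abs_heatTest_le (hw : IsScaledKernel w ε Λ κ δ) (hc : 0 < c) {K : ℝ} {j : ℕ}
    {p : Pt d × Pt d} {y : Pt d} (h : dist p.2 y ≤ ε → (hw.heat μ hc j p.1 : Pt d → ℝ) y
      ≤ K * tailScale d ε j (dist p.1 p.2)) : |heatTest hw μ hc j p y| ≤ K * w p.2 y := by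
  have hb := tailScale_pos (d := d) hw.eps_pos j (dist p.1 p.2)
  have h0 := hw.heat_nonneg (ν := μ) hc j p.1 y
  have hw0 := hw.nonneg p.2 y
  by_cases hy : ε < dist p.2 y
  · rw [heatTest, hw.range _ _ hy]; simp
  · rw [heatTest, abs_of_nonneg (by positivity), inv_mul_le_iff₀ hb]
    have := mul_le_mul_of_nonneg_left (h (not_lt.1 hy)) hw0
    linarith

/-- The second moment is at most supremum times mean, hence of order `ε ^ (-d)` rather than `ε ^ (-2
d)`; this gives the exponent `n ε ^ d lam ^ 2`. -/
theorem integral_sq_le_of_abs_le (hw : IsScaledKernel w ε Λ κ δ)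
    (hC : ∀ x, kernelDeg μ w x ≤ C) (hae : ∀ᵐ y ∂μ, y ∈ Ω) (hΛ : 0 ≤ Λ) {g : Pt d → ℝ}
    {K : ℝ} (z : Pt d)
    (h : ∀ y ∈ Ω, |g y| ≤ K * w z y) : ∫ y, g y ^ 2 ∂μ ≤ K ^ 2 * Λ * C * (ε ^ d)⁻¹ := by
  have hε := hw.eps_pos
  have hpt : ∀ᵐ y ∂μ, g y ^ 2 ≤ K ^ 2 * (Λ * (ε ^ d)⁻¹) * w z y := hae.mono fun y hy => by
    have h0 := hw.nonneg z y
    calc g y ^ 2 = |g y| ^ 2 := (sq_abs _).symm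
      _ ≤ (K * w z y) ^ 2 := by
        gcongr
        exact h y hy
      _ = K ^ 2 * w z y * w z y := by ring
      _ ≤ K ^ 2 * (Λ * (ε ^ d)⁻¹) * w z y := by
        gcongr
        exact hw.le z y
  calc _ ≤ ∫ y, K ^ 2 * (Λ * (ε ^ d)⁻¹) * w z y ∂μ := by
        refine integral_mono_of_nonneg (ae_of_all _ fun y => sq_nonneg (g y))
          ((hw.integrable_left z).const_mul _) hpt
    _ = K ^ 2 * (Λ * (ε ^ d)⁻¹) * kernelDeg μ w z := by rw [integral_const_mul, kernelDeg]
    _ ≤ K ^ 2 * (Λ * (ε ^ d)⁻¹) * C := by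
        gcongr
        exact hC z
    _ = _ := by ring

end Domain

/-! ### Deviations at random parameters. -/

section RandomGraph

variable {S : Type*} [MeasurableSpace S] {P : Measure S} [IsProbabilityMeasure P]

/-- `Z` is a measurable function of at most two of the sample points `X i`. -/
def IsTwoPointStatistic {n : ℕ} {E F : Type*} [MeasurableSpace E] [MeasurableSpace F]
    (X : Fin n → S → E) (Z : S → F) : Prop :=
  ∃ T : Finset (Fin n), T.card ≤ 2 ∧ ∃ ψ : (T → E) → F, Measurable ψ ∧
    ∀ ω, Z ω = ψ fun i => X i ω

variable {n : ℕ} {E : Type*} [MeasurableSpace E] {X : Fin n → S → E}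

omit [MeasurableSpace S] in
theorem isTwoPointStatistic_elim (x₀ : E) (o : Option (Fin n)) :
    IsTwoPointStatistic X fun ω => o.elim x₀ fun l => X l ω := by
  cases o with
  | none => exact ⟨∅, by simp, fun _ => x₀, measurable_const, fun _ => rfl⟩
  | some l =>
    exact ⟨{l}, by simp, fun t => t ⟨l, Finset.mem_singleton_self l⟩, measurable_pi_apply _,
      fun _ => rfl⟩

omit [MeasurableSpace S] in
theorem isTwoPointStatistic_elim_pair (x₀ : E) (o : Option (Fin n)) (i : Fin n) :
    IsTwoPointStatistic X fun ω => (o.elim x₀ fun l => X l ω, X i ω) := by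
  cases o with
  | none =>
    exact ⟨{i}, by simp, fun t => (x₀, t ⟨i, Finset.mem_singleton_self i⟩),
      measurable_const.prodMk (measurable_pi_apply _), fun _ => rfl⟩
  | some l =>
    exact ⟨{l, i}, Finset.card_le_two, fun t => (t ⟨l, by simp⟩, t ⟨i, by simp⟩),
      (measurable_pi_apply _).prodMk (measurable_pi_apply _), fun _ => rfl⟩

theorem IsTwoPointStatistic.measureReal_gt_le {μ : Measure E} [IsProbabilityMeasure μ]
    {F : Type*} [MeasurableSpace F] {Z : S → F} (hZ : IsTwoPointStatistic X Z)
    (hX : ∀ i, Measurable (X i)) (hind : iIndepFun X P) (hlaw : ∀ i, P.map (X i) = μ)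
    {G : F → E → ℝ} (hG : Measurable (Function.uncurry G)) {F₀ : Set F} (hF₀ : MeasurableSet F₀)
    {Ω : Set E} (hΩ : ∀ᵐ y ∂μ, y ∈ Ω) {B V τ e lam r : ℝ} (hB0 : 0 < B) (hV0 : 0 < V) (hτ : 0 < τ)
    (he : 0 < e) (hlam : 0 < lam) (hlam1 : lam ≤ 1)
    (hB : ∀ z ∈ F₀, ∀ y ∈ Ω, |G z y| ≤ B * e⁻¹) (hV : ∀ z ∈ F₀, ∫ y, G z y ^ 2 ∂μ ≤ V * e⁻¹)
    (hr1 : r ≤ min (1 / (2 * B)) (τ / (2 * V)) * (τ / 2)) (hr2 : 4 * B * r ≤ τ)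
    (hr3 : 1 ≤ r * n * e * lam ^ 2) :
    P.real {ω | (∀ i, X i ω ∈ Ω) ∧ Z ω ∈ F₀ ∧
        2 * (τ * lam) < |(n : ℝ)⁻¹ * ∑ j, G (Z ω) (X j ω) - ∫ y, G (Z ω) y ∂μ|}
      ≤ 2 * Real.exp (-(r * n * e * lam ^ 2)) := by
  obtain ⟨T, hT, ψ, hψ, hZψ⟩ := hZ
  -- `hr3` says that the exponent is at least `1`, which makes the contribution of the dependent
  -- points negligible.
  have hself : 4 * (B * e⁻¹) ≤ n * (τ * lam) := by
    rw [← mul_assoc, ← div_eq_mul_inv, div_le_iff₀ he]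
    have hnn : (0 : ℝ) ≤ n * e * lam := by positivity
    calc 4 * B = 4 * B * 1 := (mul_one _).symm
      _ ≤ 4 * B * (r * n * e * lam ^ 2) := by gcongr
      _ = 4 * B * r * (n * e * lam) * lam := by ring
      _ ≤ τ * (n * e * lam) * 1 := by gcongr
      _ = _ := by ring
  have h := measureReal_abs_average_sub_gt_le hX hind hlaw hT hψ hG hF₀ hΩ hB0 hV0 hτ he hlam hlam1
    hB hV hself
  simp only [hZψ]
  refine h.trans ?_
  gcongr

end RandomGraph

/-! ### The good event. -/

section Event

variable {S : Type*} [MeasurableSpace S] {P : Measure S} [IsProbabilityMeasure P] {n d : ℕ}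
  {X : Fin n → S → Pt d} {μ : Measure (Pt d)} [IsProbabilityMeasure μ] {Ω : Set (Pt d)}
  {w : Pt d → Pt d → ℝ} {ε Λ κ δ c C : ℝ}

/-- With high probability the empirical measure is a perturbation of the sampling distribution. -/
theorem exists_event_isPerturbation [NeZero n] (hw : IsScaledKernel w ε Λ κ δ) (hc : 0 < c)
    (hX : ∀ i, Measurable (X i)) (hind : iIndepFun X P) (hlaw : ∀ i, P.map (X i) = μ)
    (hΩ : MeasurableSet Ω) (hae : ∀ᵐ y ∂μ, y ∈ Ω) (hdeg : ∀ x ∈ Ω, c ≤ kernelDeg μ w x)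
    (hC : ∀ x, kernelDeg μ w x ≤ C) (hΛ : 0 < Λ) (hC0 : 0 < C) {K : ℝ} (hK : 0 < K) {x₀ : Pt d}
    (hx₀ : x₀ ∈ Ω) {R : ℝ} {m : ℕ} (hm : 2 ≤ m)
    (hheat : ∀ x, Metric.ball x R ⊆ Ω → ∀ j, j + 1 ≤ m → ∀ z, ∀ y ∈ Ω, dist z y ≤ ε →
      (hw.heat μ hc j x : Pt d → ℝ) y ≤ K * tailScale d ε j (dist x z))
    {lam r : ℝ} (hlam : 0 < lam) (hlam1 : lam ≤ 1)
    (hr1 : r ≤ min (1 / (2 * Λ)) (c / 4 / (2 * (Λ * C))) * (c / 4 / 2)) (hr2 : 4 * Λ * r ≤ c / 4)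
    (hr3 : r ≤ min (1 / (2 * (K * Λ))) (1 / 2 / (2 * (K ^ 2 * Λ * C))) * (1 / 2 / 2))
    (hr4 : 4 * (K * Λ) * r ≤ 1 / 2) (hr5 : 1 ≤ r * n * ε ^ d * lam ^ 2) :
    ∃ A : Set S, MeasurableSet A ∧
      1 - 12 * m * n ^ 2 * Real.exp (-(r * n * ε ^ d * lam ^ 2)) ≤ P.real A ∧
      ∀ ω ∈ A, (∀ i, X i ω ∈ Ω) ∧ ∀ x ∈ Set.range (fun i => X i ω) ∪ {x₀}, Metric.ball x R ⊆ Ω →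
        IsPerturbation hw hc μ (empirical fun i => X i ω) Ω (Set.range fun i => X i ω) x C K lam m := by
  have hε := hw.eps_pos
  have hεd : 0 < ε ^ d := by positivity
  set q := Real.exp (-(r * n * ε ^ d * lam ^ 2))
  -- The `n + 1` possible centres: `none` stands for `x₀`, `some l` for a node.
  set pos : Option (Fin n) → S → Pt d := fun o ω => o.elim x₀ fun l => X l ω
  set bad0 : Fin n → Set S := fun i => {ω | X i ω ∉ Ω}
  set badD : Option (Fin n) → Set S := fun o => {ω | (∀ i, X i ω ∈ Ω) ∧ pos o ω ∈ Set.univ ∧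
    2 * (c / 4 * lam) < |(n : ℝ)⁻¹ * ∑ j, w (pos o ω) (X j ω) - ∫ y, w (pos o ω) y ∂μ|}
  -- Heat kernel bounds hold only for interior centres; for a random centre this becomes part of the
  -- event.
  set F₀ : Set (Pt d × Pt d) := {p | Metric.ball p.1 R ⊆ Ω ∧ p.2 ∈ Ω}
  set badM : Option (Fin n) × Fin n × Fin (m - 1) → Set S := fun a =>
    {ω | (∀ i, X i ω ∈ Ω) ∧ (pos a.1 ω, X a.2.1 ω) ∈ F₀ ∧
      2 * (1 / 2 * lam) < |(n : ℝ)⁻¹ * ∑ j, heatTest hw μ hc a.2.2 (pos a.1 ω, X a.2.1 ω) (X j ω)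
        - ∫ y, heatTest hw μ hc a.2.2 (pos a.1 ω, X a.2.1 ω) y ∂μ|}
  have hP0 : ∀ i, P.real (bad0 i) ≤ 0 := by
    intro i
    have h1 : ∀ᵐ y ∂(P.map (X i)), y ∈ Ω := by rw [hlaw i]; exact hae
    have h2 : ∀ᵐ ω ∂P, X i ω ∈ Ω := ae_of_ae_map (hX i).aemeasurable h1
    rw [measureReal_def, show P (bad0 i) = 0 from ae_iff.1 h2]; simp
  have hPD : ∀ o, P.real (badD o) ≤ 2 * q := by
    intro o
    have hb : ∀ z : Pt d, ∀ y ∈ Ω, |w z y| ≤ 1 * w z y := fun z y _ => by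
      rw [abs_of_nonneg (hw.nonneg z y), one_mul]
    refine (isTwoPointStatistic_elim x₀ o).measureReal_gt_le hX hind hlaw hw.meas MeasurableSet.univ
      hae hΛ (mul_pos hΛ hC0) (by positivity) hεd hlam hlam1 (fun z _ y _ => ?_) (fun z _ => ?_)
      hr1 hr2 hr5
    · rw [abs_of_nonneg (hw.nonneg z y)]; exact hw.le z y
    · have := integral_sq_le_of_abs_le hw hC hae hΛ.le z (hb z)
      rwa [one_pow, one_mul] at this
  have hF₀ : MeasurableSet F₀ :=
    ((isClosed_setOf_ball_subset Ω R).measurableSet.preimage measurable_fst).inter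
      (hΩ.preimage measurable_snd)
  have hPM : ∀ a, P.real (badM a) ≤ 2 * q := by
    intro a
    have hb : ∀ p ∈ F₀, ∀ y ∈ Ω, |heatTest hw μ hc a.2.2 p y| ≤ K * w p.2 y := fun p hp y hy =>
      abs_heatTest_le hw hc fun hd' => hheat p.1 hp.1 a.2.2 (by have := a.2.2.2; omega) p.2 y hy hd'
    refine (isTwoPointStatistic_elim_pair x₀ a.1 a.2.1).measureReal_gt_le hX hind hlaw
      (measurable_heatTest hw hc a.2.2) hF₀ hae (mul_pos hK hΛ) (by positivity) (by positivity) hεd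
      hlam hlam1 (fun p hp y hy => ?_) (fun p hp => ?_) hr3 hr4 hr5
    · refine (hb p hp y hy).trans ?_
      rw [mul_assoc]
      exact mul_le_mul_of_nonneg_left (hw.le _ _) hK.le
    · exact integral_sq_le_of_abs_le hw hC hae hΛ.le p.2 (hb p hp)
  set bad := (⋃ i, bad0 i) ∪ ((⋃ o, badD o) ∪ ⋃ a, badM a)
  have hq : 0 < q := Real.exp_pos _
  have hn1 : (1 : ℝ) ≤ n := by exact_mod_cast Nat.one_le_iff_ne_zero.2 (NeZero.ne n)
  have hm1 : (2 : ℝ) ≤ m := by exact_mod_cast hm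
  have hbad : P.real bad ≤ 12 * m * n ^ 2 * q := by
    have h0 : P.real (⋃ i, bad0 i) ≤ 0 :=
      (measureReal_iUnion_fintype_le bad0).trans (Finset.sum_nonpos fun i _ => hP0 i)
    have h1 : P.real (⋃ o, badD o) ≤ (n + 1) * (2 * q) := by
      refine (measureReal_iUnion_fintype_le badD).trans
        ((Finset.sum_le_card_nsmul _ _ _ fun o _ => hPD o).trans_eq ?_)
      simp
    have h2 : P.real (⋃ a, badM a) ≤ (n + 1) * (n * (m - 1)) * (2 * q) := by
      refine (measureReal_iUnion_fintype_le badM).trans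
        ((Finset.sum_le_card_nsmul _ _ _ fun o _ => hPM o).trans_eq ?_)
      rw [Finset.card_univ, Fintype.card_prod, Fintype.card_prod, Fintype.card_option,
        Fintype.card_fin, Fintype.card_fin, nsmul_eq_mul]
      push_cast [Nat.cast_sub (by omega : 1 ≤ m)]
      ring
    have h3 : P.real bad ≤ (n + 1) * (2 * q) + (n + 1) * (n * (m - 1)) * (2 * q) := by
      have h4 := measureReal_union_le (μ := P) (⋃ i, bad0 i) ((⋃ o, badD o) ∪ ⋃ a, badM a)
      have h5 := measureReal_union_le (μ := P) (⋃ o, badD o) (⋃ a, badM a)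
      linarith
    refine h3.trans ?_
    -- There are `n + 1` degree tests and `(n + 1) n (m - 1)` heat tests, each failing with
    -- probability at most `2 q`.
    have h6 : ((n : ℝ) + 1) * 2 + (n + 1) * (n * (m - 1)) * 2 ≤ 12 * m * n ^ 2 := by
      nlinarith [mul_le_mul hn1 hn1 zero_le_one (by linarith : (0 : ℝ) ≤ n),
        mul_nonneg (by linarith : (0 : ℝ) ≤ n) (by linarith : (0 : ℝ) ≤ (m : ℝ) - 1),
        mul_nonneg (mul_nonneg (by linarith : (0 : ℝ) ≤ n) (by linarith : (0 : ℝ) ≤ (n : ℝ) - 1))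
          (by linarith : (0 : ℝ) ≤ (m : ℝ) - 1),
        mul_nonneg (by linarith : (0 : ℝ) ≤ (n : ℝ) - 1) (by linarith : (0 : ℝ) ≤ n)]
    nlinarith
  -- A measurable hull of the same measure spares proving that `bad` is measurable.
  refine ⟨(toMeasurable P bad)ᶜ, (measurableSet_toMeasurable P bad).compl, ?_, ?_⟩
  · rw [probReal_compl_eq_one_sub (measurableSet_toMeasurable P bad), measureReal_def,
      measure_toMeasurable, ← measureReal_def]
    linarith
  intro ω hω
  have hω' : ω ∉ bad := fun h => hω (subset_toMeasurable P bad h)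
  simp only [bad, Set.mem_union, Set.mem_iUnion, not_or, not_exists] at hω'
  obtain ⟨hω0, hωD, hωM⟩ := hω'
  have hXΩ : ∀ i, X i ω ∈ Ω := fun i => by simpa [bad0] using hω0 i
  have hdegsub : ∀ o, |kernelDeg (empirical fun i => X i ω) w (pos o ω) - kernelDeg μ w (pos o ω)|
      ≤ c / 2 * lam := by
    intro o
    by_contra! hlt
    refine hωD o ⟨hXΩ, Set.mem_univ _, ?_⟩
    have e1 : 2 * (c / 4 * lam) = c / 2 * lam := by ring
    rw [e1, ← integral_empirical (fun j => X j ω)]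
    exact hlt
  refine ⟨hXΩ, fun x hx hball => ?_⟩
  obtain ⟨o, rfl⟩ : ∃ o, pos o ω = x := by
    rcases hx with ⟨i, rfl⟩ | rfl
    · exact ⟨some i, rfl⟩
    · exact ⟨none, rfl⟩
  refine ⟨hae, ae_mem_range_empirical _, ?_, ?_, hdeg, hC, hlam, hlam1, hK.le, ?_, ?_, ?_⟩
  · rintro _ ⟨i, rfl⟩
    exact hXΩ i
  · cases o with
    | none => exact hx₀
    | some i => exact hXΩ i
  · rintro y (rfl | ⟨i, rfl⟩)
    · exact hdegsub o
    · exact hdegsub (some i)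
  · exact fun j hj z _ y hy hzy => hheat _ hball j hj z y hy hzy
  · rintro j hj _ ⟨i, rfl⟩
    have hb := tailScale_pos (d := d) hε j (dist (pos o ω) (X i ω))
    set b := tailScale d ε j (dist (pos o ω) (X i ω)) with hbdef
    have h1 : |(n : ℝ)⁻¹ * ∑ l, heatTest hw μ hc j (pos o ω, X i ω) (X l ω)
        - ∫ y, heatTest hw μ hc j (pos o ω, X i ω) y ∂μ| ≤ lam := by
      by_contra! hlt
      refine hωM (o, i, ⟨j, by omega⟩) ⟨hXΩ, ⟨hball, hXΩ i⟩, ?_⟩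
      have e1 : 2 * (1 / 2 * lam) = lam := by ring
      rw [e1]
      exact hlt
    rw [← integral_empirical (fun l => X l ω)] at h1
    simp only [heatTest, ← hbdef] at h1
    rw [integral_const_mul, integral_const_mul, ← mul_sub, abs_mul, abs_of_pos (inv_pos.2 hb),
      inv_mul_le_iff₀ hb] at h1
    rw [mul_comm lam b]
    exact h1

end Event

end PoissonLearning

end

/-! ### Assembly of the theorem. -/

theorem theorem4p14 (d : ℕ) (hd : 1 ≤ d)
    (Ω : Set (Pt d)) (hΩ : IsLipschitzDomain Ω)
    (η : ℝ → ℝ) (hη : IsKernelProfile d η)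
    (ρmin ρmax : ℝ) (hρmin : 0 < ρmin) :
    -- `c` is the constant in `m ε^{1+α} ≪ 1`, `K` the one in the big-O, `C` the one in the probability
    ∃ c C K : ℝ, 0 < c ∧ c < 1 ∧ 0 < C ∧ 0 < K ∧
      ∀ (ρ : Pt d → ℝ) (α : ℝ≥0), IsDensityBetween Ω ρmin ρmax ρ → 0 < α → α ≤ 1 →
        IsC1Holder Ω α ρ →
      ∀ (n : ℕ) (ε : ℝ), 2 ≤ n → 0 < ε → ε ≤ 1 → 1 ≤ n * ε ^ d →
      ∀ (x₀ : Pt d) (m : ℕ) (R lam : ℝ), x₀ ∈ Ω → 2 ≤ m → radiusK d ε m ≤ R →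
        m * ε ^ (1 + (α : ℝ)) ≤ c → 0 < lam → lam ≤ 1 →
      ∀ (S : Type u) [MeasurableSpace S] (P : Measure S) [IsProbabilityMeasure P]
        (X : Fin n → S → Pt d), (∀ i, Measurable (X i)) → iIndepFun X P →
        (∀ i, P.map (X i) = densityLaw Ω ρ) →
      ∃ A : Set S, MeasurableSet A ∧
        1 - 12 * m * n ^ 2 * Real.exp (-(C * n * ε ^ d * lam ^ 2)) ≤ P.real A ∧
        ∀ ω ∈ A, ∀ x ∈ Set.range (fun i => X i ω) ∪ {x₀}, Metric.ball x R ⊆ Ω →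
          ∀ (i : Fin n) (k : ℕ), 2 ≤ k → k ≤ m →
            |heatKernel η ε (fun j => X j ω) x k i
                - (rhoHat Ω η ρ ε x)⁻¹ * (averaging Ω η ρ ε)^[k - 1] (etaAt η ε x) (X i ω)|
              ≤ K * (lam * (ε ^ d)⁻¹ * phiError ε k (x - X i ω)
                  + lam * epsK ε k ^ 2 * Real.exp (-R ^ 2 / (4 * d * epsK ε k ^ 2))) := by
  -- For `ρmax ≤ 0` no density can satisfy the bounds at `x₀`, so any constants do.
  by_cases hρmax : 0 < ρmax
  swap
  · refine ⟨1 / 2, 1, 1, by norm_num, by norm_num, one_pos, one_pos, ?_⟩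
    intro ρ α hρ _ _ _ n ε _ _ _ _ x₀ m R lam hx₀
    exact absurd (hρmin.trans_le ((hρ.lower x₀ hx₀).trans (hρ.upper x₀ hx₀))) hρmax
  obtain ⟨θ, hθ0, hθ1, hcork⟩ := hΩ.exists_corkscrew
  obtain ⟨δ, hδ0, hδ1, hδ⟩ := hη.exists_half
  have hη0 := hη.pos_zero
  set V := volume.real (Metric.ball (0 : Pt d) 1)
  have hV : 0 < V := volume_real_ball_pos
  set Λ := η 0
  set κ := η 0 / 2
  have hκ : 0 < κ := half_pos hη0
  set c := κ * (ρmin * ((θ * δ) ^ d * V))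
  have hc : 0 < c := by positivity
  set C := Λ * (ρmax * V)
  have hC0 : 0 < C := by positivity
  obtain ⟨K₁, hK₁, hdiag⟩ := exists_heat_le hd hρmin hρmax hκ hδ0 hc hC0 hη0
  set K := K₁ + 2 * Λ * C / c ^ 2 * Real.exp (27 / 2)
  have hK : 0 < K := by positivity
  set Q := 2 / c * ((1 + K * (C + c / 2)) * (2 / c * (C + c / 2) + (1 + 2 * Λ * (C + c / 2) / (c / 2) ^ 2
        * Real.exp 6 * ((C + c / 2) / κ * (2 / δ) ^ d)))) + C * K / c
  have hQ : 0 < Q := by positivity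
  set r₁ := min (1 / (2 * Λ)) (c / 4 / (2 * (Λ * C))) * (c / 4 / 2)
  set r₂ := min (1 / (2 * (K * Λ))) (1 / 2 / (2 * (K ^ 2 * Λ * C))) * (1 / 2 / 2)
  -- The rate in the probability: the smallest value allowed by the degree tests and by the heat
  -- tests.
  set r := min (min r₁ (c / 4 / (4 * Λ))) (min r₂ (1 / 2 / (4 * (K * Λ))))
  have hr : 0 < r := by positivity
  have hr1 : r ≤ r₁ := (min_le_left _ _).trans (min_le_left _ _)
  have hr2 : 4 * Λ * r ≤ c / 4 := by
    have : r ≤ c / 4 / (4 * Λ) := (min_le_left _ _).trans (min_le_right _ _)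
    rwa [le_div_iff₀ (by positivity), mul_comm] at this
  have hr3 : r ≤ r₂ := (min_le_right _ _).trans (min_le_left _ _)
  have hr4 : 4 * (K * Λ) * r ≤ 1 / 2 := by
    have : r ≤ 1 / 2 / (4 * (K * Λ)) := (min_le_right _ _).trans (min_le_right _ _)
    rwa [le_div_iff₀ (by positivity), mul_comm] at this
  refine ⟨1 / 2, r, Q * 2 ^ (d + 2), by norm_num, by norm_num, hr, by positivity, ?_⟩
  intro ρ α hρ _ _ hρα n ε hn hε hε1 _ x₀ m R lam hx₀ hm hR _ hlam hlam1 S _ P _ X hX hind hlaw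
  have : NeZero n := ⟨by omega⟩
  have hn2 : (2 : ℝ) ≤ n := by exact_mod_cast hn
  have hm2 : (2 : ℝ) ≤ m := by exact_mod_cast hm
  -- In this case `12 m n ^ 2 exp (-1) ≥ 1`, so the probability bound is vacuous and the empty event
  -- serves.
  by_cases htriv : r * n * ε ^ d * lam ^ 2 < 1
  · refine ⟨∅, MeasurableSet.empty, ?_, fun ω hω => absurd hω (Set.notMem_empty ω)⟩
    rw [measureReal_empty]
    have h1 : Real.exp (-1) ≤ Real.exp (-(r * n * ε ^ d * lam ^ 2)) :=
      Real.exp_le_exp.2 (by linarith)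
    have h2 : (1 / 4 : ℝ) ≤ Real.exp (-1) := by
      have := Real.exp_one_lt_d9
      rw [Real.exp_neg, ← one_div, div_le_div_iff₀ (by norm_num) (Real.exp_pos 1)]
      linarith
    have h3 : (4 : ℝ) ≤ 12 * m * n ^ 2 := by nlinarith
    nlinarith
  have hμprob : IsProbabilityMeasure (densityLaw Ω ρ) := by
    rw [← hlaw 0]
    exact Measure.isProbabilityMeasure_map (hX 0).aemeasurable
  set μ := densityLaw Ω ρ
  have hΩm := hΩ.isOpen.measurableSet
  have hρm := hρα.aemeasurable hΩ.isOpen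
  have hcomp : IsComparable μ Ω ρmin ρmax := densityLaw_isComparable hΩm hρmin hρ
  have hw : IsScaledKernel (d := d) (etaAt η ε) ε Λ κ δ := hη.isScaledKernel hδ0 hδ1 hδ hε
  have hae : ∀ᵐ y ∂μ, y ∈ Ω := hcomp.ae_mem
  have hdeg : ∀ x ∈ Ω, c ≤ kernelDeg μ (etaAt η ε) x := by
    intro x hx
    obtain ⟨p, hp⟩ := hcork x hx (δ * ε) (by positivity) (mul_le_one₀ hδ1 hε.le hε1)
    exact le_kernelDeg_of_ball_subset hcomp hw hθ0 hp
  have hC : ∀ x, kernelDeg μ (etaAt η ε) x ≤ C :=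
    kernelDeg_le_of_isComparable hcomp hw hρmax.le hη0.le
  have hheat : ∀ x, Metric.ball x R ⊆ Ω → ∀ j, j + 1 ≤ m → ∀ z, ∀ y ∈ Ω, dist z y ≤ ε →
      (hw.heat μ hc j x : Pt d → ℝ) y ≤ K * tailScale d ε j (dist x z) :=
    fun x hball j hj z y hy hzy => heat_le_mul_tailScale hw hc hη0 hdeg hC hae hK₁
      (hdiag μ Ω hcomp _ ε hw hε1 hdeg hC x R m hball hR j hj) z hy hzy
  obtain ⟨A, hA, hPA, hgood⟩ := exists_event_isPerturbation hw hc hX hind hlaw hΩm hae hdeg hC hη0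
    hC0 hK hx₀ hm hheat hlam hlam1 hr1 hr2 hr3 hr4 (not_lt.1 htriv)
  refine ⟨A, hA, hPA, fun ω hω x hx hball i k hk hkm => ?_⟩
  have hpert := (hgood ω hω).2 x hx hball
  obtain ⟨l, rfl⟩ : ∃ l, k = l + 1 := ⟨k - 1, by omega⟩
  have hmain := hpert.abs_heatKernel_sub_le hkm (by omega) (Set.mem_range_self i)
  rw [heatKernel_eq_adjWalk, rhoHat_eq_kernelDeg hΩm hρmin hρ hρm,
    averaging_eq_adjWalk hΩm hρmin hρ hρm, Nat.add_sub_cancel]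
  refine hmain.trans ?_
  have hphi := errorScale_le_phiError hd hε (Nat.le_add_left 1 l) (x - X i ω)
  rw [← dist_eq_norm] at hphi
  have hE := Real.exp_pos (-R ^ 2 / (4 * d * epsK ε (l + 1) ^ 2))
  calc Q * (lam * errorScale d ε (l + 1) (dist x (X i ω)))
      ≤ Q * (lam * (2 ^ (d + 2) * ((ε ^ d)⁻¹ * phiError ε (l + 1) (x - X i ω)))) := by gcongr
    -- The `phiError` term already dominates; the exponential term in `R` is only used as a
    -- nonnegative quantity.
    _ = Q * 2 ^ (d + 2) * (lam * (ε ^ d)⁻¹ * phiError ε (l + 1) (x - X i ω) + 0) := by ring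
    _ ≤ _ := by
        gcongr
        positivity
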